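/- Let $B\ge 1$, let $S_0$ be a unitary $2B\times 2B$ matrix, and let $\vec L=(L_1,\dots,L_B)$ be a vector of positive bond lengths that is linearly independent over $\mathbb{Q}$, with mean $\bar L=(L_1+\dots+L_B)/B$. For $\vec x\in\mathbb{R}^B$ write $e^{i\vec x}=\mathrm{diag}(e^{ix_1},\dots,e^{ix_B},e^{ix_1},\dots,e^{ix_B})$, and put $L=\mathrm{diag}(\vec L,\vec L)$. Let $0<\lambda_1\le\lambda_2\le\cdots$ be the positive solutions, with multiplicity, of $\det(I-e^{i\lambda\vec L}S_0)=0$. A choice of eigenvectors assigns to every $D=e^{i\vec x}$ an orthonormal basis $\psi_1(D),\dots,\psi_{2B}(D)$ of $\mathbb{C}^{2B}$ consisting of eigenvectors of $DS_0$. It is called regular if there is a closed subset $U$ of the torus $\{e^{i\vec x}\}$, invariant under $D\mapsto cD$ ($|c|=1$), of measure zero, and such that $\{t\in\mathbb{R}: e^{it\vec L}\in U\}$ has measure zero, with the following property: for all $D\notin U$, the bases chosen at $D$ and at $cD$ ($|c|=1$) agree up to order and phases, and the chosen basis is continuous at $D$ up to order and phases. Given a choice, put $\psi_k(\lambda)=\psi_k(e^{i\lambda\vec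 L})$, and let $\phi_n$ be the chosen eigenvector of $e^{i\lambda_n\vec L}S_0$ with eigenvalue $1$ that belongs to $\lambda_n$ (at a multiple $\lambda_n$, each chosen basis vector of the eigenspace is used once). 1. There is a regular choice of eigenvectors. If $DS_0$ has $2B$ distinct eigenvalues for at least one $D$, then every choice of eigenvectors is regular. 2. For every regular choice, every $2B\times 2B$ complex matrix $A$ and every integer $m\ge 0$, the averages below are well defined, both limits exist, and $$\lim_{N\to\infty}\frac1N\sum_{n=1}^N\frac{\langle\phi_n|A|\phi_n\rangle^m}{\langle\phi_n|L|\phi_n\rangle/\bar L} =\lim_{\Lambda\to\infty}\frac1\Lambda\int_0^\Lambda\frac1{2B}\sum_{k=1}^{2B}\langle\psi_k(\lambda)|A|\psi_k(\lambda)\rangle^m\,d\lambda =\mathbb{E}\Big[\frac1{2B}\sum_{k=1}^{2B}\langle\psi_k(D)|A|\psi_k(D)\rangle^m\Big],$$ where $D=e^{i\vec X}$ with $\vec X$ uniformly distributed on $[0,2\pi)^B$. -/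

import Mathlib

open MeasureTheory Filter Topology Matrix

noncomputable section

namespace QuantumGraph

/-- Directed bonds of a graph with `B` bonds: every bond in each of its two directions. -/
abbrev DirBond (B : ℕ) : Type := Fin B ⊕ Fin B

/-- The torus `𝕋^B`, as the group of `B`-tuples of unit complex numbers. -/
abbrev Torus (B : ℕ) : Type := Fin B → Circle

/-- The point `(e^{i x_1}, …, e^{i x_B})` of the torus. -/
def expTorus {B : ℕ} (x : Fin B → ℝ) : Torus B := fun b => Circle.exp (x b)

/-- The point `e^{i t L}` that the linear flow with velocity `L`, started at the identity,
reaches at time `t`. -/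
def flow {B : ℕ} (L : Fin B → ℝ) (t : ℝ) : Torus B := expTorus fun b => t * L b

/-- The uniform probability distribution on `[0, 2π)^B`. -/
def uniformTorus (B : ℕ) : Measure (Fin B → ℝ) :=
  ProbabilityTheory.cond volume (Set.univ.pi fun _ => Set.Ico 0 (2 * Real.pi))

/-- The `2B × 2B` matrix `D = diag(z_1, …, z_B, z_1, …, z_B)`. -/
def phaseMatrix {B : ℕ} (z : Torus B) : Matrix (DirBond B) (DirBond B) ℂ :=
  Matrix.diagonal (Sum.elim (fun b => (z b : ℂ)) (fun b => (z b : ℂ)))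

/-- The matrix `D S₀`; at `z = flow L t` it is `e^{i t L} S₀`. -/
def evolution {B : ℕ} (S₀ : Matrix (DirBond B) (DirBond B) ℂ) (z : Torus B) :
    Matrix (DirBond B) (DirBond B) ℂ :=
  phaseMatrix z * S₀

/-- `⟨v | A | v⟩`. -/
def expectation {B : ℕ} (A : Matrix (DirBond B) (DirBond B) ℂ) (v : DirBond B → ℂ) : ℂ :=
  star v ⬝ᵥ (A *ᵥ v)

/-- The bond-length observable `diag(L_1, …, L_B, L_1, …, L_B)`. -/
def bondLength {B : ℕ} (L : Fin B → ℝ) : Matrix (DirBond B) (DirBond B) ℂ :=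
  Matrix.diagonal (Sum.elim (fun b => (L b : ℂ)) (fun b => (L b : ℂ)))

/-- The mean bond length. -/
def meanLength {B : ℕ} (L : Fin B → ℝ) : ℝ := (∑ b, L b) / B

/-- The rank-one matrix `|v⟩⟨v|`. For unit vectors it determines `v` exactly up to a phase. -/
def rankOne {B : ℕ} (v : DirBond B → ℂ) : Matrix (DirBond B) (DirBond B) ℂ :=
  Matrix.vecMulVec v (star v)

/-- `v` is an orthonormal basis of `ℂ^{2B}` that consists of eigenvectors of `M`. -/
def IsEigenbasis {B : ℕ} (M : Matrix (DirBond B) (DirBond B) ℂ)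
    (v : DirBond B → DirBond B → ℂ) : Prop :=
  (∀ i j, star (v i) ⬝ᵥ v j = if i = j then 1 else 0) ∧
    ∀ j, ∃ μ : ℂ, M *ᵥ v j = μ • v j

/-- A choice of eigenvectors: to every point `z` of the torus it assigns an orthonormal basis
`(ψ z j)_j` of eigenvectors of `D S₀`. -/
def IsEigenvectorChoice {B : ℕ} (S₀ : Matrix (DirBond B) (DirBond B) ℂ)
    (ψ : Torus B → DirBond B → DirBond B → ℂ) : Prop :=
  ∀ z, IsEigenbasis (evolution S₀ z) (ψ z)

/-- Regularity of a choice of eigenvectors. There is a negligible exceptional set `U`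
(closed, invariant under multiplication of `D` by a scalar phase, null for the uniform measure,
and met by the flow at a null set of times only), outside of which

* the chosen eigenvectors of `D S₀` and of `c D S₀`, where `c` is a scalar phase, are the same
  up to phases and order;
* the chosen eigenvectors depend continuously on the point, up to phases and order. -/
def IsRegularChoice {B : ℕ} (L : Fin B → ℝ) (ψ : Torus B → DirBond B → DirBond B → ℂ) :
    Prop :=
  ∃ U : Set (Torus B),
    IsClosed U ∧
    (∀ (c : Circle), ∀ z ∈ U, (fun b => c * z b) ∈ U) ∧
    uniformTorus B {x | expTorus x ∈ U} = 0 ∧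
    volume {t : ℝ | flow L t ∈ U} = 0 ∧
    (∀ z ∉ U, ∀ c : Circle, ∃ σ : Equiv.Perm (DirBond B), ∀ j,
      rankOne (ψ (fun b => c * z b) j) = rankOne (ψ z (σ j))) ∧
    (∀ z ∉ U, ∃ σ : Torus B → Equiv.Perm (DirBond B), ∀ j,
      ContinuousAt (fun w => rankOne (ψ w (σ w j))) z)

/-- All `2B` eigenvalues of `M` are distinct. -/
def HasSimpleSpectrum {B : ℕ} (M : Matrix (DirBond B) (DirBond B) ℂ) : Prop :=
  M.charpoly.roots.Nodup

/-- The `λ`-spectrum as a set: the positive solutions of `det (1 - e^{i t L} S₀) = 0`. -/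
def lambdaSpectrum {B : ℕ} (S₀ : Matrix (DirBond B) (DirBond B) ℂ) (L : Fin B → ℝ) : Set ℝ :=
  {t | 0 < t ∧ (1 - evolution S₀ (flow L t)).det = 0}

/-- `lam 0 ≤ lam 1 ≤ …` lists the `λ`-spectrum with multiplicity, and
`ψ (flow L (lam n)) (j n)` is the eigenvector of `e^{i (lam n) L} S₀` for the eigenvalue `1`
that belongs to `lam n`: every pair of a point `t` of the `λ`-spectrum and a chosen basis vector
of the eigenspace of `e^{i t L} S₀` for the eigenvalue `1` is listed exactly once. -/
def IsSpectralSequence {B : ℕ} (S₀ : Matrix (DirBond B) (DirBond B) ℂ) (L : Fin B → ℝ)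
    (ψ : Torus B → DirBond B → DirBond B → ℂ) (lam : ℕ → ℝ) (j : ℕ → DirBond B) : Prop :=
  Monotone lam ∧
    Set.BijOn (fun n => (lam n, j n)) Set.univ
      {p : ℝ × DirBond B | p.1 ∈ lambdaSpectrum S₀ L ∧
        evolution S₀ (flow L p.1) *ᵥ ψ (flow L p.1) p.2 = ψ (flow L p.1) p.2}

/-- The mean of the `m`-th powers of the expectations of `A` over a family of `2B` vectors. -/
def meanMoment {B : ℕ} (A : Matrix (DirBond B) (DirBond B) ℂ) (m : ℕ)
    (v : DirBond B → DirBond B → ℂ) : ℂ :=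
  (2 * (B : ℂ))⁻¹ * ∑ k, expectation A (v k) ^ m

end QuantumGraph

end

open MeasureTheory Filter Topology Matrix

noncomputable section

namespace QuantumGraph

/-! ### The torus: uniform measure, monomials, equidistribution of the linear flow -/

section Torus

/-! Along the flow `t ↦ e^{itL}` an eigenvalue of `e^{itL} S₀` turns round the circle with angular
velocity `⟨ψ|L|ψ⟩`, and the `λ_n` are the times at which an eigenvalue passes through `1`. Counting
passages therefore samples eigenvectors with weight `⟨ψ|L|ψ⟩`; dividing by this weight restores the
uniform mean over the basis.

To make this precise, fix a small `h` and smooth each spectral point by a tent of half-width `h`. If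
a branch with projection `P`, eigenvalue `μ` and velocity `ℓ = ⟨L⟩` passes `1` at time `t + s`, then
`|s|` is close to (distance of `μ` from `1`) / `ℓ`. Hence `∑ tent h (λ_n - t) g(P_n)` is close to
the sum over the basis at time `t` of `g(P_k)` times a tent of half-width `hℓ_k` evaluated at `μ_k`.
The latter sum, `smoothDensity`, is a function on the torus evaluated along the flow. Weyl
equidistribution, valid because `L` is independent over `ℚ`, turns its time average into a torus
integral (`tendsto_timeAverage`). The uniform measure is invariant under `D ↦ cD`, which keeps the
projections and multiplies the eigenvalues by `c`; averaging over `c` replaces each tent by `hℓ_k /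
2π` (`integral_sum_phaseTent`). With `g = F / ℓ` the `ℓ_k` cancels, which gives `λ_N⁻¹ ∑_{n<N}
F(P_n)/ℓ_n → (2π)⁻¹ ∫ ∑_k F(P_k)` (`tendsto_spectralSum`). The choice `F = ⟨A⟩^m`, divided by the
choice `F = ℓ`, which is Weyl's law for `N / λ_N`, is the claim.

The error of the smoothing must be small compared with `h`. It is therefore always bounded by a
coefficient times the number of eigenvalues within `O(h)` of `1`, whose time average is itself
`O(h)`. Where the eigenbases vary continuously the coefficient is small; near the exceptional set it
is merely bounded, but a phase invariant cutoff of small integral confines that region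
(`exists_smoothing_bound`). That the spectrum has boundedly many points in short windows comes from
`exists_spacing`: fixed vectors at nearby times are almost orthogonal for the weight `L`.

For the existence of regular choices, simplicity of the spectrum is the nonvanishing of a
discriminant that is analytic along the flow. If it is nonzero somewhere, its zeros are null on each
orbit, since orbits are dense, and null on the torus by Fubini. Off the zeros eigenbases are unique
up to order and phases, hence continuous by compactness. If `DS₀` is degenerate everywhere, the same
argument is applied to a Hermitian family in its commutant that is generically nondegenerate; such a
family is obtained by a polynomial projection onto the kernel of `X ↦ MXM⁻¹ - X`
(`exists_commuting_family`). -/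

instance : MeasurableSpace Circle := borel Circle

instance : BorelSpace Circle := ⟨rfl⟩

instance : SecondCountableTopology Circle :=
  inferInstanceAs (SecondCountableTopology (Metric.sphere (0 : ℂ) 1))

variable {B : ℕ}

theorem continuous_expTorus : Continuous (expTorus : (Fin B → ℝ) → Torus B) := by
  unfold expTorus; fun_prop

theorem continuous_flow (L : Fin B → ℝ) : Continuous (flow L) := by
  unfold flow; exact continuous_expTorus.comp (by fun_prop)

theorem flow_add (L : Fin B → ℝ) (s t : ℝ) : flow L (s + t) = flow L s * flow L t := by
  funext b
  simp [flow, expTorus, add_mul, Circle.exp_add]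

instance : IsProbabilityMeasure (uniformTorus B) := by
  unfold uniformTorus
  refine ProbabilityTheory.cond_isProbabilityMeasure_of_finite ?_ ?_
  · rw [Real.volume_pi_Ico]
    simp [Real.pi_pos]
  · rw [Real.volume_pi_Ico]
    exact ENNReal.prod_ne_top fun _ _ => ENNReal.ofReal_ne_top

/-- The uniform distribution on the torus. -/
def torusMeasure (B : ℕ) : Measure (Torus B) := (uniformTorus B).map expTorus

instance : IsProbabilityMeasure (torusMeasure B) :=
  Measure.isProbabilityMeasure_map continuous_expTorus.measurable.aemeasurable

theorem torusMeasure_eq_zero_iff {U : Set (Torus B)} (hU : MeasurableSet U) :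
    torusMeasure B U = 0 ↔ uniformTorus B {x | expTorus x ∈ U} = 0 := by
  rw [torusMeasure, Measure.map_apply continuous_expTorus.measurable hU]
  rfl

/-- The monomial `∏ z_b ^ n_b` on the torus. -/
def torusMonomial (n : Fin B → ℤ) : C(Torus B, ℂ) where
  toFun z := ∏ b, ((z b ^ n b : Circle) : ℂ)
  continuous_toFun := continuous_finsetProd _ fun b _ =>
    have h : Continuous fun z : Torus B => z b ^ n b :=
      (continuous_zpow (G := Circle) (n b)).comp (continuous_apply b)
    continuous_subtype_val.comp h

theorem torusMonomial_apply (n : Fin B → ℤ) (z : Torus B) :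
    torusMonomial n z = ∏ b, ((z b ^ n b : Circle) : ℂ) := rfl

theorem torusMonomial_mul (n : Fin B → ℤ) (z w : Torus B) :
    torusMonomial n (z * w) = torusMonomial n z * torusMonomial n w := by
  simp [torusMonomial_apply, _root_.mul_zpow, Finset.prod_mul_distrib]

theorem torusMonomial_expTorus (n : Fin B → ℤ) (x : Fin B → ℝ) :
    torusMonomial n (expTorus x) = ∏ b, Complex.exp ((n b * Complex.I) * x b) := by
  rw [torusMonomial_apply]
  refine Finset.prod_congr rfl fun b _ => ?_
  rw [expTorus, Circle.coe_zpow, Circle.coe_exp, ← Complex.exp_int_mul]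
  ring_nf

/-- Stone–Weierstrass: monomials are closed under products and under conjugation, which negates the
exponents, and the coordinates separate points. -/
theorem span_torusMonomial_closure_eq_top :
    (Submodule.span ℂ (Set.range (torusMonomial (B := B)))).topologicalClosure = ⊤ := by
  let A : StarSubalgebra ℂ C(Torus B, ℂ) :=
    { toSubalgebra := Algebra.adjoin ℂ (Set.range torusMonomial)
      star_mem' := by
        change Algebra.adjoin ℂ (Set.range torusMonomial) ≤
          star (Algebra.adjoin ℂ (Set.range torusMonomial))
        refine Algebra.adjoin_le ?_
        rintro _ ⟨n, rfl⟩
        refine Algebra.subset_adjoin ⟨-n, ?_⟩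
        ext z
        simp [torusMonomial_apply, ← Circle.coe_inv_eq_conj] }
  have hspan : A.toSubalgebra.toSubmodule =
      Submodule.span ℂ (Set.range (torusMonomial (B := B))) := by
    apply Algebra.adjoin_eq_span_of_subset
    refine .trans (fun x ↦ Submonoid.closure_induction (fun _ ↦ id) ⟨0, ?_⟩ ?_)
      Submodule.subset_span
    · ext z
      simp [torusMonomial_apply]
    · rintro _ _ _ _ ⟨m, rfl⟩ ⟨n, rfl⟩
      refine ⟨m + n, ?_⟩
      ext z
      simp [torusMonomial_apply, zpow_add₀, Finset.prod_mul_distrib]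
  have hsep : A.SeparatesPoints := by
    intro z w hzw
    obtain ⟨i, hi⟩ := Function.ne_iff.1 hzw
    refine ⟨_, ⟨torusMonomial (Pi.single i 1), Algebra.subset_adjoin ⟨_, rfl⟩, rfl⟩, ?_⟩
    have key : ∀ z : Torus B, torusMonomial (Pi.single i 1) z = z i := by
      intro z
      rw [torusMonomial_apply, Finset.prod_eq_single i]
      · simp
      · intro j _ hj
        simp [hj]
      · simp
    simpa [key, Circle.coe_inj] using hi
  rw [← hspan]
  exact congr_arg (Subalgebra.toSubmodule <| StarSubalgebra.toSubalgebra ·)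
    (ContinuousMap.starSubalgebra_topologicalClosure_eq_top_of_separatesPoints A hsep)

/-- A property of continuous functions on the torus holds for all of them as soon as it holds for
monomials, is linear and closed under uniform approximation. -/
theorem torus_induction {p : C(Torus B, ℂ) → Prop} (f : C(Torus B, ℂ))
    (hmon : ∀ n, p (torusMonomial n)) (hzero : p 0) (hadd : ∀ f g, p f → p g → p (f + g))
    (hsmul : ∀ (c : ℂ) f, p f → p (c • f))
    (hclosed : ∀ f, (∀ ε > 0, ∃ g, p g ∧ ‖f - g‖ < ε) → p f) : p f := by
  have hspan : ∀ g ∈ Submodule.span ℂ (Set.range (torusMonomial (B := B))), p g := by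
    intro g hg
    induction hg using Submodule.span_induction with
    | mem g hg => obtain ⟨n, rfl⟩ := hg; exact hmon n
    | zero => exact hzero
    | add f g _ _ hf hg => exact hadd f g hf hg
    | smul c f _ hf => exact hsmul c f hf
  refine hclosed f fun ε hε => ?_
  have hf : f ∈ (Submodule.span ℂ (Set.range (torusMonomial (B := B)))).topologicalClosure := by
    rw [span_torusMonomial_closure_eq_top]; trivial
  obtain ⟨g, hg, hd⟩ := Metric.mem_closure_iff.1
    ((Submodule.mem_closure_iff (s := Submodule.span ℂ (Set.range (torusMonomial (B := B))))).1 hf)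
    ε hε
  exact ⟨g, hspan g hg, by rwa [← dist_eq_norm]⟩

theorem integral_torusMonomial {n : Fin B → ℤ} (hn : n ≠ 0) :
    ∫ z, torusMonomial n z ∂torusMeasure B = 0 := by
  rw [torusMeasure, integral_map continuous_expTorus.measurable.aemeasurable
    (torusMonomial n).continuous.aestronglyMeasurable]
  simp_rw [torusMonomial_expTorus]
  rw [uniformTorus, ProbabilityTheory.cond, integral_smul_measure, volume_pi,
    Measure.restrict_pi_pi]
  obtain ⟨b, hb⟩ := Function.ne_iff.1 hn
  rw [integral_fintype_prod_eq_prod (𝕜 := ℂ)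
    (f := fun b (x : ℝ) => Complex.exp ((n b * Complex.I) * x))]
  rw [Finset.prod_eq_zero (Finset.mem_univ b), smul_zero]
  rw [integral_Ico_eq_integral_Ioc, ← intervalIntegral.integral_of_le (by positivity)]
  have hc : ((n b : ℂ) * Complex.I) ≠ 0 := by simpa using hb
  rw [integral_exp_mul_complex hc]
  have : Complex.exp ((n b * Complex.I) * ((2 * Real.pi : ℝ) : ℂ)) = 1 := by
    rw [Complex.exp_eq_one_iff]
    exact ⟨n b, by push_cast; ring⟩
  rw [this]; simp

theorem torusMonomial_flow (n : Fin B → ℤ) (L : Fin B → ℝ) (t : ℝ) :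
    torusMonomial n (flow L t) = Complex.exp (((∑ b, n b * L b : ℝ) * Complex.I) * t) := by
  rw [flow, torusMonomial_expTorus, ← Complex.exp_sum]
  congr 1
  push_cast
  rw [Finset.sum_mul, Finset.sum_mul]
  refine Finset.sum_congr rfl fun b _ => ?_
  ring

/-- The frequency of a nontrivial monomial along the flow. Its nonvanishing makes the time average
of the monomial decay, and is the way rational independence enters Weyl's theorem. -/
theorem sum_int_mul_ne_zero {L : Fin B → ℝ} (hL : LinearIndependent ℚ L) {n : Fin B → ℤ}
    (hn : n ≠ 0) : ∑ b, (n b : ℝ) * L b ≠ 0 := by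
  intro h
  apply hn
  rw [Fintype.linearIndependent_iff] at hL
  funext b
  have := hL (fun b => (n b : ℚ)) (by simpa [Rat.smul_def] using h) b
  exact_mod_cast this

/-- Integrals of continuous functions over the torus are limits of time averages. -/
theorem tendsto_timeAverage_of_continuous {L : Fin B → ℝ} (hL : LinearIndependent ℚ L)
    (f : C(Torus B, ℂ)) :
    Tendsto (fun Λ : ℝ => (Λ : ℂ)⁻¹ * ∫ t in (0 : ℝ)..Λ, f (flow L t)) atTop
      (𝓝 (∫ z, f z ∂torusMeasure B)) := by
  have hInt : ∀ (f : C(Torus B, ℂ)) (a b : ℝ),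
      IntervalIntegrable (fun t => f (flow L t)) volume a b := fun f a b =>
    (f.continuous.comp (continuous_flow L)).intervalIntegrable a b
  have hInt' : ∀ f : C(Torus B, ℂ), Integrable f (torusMeasure B) := fun f =>
    f.continuous.integrable_of_hasCompactSupport (HasCompactSupport.of_compactSpace f)
  induction f using torus_induction with
  | hmon n =>
    by_cases hn : n = 0
    · subst hn
      have : ∀ z, torusMonomial (0 : Fin B → ℤ) z = 1 := fun z => by simp [torusMonomial_apply]
      simp only [this]
      simp only [intervalIntegral.integral_const, integral_const, probReal_univ, sub_zero]
      refine tendsto_const_nhds.congr' ?_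
      filter_upwards [eventually_gt_atTop 0] with Λ hΛ
      have : (Λ : ℂ) ≠ 0 := by exact_mod_cast hΛ.ne'
      simp [this]
    · rw [integral_torusMonomial hn]
      simp_rw [torusMonomial_flow]
      have hs := sum_int_mul_ne_zero hL hn
      set s : ℝ := ∑ b, (n b : ℝ) * L b
      have hc : ((s : ℂ) * Complex.I) ≠ 0 := by simpa using hs
      rw [tendsto_zero_iff_norm_tendsto_zero]
      have hlim : Tendsto (fun Λ : ℝ => Λ⁻¹ * (2 / |s|)) atTop (𝓝 0) := by
        simpa using tendsto_inv_atTop_zero.mul_const (2 / |s|)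
      refine squeeze_zero' (Eventually.of_forall fun _ => norm_nonneg _) ?_ hlim
      filter_upwards [eventually_gt_atTop 0] with Λ hΛ
      rw [integral_exp_mul_complex hc, norm_mul, norm_inv, Complex.norm_real, Real.norm_eq_abs,
        abs_of_pos hΛ, norm_div]
      gcongr
      · refine (norm_sub_le _ _).trans ?_
        have : ∀ t : ℝ, ‖Complex.exp (s * Complex.I * t)‖ = 1 := fun t => by
          rw [show (s : ℂ) * Complex.I * t = ((s * t : ℝ) : ℂ) * Complex.I by push_cast; ring]
          exact Complex.norm_exp_ofReal_mul_I _
        rw [this, this]; norm_num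
      · simp
  | hzero => simp
  | hadd f g hf hg =>
    have := hf.add hg
    simp only [ContinuousMap.add_apply]
    rw [integral_add (hInt' f) (hInt' g)]
    refine this.congr fun Λ => ?_
    rw [intervalIntegral.integral_add (hInt f _ _) (hInt g _ _)]
    ring
  | hsmul c f hf =>
    have := hf.const_mul c
    simp only [ContinuousMap.smul_apply, smul_eq_mul]
    rw [integral_const_mul]
    refine this.congr fun Λ => ?_
    rw [intervalIntegral.integral_const_mul]
    ring
  | hclosed f h =>
    rw [Metric.tendsto_nhds]
    intro ε hε
    obtain ⟨g, hg, hfg⟩ := h (ε / 3) (by positivity)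
    have hpt : ∀ z, ‖f z - g z‖ ≤ ε / 3 := fun z =>
      ((f - g).norm_coe_le_norm z).trans hfg.le
    filter_upwards [Metric.tendsto_nhds.1 hg (ε / 3) (by positivity), eventually_gt_atTop 0]
      with Λ h1 hΛ
    have h2 : ‖(Λ : ℂ)⁻¹ * (∫ t in (0 : ℝ)..Λ, f (flow L t)) -
        (Λ : ℂ)⁻¹ * ∫ t in (0 : ℝ)..Λ, g (flow L t)‖ ≤ ε / 3 := by
      rw [← mul_sub, ← intervalIntegral.integral_sub (hInt f _ _) (hInt g _ _), norm_mul, norm_inv,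
        Complex.norm_real, Real.norm_eq_abs, abs_of_pos hΛ]
      have := intervalIntegral.norm_integral_le_of_norm_le_const (a := (0 : ℝ)) (b := Λ)
        (f := fun t => f (flow L t) - g (flow L t)) (C := ε / 3) fun t _ => hpt _
      rw [sub_zero, abs_of_pos hΛ] at this
      calc Λ⁻¹ * _ ≤ Λ⁻¹ * (ε / 3 * Λ) := by gcongr
        _ = ε / 3 := by field_simp
    have h3 : ‖(∫ z, g z ∂torusMeasure B) - ∫ z, f z ∂torusMeasure B‖ ≤ ε / 3 := by
      rw [← integral_sub (hInt' g) (hInt' f)]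
      refine (norm_integral_le_of_norm_le_const (C := ε / 3)
        (Eventually.of_forall fun z => ?_)).trans (by simp)
      rw [norm_sub_rev]; exact hpt z
    rw [dist_eq_norm] at h1 ⊢
    calc _ = ‖((Λ : ℂ)⁻¹ * (∫ t in (0 : ℝ)..Λ, f (flow L t)) -
          (Λ : ℂ)⁻¹ * ∫ t in (0 : ℝ)..Λ, g (flow L t)) +
          ((Λ : ℂ)⁻¹ * (∫ t in (0 : ℝ)..Λ, g (flow L t)) - ∫ z, g z ∂torusMeasure B) +
          ((∫ z, g z ∂torusMeasure B) - ∫ z, f z ∂torusMeasure B)‖ := by congr 1; ring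
      _ < ε := by
        refine (norm_add₃_le).trans_lt ?_
        linarith

/-- A translation multiplies a monomial by a constant, which is harmless: the constant is `1` for
the trivial monomial, and every other monomial has integral zero. -/
theorem integral_comp_mul_left_of_continuous (w : Torus B) (f : C(Torus B, ℂ)) :
    ∫ z, f (w * z) ∂torusMeasure B = ∫ z, f z ∂torusMeasure B := by
  have hInt : ∀ (w : Torus B) (f : C(Torus B, ℂ)),
      Integrable (fun z => f (w * z)) (torusMeasure B) := fun w f =>
    Continuous.integrable_of_hasCompactSupport (by fun_prop) (HasCompactSupport.of_compactSpace _)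
  have hInt' : ∀ f : C(Torus B, ℂ), Integrable f (torusMeasure B) := fun f =>
    f.continuous.integrable_of_hasCompactSupport (HasCompactSupport.of_compactSpace f)
  induction f using torus_induction with
  | hmon n =>
    simp only [torusMonomial_mul]
    rw [integral_const_mul]
    by_cases hn : n = 0
    · subst hn; simp [torusMonomial_apply]
    · rw [integral_torusMonomial hn, mul_zero]
  | hzero => simp
  | hadd f g hf hg =>
    simp only [ContinuousMap.add_apply]
    rw [integral_add (hInt w f) (hInt w g), integral_add (hInt' f) (hInt' g), hf, hg]
  | hsmul c f hf =>
    simp only [ContinuousMap.smul_apply, smul_eq_mul]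
    rw [integral_const_mul, integral_const_mul, hf]
  | hclosed f h =>
    refine eq_of_forall_dist_le fun ε hε => ?_
    obtain ⟨g, hg, hfg⟩ := h (ε / 2) (by positivity)
    have hpt : ∀ z, ‖f z - g z‖ ≤ ε / 2 := fun z =>
      ((f - g).norm_coe_le_norm z).trans hfg.le
    have h2 : dist (∫ z, f (w * z) ∂torusMeasure B) (∫ z, g (w * z) ∂torusMeasure B) ≤ ε / 2 := by
      rw [dist_eq_norm, ← integral_sub (hInt w f) (hInt w g)]
      exact (norm_integral_le_of_norm_le_const (C := ε / 2)
        (Eventually.of_forall fun z => hpt _)).trans (by simp)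
    have h3 : dist (∫ z, g z ∂torusMeasure B) (∫ z, f z ∂torusMeasure B) ≤ ε / 2 := by
      rw [dist_comm, dist_eq_norm, ← integral_sub (hInt' f) (hInt' g)]
      exact (norm_integral_le_of_norm_le_const (C := ε / 2)
        (Eventually.of_forall fun z => hpt _)).trans (by simp)
    rw [hg] at h2
    linarith [dist_triangle (∫ z, f (w * z) ∂torusMeasure B) (∫ z, g z ∂torusMeasure B)
      (∫ z, f z ∂torusMeasure B)]

instance : (torusMeasure B).IsMulLeftInvariant where
  map_mul_left_eq_self w := by
    have hm : Measurable (w * · : Torus B → Torus B) := (continuous_const_mul w).measurable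
    have : IsProbabilityMeasure ((torusMeasure B).map (w * ·)) :=
      Measure.isProbabilityMeasure_map hm.aemeasurable
    refine ext_of_forall_integral_eq_of_IsFiniteMeasure fun f => ?_
    rw [integral_map hm.aemeasurable f.continuous.aestronglyMeasurable]
    have := integral_comp_mul_left_of_continuous w
      ⟨fun z => ((f z : ℝ) : ℂ), Complex.continuous_ofReal.comp f.continuous⟩
    simp only [ContinuousMap.coe_mk] at this
    rw [integral_complex_ofReal, integral_complex_ofReal] at this
    exact_mod_cast this

instance : (torusMeasure B).IsOpenPosMeasure :=
  isOpenPosMeasure_of_mulLeftInvariant_of_compact Set.univ isCompact_univ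
    (by rw [measure_univ]; exact one_ne_zero)

theorem aestronglyMeasurable_of_continuousAt_compl {X E : Type*} [TopologicalSpace X]
    [MeasurableSpace X] [BorelSpace X] [SecondCountableTopology X] [TopologicalSpace.PseudoMetrizableSpace X]
    [TopologicalSpace E] [TopologicalSpace.PseudoMetrizableSpace E]
    {μ : Measure X} {U : Set X} (hU : IsClosed U) (h0 : μ U = 0) {f : X → E}
    (hf : ∀ x ∉ U, ContinuousAt f x) : AEStronglyMeasurable f μ := by
  have h : ContinuousOn f Uᶜ := fun x hx => (hf x hx).continuousWithinAt
  have h1 := h.aestronglyMeasurable (μ := μ) hU.isOpen_compl.measurableSet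
  rwa [Measure.restrict_eq_self_of_ae_mem] at h1
  rw [ae_iff]
  simpa using h0

theorem integrable_of_bounded_of_continuousAt_compl {X E : Type*} [TopologicalSpace X]
    [MeasurableSpace X] [BorelSpace X] [SecondCountableTopology X] [TopologicalSpace.PseudoMetrizableSpace X]
    [NormedAddCommGroup E] {μ : Measure X} [IsFiniteMeasure μ] {U : Set X} (hU : IsClosed U)
    (h0 : μ U = 0) {f : X → E} (hf : ∀ x ∉ U, ContinuousAt f x) {C : ℝ} (hC : ∀ x, ‖f x‖ ≤ C) :
    Integrable f μ :=
  Integrable.of_bound (aestronglyMeasurable_of_continuousAt_compl hU h0 hf) C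
    (Eventually.of_forall hC)

theorem intervalIntegrable_flow {L : Fin B → ℝ} {U : Set (Torus B)} (hU : IsClosed U)
    (h0 : volume {t : ℝ | flow L t ∈ U} = 0) {E : Type*} [NormedAddCommGroup E]
    {f : Torus B → E} (hf : ∀ z ∉ U, ContinuousAt f z)
    {C : ℝ} (hC : ∀ z, ‖f z‖ ≤ C) (a b : ℝ) :
    IntervalIntegrable (fun t => f (flow L t)) volume a b := by
  have hm : AEStronglyMeasurable (fun t => f (flow L t)) volume :=
    aestronglyMeasurable_of_continuousAt_compl (hU.preimage (continuous_flow L)) h0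
      fun t ht => (hf _ ht).comp (f := flow L) (continuous_flow L).continuousAt
  have hI : ∀ a b : ℝ, IntegrableOn (fun t => f (flow L t)) (Set.Ioc a b) volume := fun a b =>
    Measure.integrableOn_of_bounded (by simp) hm (Eventually.of_forall fun t => hC _)
  exact ⟨hI a b, hI b a⟩

/-- Multiplication of all coordinates by the same phase. -/
def rotate (c : Circle) (z : Torus B) : Torus B := fun b => c * z b

theorem rotate_eq_mul (c : Circle) (z : Torus B) : rotate c z = (fun _ => c) * z := rfl

theorem dist_circle_mul_left (c z w : Circle) : dist (c * z) (c * w) = dist z w := by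
  change dist ((c * z : Circle) : ℂ) ((c * w : Circle) : ℂ) = dist (z : ℂ) (w : ℂ)
  rw [dist_eq_norm, dist_eq_norm, Circle.coe_mul, Circle.coe_mul, ← mul_sub, norm_mul,
    Circle.norm_coe, one_mul]

theorem isometry_rotate (c : Circle) : Isometry (rotate c : Torus B → Torus B) := by
  refine Isometry.of_dist_eq fun z w => ?_
  refine le_antisymm ?_ ?_ <;> rw [dist_pi_le_iff dist_nonneg] <;> intro b
  · refine le_trans (le_of_eq ?_) (dist_le_pi_dist z w b)
    exact dist_circle_mul_left _ _ _
  · refine le_trans (le_of_eq ?_) (dist_le_pi_dist (rotate c z) (rotate c w) b)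
    exact (dist_circle_mul_left _ _ _).symm

theorem rotate_inv_rotate (c : Circle) (z : Torus B) : rotate c⁻¹ (rotate c z) = z := by
  funext b; simp [rotate]

/-- A continuous cutoff function of small integral around a closed null set, invariant under the
phases if the set is. -/
theorem exists_cutoff {U : Set (Torus B)} (hU : IsClosed U) (h0 : torusMeasure B U = 0)
    (hinv : ∀ (c : Circle), ∀ z ∈ U, rotate c z ∈ U) {ε : ℝ} (hε : 0 < ε) :
    ∃ ζ : C(Torus B, ℝ), (∀ z, 0 ≤ ζ z) ∧ (∀ z, ζ z ≤ 1) ∧ (∀ z ∈ U, ζ z = 1) ∧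
      (∀ c z, ζ (rotate c z) = ζ z) ∧ ∫ z, ζ z ∂torusMeasure B < ε := by
  have hpos : ∀ n : ℕ, 0 < 1 / ((n : ℝ) + 1) := fun n => by positivity
  let ζ : ℕ → Torus B → ℝ := fun n z => (thickenedIndicator (hpos n) U z : ℝ)
  have hcont : ∀ n, Continuous (ζ n) := fun n =>
    NNReal.continuous_coe.comp (thickenedIndicator (hpos n) U).continuous
  have hle : ∀ n z, ζ n z ≤ 1 := fun n z => by
    change (thickenedIndicator (hpos n) U z : ℝ) ≤ 1
    exact_mod_cast thickenedIndicator_le_one (hpos n) U z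
  have hnn : ∀ n z, 0 ≤ ζ n z := fun n z => NNReal.coe_nonneg _
  have hlim : Tendsto (fun n => ∫ z, ζ n z ∂torusMeasure B) atTop
      (𝓝 (∫ z, U.indicator (fun _ => (1 : ℝ)) z ∂torusMeasure B)) := by
    refine tendsto_integral_of_dominated_convergence (fun _ => 1)
      (fun n => (hcont n).aestronglyMeasurable) (integrable_const _)
      (fun n => Eventually.of_forall fun z => ?_) (Eventually.of_forall fun z => ?_)
    · rw [Real.norm_eq_abs, abs_of_nonneg (hnn n z)]; exact hle n z
    · have := (tendsto_pi_nhds.1 (thickenedIndicator_tendsto_indicator_closure hpos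
        tendsto_one_div_add_atTop_nhds_zero_nat U)) z
      rw [hU.closure_eq] at this
      have h2 := (NNReal.continuous_coe.tendsto _).comp this
      have h3 : U.indicator (fun _ => (1 : ℝ)) z =
          ((U.indicator (fun _ => (1 : NNReal)) z : NNReal) : ℝ) := by
        by_cases hz : z ∈ U <;> simp [hz]
      rw [h3]
      exact h2
  rw [integral_indicator_const _ hU.measurableSet, measureReal_def, h0] at hlim
  simp only [ENNReal.toReal_zero, smul_eq_mul, zero_mul] at hlim
  obtain ⟨n, hn⟩ := (hlim.eventually (gt_mem_nhds hε)).exists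
  refine ⟨⟨ζ n, hcont n⟩, hnn n, hle n, fun z hz => ?_, fun c z => ?_, hn⟩
  · change (thickenedIndicator (hpos n) U z : ℝ) = 1
    rw [thickenedIndicator_one (hpos n) U hz]; simp
  -- The cutoff depends only on the distance to `U`, and phases act by isometries that preserve `U`.
  · have himg : rotate c '' U = U := by
      ext z
      refine ⟨?_, fun hz => ⟨rotate c⁻¹ z, hinv _ _ hz, ?_⟩⟩
      · rintro ⟨w, hw, rfl⟩; exact hinv _ _ hw
      · simpa using rotate_inv_rotate c⁻¹ z
    have he : Metric.infEDist (rotate c z) U = Metric.infEDist z U := by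
      conv_lhs => rw [← himg]
      exact Metric.infEDist_image (isometry_rotate c)
    change (thickenedIndicator (hpos n) U (rotate c z) : ℝ) = thickenedIndicator (hpos n) U z
    rw [le_antisymm (thickenedIndicator_mono_infEDist (hpos n) he.ge)
      (thickenedIndicator_mono_infEDist (hpos n) he.le)]

/-- Time averages of bounded functions that are continuous off a negligible closed set. -/
theorem tendsto_timeAverage {L : Fin B → ℝ} (hL : LinearIndependent ℚ L) {U : Set (Torus B)}
    (hU : IsClosed U) (hinv : ∀ (c : Circle), ∀ z ∈ U, rotate c z ∈ U)
    (h0 : torusMeasure B U = 0) (hflow : volume {t : ℝ | flow L t ∈ U} = 0)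
    {f : Torus B → ℂ} (hf : ∀ z ∉ U, ContinuousAt f z) {C : ℝ} (hC : ∀ z, ‖f z‖ ≤ C) :
    Tendsto (fun Λ : ℝ => (Λ : ℂ)⁻¹ * ∫ t in (0 : ℝ)..Λ, f (flow L t)) atTop
      (𝓝 (∫ z, f z ∂torusMeasure B)) := by
  have hC0 : 0 ≤ C := (norm_nonneg _).trans (hC 1)
  rw [Metric.tendsto_nhds]
  intro ε hε
  obtain ⟨ζ, hζ0, hζ1, hζU, -, hζi⟩ := exists_cutoff hU h0 hinv
    (show 0 < ε / (4 * (C + 1)) by positivity)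
  -- The factor `1 - ζ` vanishes on `U` and `f` is bounded, so `g` is continuous everywhere. The
  -- difference `f - g` is at most `Cζ`, whose averages in time and over the torus are at most a
  -- quarter of `ε`.
  let g : Torus B → ℂ := fun z => ((1 - ζ z : ℝ) : ℂ) * f z
  have hfg : ∀ z, ‖f z - g z‖ ≤ C * ζ z := fun z => by
    have : f z - g z = (ζ z : ℂ) * f z := by simp only [g]; push_cast; ring
    rw [this, norm_mul, Complex.norm_real, Real.norm_eq_abs, abs_of_nonneg (hζ0 z), mul_comm]
    exact mul_le_mul_of_nonneg_right (hC z) (hζ0 z)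
  have hg : Continuous g := by
    rw [continuous_iff_continuousAt]
    intro z
    by_cases hz : z ∈ U
    · have hgz : g z = 0 := by simp [g, hζU z hz]
      rw [ContinuousAt, hgz]
      have hlim : Tendsto (fun w => (1 - ζ w) * C) (𝓝 z) (𝓝 0) := by
        have : Continuous fun w => (1 - ζ w) * C := by fun_prop
        simpa [hζU z hz] using this.tendsto z
      refine squeeze_zero_norm (fun w => ?_) hlim
      simp only [g]
      rw [norm_mul, Complex.norm_real, Real.norm_eq_abs, abs_of_nonneg (by linarith [hζ1 w])]
      exact mul_le_mul_of_nonneg_left (hC w) (by linarith [hζ1 w])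
    · have : ContinuousAt (fun w => ((1 - ζ w : ℝ) : ℂ)) z :=
        (Complex.continuous_ofReal.comp (by fun_prop)).continuousAt
      exact this.mul (hf z hz)
  have hfi : Integrable f (torusMeasure B) :=
    integrable_of_bounded_of_continuousAt_compl hU h0 hf hC
  have hgi : Integrable g (torusMeasure B) :=
    hg.integrable_of_hasCompactSupport (HasCompactSupport.of_compactSpace g)
  have hζint : Integrable ζ (torusMeasure B) :=
    ζ.continuous.integrable_of_hasCompactSupport (HasCompactSupport.of_compactSpace _)
  have e1 := Metric.tendsto_nhds.1 (tendsto_timeAverage_of_continuous hL ⟨g, hg⟩) (ε / 4)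
    (by positivity)
  have e2 := tendsto_timeAverage_of_continuous hL
    ⟨fun z => (ζ z : ℂ), Complex.continuous_ofReal.comp ζ.continuous⟩
  simp only [ContinuousMap.coe_mk, integral_complex_ofReal, intervalIntegral.integral_ofReal] at e1 e2
  have e3 : Tendsto (fun Λ : ℝ => Λ⁻¹ * ∫ t in (0 : ℝ)..Λ, ζ (flow L t)) atTop
      (𝓝 (∫ z, ζ z ∂torusMeasure B)) := by
    have := (Complex.continuous_re.tendsto _).comp e2
    rw [Complex.ofReal_re] at this
    refine this.congr fun Λ => ?_
    rw [Function.comp_apply, ← Complex.ofReal_inv, ← Complex.ofReal_mul, Complex.ofReal_re]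
  filter_upwards [e1, e3.eventually (gt_mem_nhds hζi), eventually_gt_atTop 0] with Λ h1 h2 hΛ
  have hii := intervalIntegrable_flow hU hflow hf hC 0 Λ
  have hgii : IntervalIntegrable (fun t => g (flow L t)) volume 0 Λ :=
    (hg.comp (continuous_flow L)).intervalIntegrable _ _
  have hζii : IntervalIntegrable (fun t => ζ (flow L t)) volume 0 Λ :=
    (ζ.continuous.comp (continuous_flow L)).intervalIntegrable _ _
  have hsmall : C * (ε / (4 * (C + 1))) ≤ ε / 4 := by
    rw [← mul_div_assoc, div_le_div_iff₀ (by positivity) (by positivity)]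
    nlinarith
  have hA : ‖(Λ : ℂ)⁻¹ * (∫ t in (0 : ℝ)..Λ, f (flow L t)) -
      (Λ : ℂ)⁻¹ * ∫ t in (0 : ℝ)..Λ, g (flow L t)‖ ≤ ε / 4 := by
    rw [← mul_sub, ← intervalIntegral.integral_sub hii hgii, norm_mul, norm_inv,
      Complex.norm_real, Real.norm_eq_abs, abs_of_pos hΛ]
    have := intervalIntegral.norm_integral_le_of_norm_le hΛ.le
      (Eventually.of_forall fun t _ => hfg (flow L t)) (hζii.const_mul C)
    rw [intervalIntegral.integral_const_mul] at this
    calc _ ≤ Λ⁻¹ * (C * ∫ t in (0 : ℝ)..Λ, ζ (flow L t)) := by gcongr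
      _ = C * (Λ⁻¹ * ∫ t in (0 : ℝ)..Λ, ζ (flow L t)) := by ring
      _ ≤ C * (ε / (4 * (C + 1))) := by gcongr
      _ ≤ ε / 4 := hsmall
  have hB : ‖(∫ z, g z ∂torusMeasure B) - ∫ z, f z ∂torusMeasure B‖ ≤ ε / 4 := by
    rw [← integral_sub hgi hfi]
    refine (norm_integral_le_of_norm_le (hζint.const_mul C)
      (Eventually.of_forall fun z => ?_)).trans ?_
    · rw [norm_sub_rev]; exact hfg z
    · rw [integral_const_mul]
      exact le_trans (by gcongr) hsmall
  rw [dist_eq_norm] at h1 ⊢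
  calc _ = ‖((Λ : ℂ)⁻¹ * (∫ t in (0 : ℝ)..Λ, f (flow L t)) -
        (Λ : ℂ)⁻¹ * ∫ t in (0 : ℝ)..Λ, g (flow L t)) +
        ((Λ : ℂ)⁻¹ * (∫ t in (0 : ℝ)..Λ, g (flow L t)) - ∫ z, g z ∂torusMeasure B) +
        ((∫ z, g z ∂torusMeasure B) - ∫ z, f z ∂torusMeasure B)‖ := by congr 1; ring
    _ < ε := by
      refine (norm_add₃_le).trans_lt ?_
      linarith

end Torus

/-! ### Functions analytic along the flow and their zero sets -/

section OrbitAnalytic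

variable {B : ℕ}

/-- The algebra of continuous functions on the torus that are real analytic along all orbits of
the flow. -/
def orbitAnalytic (L : Fin B → ℝ) : Subalgebra ℂ (Torus B → ℂ) where
  carrier := {f | Continuous f ∧ ∀ z, AnalyticOnNhd ℝ (fun t => f (z * flow L t)) Set.univ}
  mul_mem' hf hg := ⟨hf.1.mul hg.1, fun z => (hf.2 z).mul (hg.2 z)⟩
  add_mem' hf hg := ⟨hf.1.add hg.1, fun z => (hf.2 z).add (hg.2 z)⟩
  algebraMap_mem' _ := ⟨continuous_const, fun _ => analyticOnNhd_const⟩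

theorem star_mem_orbitAnalytic {L : Fin B → ℝ} {f : Torus B → ℂ} (hf : f ∈ orbitAnalytic L) :
    (fun z => star (f z)) ∈ orbitAnalytic L :=
  ⟨continuous_star.comp hf.1, fun z t ht =>
    (Complex.conjCLE.toContinuousLinearMap.analyticAt _).comp (hf.2 z t ht)⟩

theorem coord_mem_orbitAnalytic (L : Fin B → ℝ) (b : Fin B) :
    (fun z : Torus B => (z b : ℂ)) ∈ orbitAnalytic L := by
  refine ⟨continuous_subtype_val.comp (continuous_apply b), fun z t _ => ?_⟩
  have h : (fun t : ℝ => (((z * flow L t) b : Circle) : ℂ)) =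
      fun t : ℝ => (z b : ℂ) * Complex.exp ((t * L b : ℝ) * Complex.I) := by
    funext t
    simp [flow, expTorus]
  rw [h]
  have h1 : AnalyticAt ℝ (fun t : ℝ => ((t * L b : ℝ) : ℂ) * Complex.I) t := by
    have : AnalyticAt ℝ (fun t : ℝ => ((t * L b : ℝ) : ℂ)) t :=
      (Complex.ofRealCLM.analyticAt _).comp (analyticAt_id.mul analyticAt_const)
    exact this.mul analyticAt_const
  have h2 : AnalyticAt ℝ Complex.exp (((t * L b : ℝ) : ℂ) * Complex.I) :=
    (analyticAt_cexp (z := ((t * L b : ℝ) : ℂ) * Complex.I)).restrictScalars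
  exact analyticAt_const.mul (h2.comp (f := fun t : ℝ => ((t * L b : ℝ) : ℂ) * Complex.I) h1)

/-- Evaluation at a point of the torus. -/
def evalAt (L : Fin B → ℝ) (z : Torus B) : orbitAnalytic L →+* ℂ :=
  (Pi.evalRingHom (fun _ : Torus B => ℂ) z).comp (orbitAnalytic L).val.toRingHom

/-- Every orbit of the flow is dense. -/
theorem eq_zero_of_orbit {L : Fin B → ℝ} (hL : LinearIndependent ℚ L) {f : Torus B → ℂ}
    (hf : Continuous f) {z : Torus B} (hz : ∀ t, f (z * flow L t) = 0) (w : Torus B) :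
    f w = 0 := by
  -- The time average of `‖f‖²` along the orbit is zero and converges to an integral over the torus;
  -- the measure charges open sets, so `f` vanishes identically.
  have hc : Continuous fun w => ‖f (z * w)‖ ^ 2 := by fun_prop
  have h := tendsto_timeAverage_of_continuous hL
    ⟨fun w => ((‖f (z * w)‖ ^ 2 : ℝ) : ℂ), Complex.continuous_ofReal.comp hc⟩
  simp only [ContinuousMap.coe_mk, hz, integral_complex_ofReal] at h
  simp only [norm_zero, ne_eq, OfNat.ofNat_ne_zero, not_false_eq_true, zero_pow,
    Complex.ofReal_zero, intervalIntegral.integral_zero, mul_zero] at h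
  have h0 : ∫ w, ‖f (z * w)‖ ^ 2 ∂torusMeasure B = 0 := by
    exact_mod_cast (tendsto_nhds_unique h tendsto_const_nhds)
  have hi : Integrable (fun w => ‖f (z * w)‖ ^ 2) (torusMeasure B) :=
    hc.integrable_of_hasCompactSupport (HasCompactSupport.of_compactSpace _)
  rw [integral_eq_zero_iff_of_nonneg (fun w => by positivity) hi] at h0
  have h1 := (hc.ae_eq_iff_eq (torusMeasure B) continuous_zero).1 h0
  have h2 := congrFun h1 (z⁻¹ * w)
  simpa using h2

/-- The orbit is dense, so `f` is not identically zero on it, and a nonzero analytic function of one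
real variable has isolated zeros. -/
theorem volume_orbit_zero {L : Fin B → ℝ} (hL : LinearIndependent ℚ L) {f : Torus B → ℂ}
    (hf : f ∈ orbitAnalytic L) {z₀ : Torus B} (h₀ : f z₀ ≠ 0) (z : Torus B) :
    volume {t : ℝ | f (z * flow L t) = 0} = 0 := by
  obtain ⟨t₀, ht₀⟩ : ∃ t, f (z * flow L t) ≠ 0 := by
    by_contra! h
    exact h₀ (eq_zero_of_orbit hL hf.1 h z₀)
  have h1 := (hf.2 z).preimage_zero_mem_codiscrete ht₀
  have h2 := ae_restrict_le_codiscreteWithin (μ := (volume : Measure ℝ)) MeasurableSet.univ h1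
  rw [Measure.restrict_univ] at h2
  have h3 := mem_ae_iff.1 h2
  convert h3 using 2
  ext t
  simp

theorem volume_flow_zero {L : Fin B → ℝ} (hL : LinearIndependent ℚ L) {f : Torus B → ℂ}
    (hf : f ∈ orbitAnalytic L) {z₀ : Torus B} (h₀ : f z₀ ≠ 0) :
    volume {t : ℝ | f (flow L t) = 0} = 0 := by
  simpa using volume_orbit_zero hL hf h₀ 1

/-- Fubini on `[0, 1] × 𝕋^B`: every orbit meets the zero set in a null set of times, while by
invariance every time slice has the measure of the zero set itself. -/
theorem torusMeasure_zero {L : Fin B → ℝ} (hL : LinearIndependent ℚ L) {f : Torus B → ℂ}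
    (hf : f ∈ orbitAnalytic L) {z₀ : Torus B} (h₀ : f z₀ ≠ 0) :
    torusMeasure B {z | f z = 0} = 0 := by
  have hclosed : IsClosed {z | f z = 0} := isClosed_eq hf.1 continuous_const
  set U := {z | f z = 0} with hU
  let ν : Measure ℝ := volume.restrict (Set.Icc 0 1)
  have hmeas : MeasurableSet {p : ℝ × Torus B | p.2 * flow L p.1 ∈ U} := by
    refine (hclosed.preimage ?_).measurableSet
    exact continuous_snd.mul ((continuous_flow L).comp continuous_fst)
  have h1 : (ν.prod (torusMeasure B)) {p : ℝ × Torus B | p.2 * flow L p.1 ∈ U} = 0 := by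
    rw [Measure.prod_apply_symm hmeas]
    have : ∀ z, ν ((fun t => (t, z)) ⁻¹' {p : ℝ × Torus B | p.2 * flow L p.1 ∈ U}) = 0 := by
      intro z
      refine le_antisymm ((Measure.restrict_apply_le _ _).trans ?_) (zero_le)
      exact (volume_orbit_zero hL hf h₀ z).le
    exact lintegral_eq_zero_of_ae_eq_zero (Eventually.of_forall this)
  rw [Measure.prod_apply hmeas] at h1
  have h2 : ∀ t : ℝ, torusMeasure B (Prod.mk t ⁻¹' {p : ℝ × Torus B | p.2 * flow L p.1 ∈ U}) =
      torusMeasure B U := by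
    intro t
    have := measure_preimage_mul (torusMeasure B) (flow L t) U
    rw [← this]
    congr 1
    ext z
    simp [mul_comm]
  simp only [h2, lintegral_const] at h1
  simpa [ν] using h1

end OrbitAnalytic

/-! ### Orthonormal eigenbases -/

section Eigenbasis

variable {B : ℕ} {M : Matrix (DirBond B) (DirBond B) ℂ} {v w : DirBond B → DirBond B → ℂ}

/-- The matrix whose columns are the given vectors. -/
def basisMatrix (v : DirBond B → DirBond B → ℂ) : Matrix (DirBond B) (DirBond B) ℂ :=
  Matrix.of fun i k => v k i

theorem basisMatrix_conjTranspose_mul_apply (v w : DirBond B → DirBond B → ℂ) (i j : DirBond B) :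
    ((basisMatrix v)ᴴ * basisMatrix w) i j = star (v i) ⬝ᵥ w j := rfl

theorem basisMatrix_conjTranspose_mulVec (v : DirBond B → DirBond B → ℂ) (x : DirBond B → ℂ)
    (k : DirBond B) : ((basisMatrix v)ᴴ *ᵥ x) k = star (v k) ⬝ᵥ x := rfl

theorem IsEigenbasis.conjTranspose_mul (h : IsEigenbasis M v) :
    (basisMatrix v)ᴴ * basisMatrix v = 1 := by
  ext i j
  rw [basisMatrix_conjTranspose_mul_apply, h.1, Matrix.one_apply]

theorem IsEigenbasis.mul_conjTranspose (h : IsEigenbasis M v) :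
    basisMatrix v * (basisMatrix v)ᴴ = 1 :=
  mul_eq_one_comm.1 h.conjTranspose_mul

theorem IsEigenbasis.star_dotProduct_self (h : IsEigenbasis M v) (k : DirBond B) :
    star (v k) ⬝ᵥ v k = 1 := by
  simpa using h.1 k k

/-- The eigenvalue of a basis vector is its expectation. -/
theorem IsEigenbasis.mulVec (h : IsEigenbasis M v) (k : DirBond B) :
    M *ᵥ v k = expectation M (v k) • v k := by
  obtain ⟨μ, hμ⟩ := h.2 k
  have : expectation M (v k) = μ := by
    rw [expectation, hμ, dotProduct_smul, h.star_dotProduct_self, smul_eq_mul, mul_one]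
  rw [this, hμ]

theorem IsEigenbasis.eq_expectation (h : IsEigenbasis M v) {k : DirBond B} {μ : ℂ}
    (hμ : M *ᵥ v k = μ • v k) : expectation M (v k) = μ := by
  rw [expectation, hμ, dotProduct_smul, h.star_dotProduct_self, smul_eq_mul, mul_one]

theorem IsEigenbasis.mul_basisMatrix (h : IsEigenbasis M v) :
    M * basisMatrix v = basisMatrix v * diagonal fun k => expectation M (v k) := by
  ext i k
  rw [Matrix.mul_diagonal]
  have := congrFun (h.mulVec k) i
  rw [Pi.smul_apply, smul_eq_mul, mul_comm] at this
  exact this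

theorem IsEigenbasis.eq_conj (h : IsEigenbasis M v) :
    M = basisMatrix v * (diagonal fun k => expectation M (v k)) * (basisMatrix v)ᴴ := by
  rw [← h.mul_basisMatrix, Matrix.mul_assoc, h.mul_conjTranspose, Matrix.mul_one]

theorem IsEigenbasis.roots_charpoly (h : IsEigenbasis M v) :
    M.charpoly.roots = Finset.univ.val.map fun k => expectation M (v k) := by
  have : M.charpoly = (diagonal fun k => expectation M (v k)).charpoly := by
    conv_lhs => rw [h.eq_conj]
    rw [Matrix.charpoly_mul_comm, ← Matrix.mul_assoc, h.conjTranspose_mul, Matrix.one_mul]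
  rw [this, Matrix.charpoly_diagonal, Polynomial.roots_prod _ _ (by
    simp [Finset.prod_ne_zero_iff, Polynomial.X_sub_C_ne_zero])]
  simp

theorem IsEigenbasis.hasSimpleSpectrum_iff (h : IsEigenbasis M v) :
    HasSimpleSpectrum M ↔ Function.Injective fun k => expectation M (v k) := by
  rw [HasSimpleSpectrum, h.roots_charpoly]
  constructor
  · intro hn i j hij
    exact Multiset.inj_on_of_nodup_map hn i (Finset.mem_univ i) j (Finset.mem_univ j) hij
  · intro hi
    exact Finset.univ.nodup.map hi

theorem IsEigenbasis.pow_mul_basisMatrix (h : IsEigenbasis M v) (p : ℕ) :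
    M ^ p * basisMatrix v = basisMatrix v * diagonal fun k => expectation M (v k) ^ p := by
  induction p with
  | zero => simp
  | succ p ih =>
    rw [pow_succ', Matrix.mul_assoc, ih, ← Matrix.mul_assoc, h.mul_basisMatrix, Matrix.mul_assoc,
      diagonal_mul_diagonal]
    simp only [_root_.pow_succ']

theorem IsEigenbasis.trace_pow (h : IsEigenbasis M v) (p : ℕ) :
    (M ^ p).trace = ∑ k, expectation M (v k) ^ p := by
  rw [← Matrix.mul_one (M ^ p), ← h.mul_conjTranspose, ← Matrix.mul_assoc, h.pow_mul_basisMatrix,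
    Matrix.trace_mul_comm, ← Matrix.mul_assoc, h.conjTranspose_mul, Matrix.one_mul,
    Matrix.trace_diagonal]

/-- The determinant of the Hankel matrix of the traces of powers: the discriminant of the
characteristic polynomial. -/
def traceDiscriminant {R : Type*} [CommRing R] (M : Matrix (DirBond B) (DirBond B) R) : R :=
  (Matrix.of fun a b : Fin (Fintype.card (DirBond B)) => (M ^ (a + b : ℕ)).trace).det

theorem map_traceDiscriminant {R S : Type*} [CommRing R] [CommRing S] (f : R →+* S)
    (M : Matrix (DirBond B) (DirBond B) R) :
    f (traceDiscriminant M) = traceDiscriminant (f.mapMatrix M) := by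
  rw [traceDiscriminant, RingHom.map_det, traceDiscriminant]
  congr 1
  ext a b
  have h : ∀ A : Matrix (DirBond B) (DirBond B) R, f A.trace = (f.mapMatrix A).trace := fun A => by
    simp [Matrix.trace]
  have h2 := h (M ^ (a + b : ℕ))
  rw [map_pow] at h2
  exact h2

theorem IsEigenbasis.traceDiscriminant_ne_zero_iff (h : IsEigenbasis M v) :
    traceDiscriminant M ≠ 0 ↔ HasSimpleSpectrum M := by
  let e := (Fintype.equivFin (DirBond B)).symm
  let u : Fin (Fintype.card (DirBond B)) → ℂ := fun a => expectation M (v (e a))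
  -- Traces of powers are power sums of the eigenvalues, so the Hankel matrix is `VᵀV` for their
  -- Vandermonde matrix.
  have : (Matrix.of fun a b : Fin (Fintype.card (DirBond B)) => (M ^ (a + b : ℕ)).trace) =
      (vandermonde u)ᵀ * vandermonde u := by
    ext a b
    rw [Matrix.of_apply, h.trace_pow, Matrix.mul_apply, ← e.sum_comp]
    simp [vandermonde_apply, u, pow_add]
  rw [traceDiscriminant, this, det_mul, det_transpose, mul_self_ne_zero,
    det_vandermonde_ne_zero_iff, h.hasSimpleSpectrum_iff]
  constructor
  · intro hu
    exact (Function.Injective.of_comp_iff' (fun k => expectation M (v k)) e.bijective).1 hu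
  · intro hu
    exact hu.comp e.injective

theorem IsEigenbasis.star_dotProduct_mulVec (h : IsEigenbasis M v) (k : DirBond B)
    (x : DirBond B → ℂ) :
    star (v k) ⬝ᵥ (M *ᵥ x) = expectation M (v k) * (star (v k) ⬝ᵥ x) := by
  have h1 : (basisMatrix v)ᴴ * M = (diagonal fun k => expectation M (v k)) * (basisMatrix v)ᴴ := by
    conv_lhs => rw [h.eq_conj]
    rw [← Matrix.mul_assoc, ← Matrix.mul_assoc, h.conjTranspose_mul, Matrix.one_mul]
  rw [← basisMatrix_conjTranspose_mulVec, Matrix.mulVec_mulVec, h1, ← Matrix.mulVec_mulVec,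
    Matrix.mulVec_diagonal, basisMatrix_conjTranspose_mulVec]

theorem IsEigenbasis.sum_smul (h : IsEigenbasis M v) (x : DirBond B → ℂ) :
    ∑ k, (star (v k) ⬝ᵥ x) • v k = x := by
  have h1 : basisMatrix v *ᵥ ((basisMatrix v)ᴴ *ᵥ x) = x := by
    rw [Matrix.mulVec_mulVec, h.mul_conjTranspose, Matrix.one_mulVec]
  conv_rhs => rw [← h1]
  funext i
  simp only [Finset.sum_apply, Pi.smul_apply, smul_eq_mul, Matrix.mulVec, dotProduct, basisMatrix,
    Matrix.of_apply]
  refine Finset.sum_congr rfl fun k _ => ?_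
  rw [mul_comm]
  rfl

theorem star_dotProduct_self_eq {n : Type*} [Fintype n] (x : n → ℂ) :
    star x ⬝ᵥ x = ((∑ i, ‖x i‖ ^ 2 : ℝ) : ℂ) := by
  simp [dotProduct, Complex.conj_mul']

theorem IsEigenbasis.parseval (h : IsEigenbasis M v) (x : DirBond B → ℂ) :
    ∑ k, ‖star (v k) ⬝ᵥ x‖ ^ 2 = ∑ i, ‖x i‖ ^ 2 := by
  have h1 : star ((basisMatrix v)ᴴ *ᵥ x) ⬝ᵥ ((basisMatrix v)ᴴ *ᵥ x) = star x ⬝ᵥ x := by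
    rw [Matrix.star_mulVec, conjTranspose_conjTranspose, ← Matrix.dotProduct_mulVec,
      Matrix.mulVec_mulVec, h.mul_conjTranspose, Matrix.one_mulVec]
  rw [star_dotProduct_self_eq, star_dotProduct_self_eq] at h1
  exact_mod_cast h1

theorem IsEigenbasis.norm_apply_le (h : IsEigenbasis M v) (k i : DirBond B) : ‖v k i‖ ≤ 1 := by
  have h1 := h.star_dotProduct_self k
  rw [star_dotProduct_self_eq] at h1
  have h2 : ∑ i, ‖v k i‖ ^ 2 = 1 := by exact_mod_cast h1
  have h3 : ‖v k i‖ ^ 2 ≤ 1 := h2 ▸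
    Finset.single_le_sum (f := fun i => ‖v k i‖ ^ 2) (fun _ _ => by positivity) (Finset.mem_univ i)
  exact (sq_le_one_iff₀ (norm_nonneg _)).1 h3

theorem rankOne_apply (x : DirBond B → ℂ) (i j : DirBond B) :
    rankOne x i j = x i * star (x j) := rfl

theorem expectation_eq_trace (A : Matrix (DirBond B) (DirBond B) ℂ) (x : DirBond B → ℂ) :
    expectation A x = (A * rankOne x).trace := by
  rw [rankOne, Matrix.mul_vecMulVec, Matrix.trace_vecMulVec, expectation, dotProduct_comm]

theorem IsEigenbasis.sum_rankOne (h : IsEigenbasis M v) : ∑ k, rankOne (v k) = 1 := by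
  rw [← h.mul_conjTranspose]
  ext i j
  simp [Matrix.sum_apply, rankOne_apply, Matrix.mul_apply, basisMatrix]

theorem rankOne_smul {c : ℂ} (hc : ‖c‖ = 1) (x : DirBond B → ℂ) :
    rankOne (c • x) = rankOne x := by
  ext i j
  simp only [rankOne_apply, Pi.smul_apply, smul_eq_mul, star_mul']
  have : c * star c = 1 := by
    rw [Complex.star_def, Complex.mul_conj']
    simp [hc]
  linear_combination (x i * star (x j)) * this

/-- Eigenbases of a matrix with simple spectrum agree up to order and phases. -/
theorem IsEigenbasis.exists_perm (hv : IsEigenbasis M v) (hw : IsEigenbasis M w)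
    (hM : HasSimpleSpectrum M) :
    ∃ σ : Equiv.Perm (DirBond B), ∀ j, rankOne (w j) = rankOne (v (σ j)) := by
  have hinj := hv.hasSimpleSpectrum_iff.1 hM
  have horth : ∀ j k, star (v k) ⬝ᵥ w j ≠ 0 → expectation M (v k) = expectation M (w j) := by
    intro j k hjk
    have h1 := hv.star_dotProduct_mulVec k (w j)
    rw [hw.mulVec, dotProduct_smul, smul_eq_mul] at h1
    exact (mul_right_cancel₀ hjk h1).symm
  have hex : ∀ j, ∃ k, star (v k) ⬝ᵥ w j ≠ 0 := by
    intro j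
    by_contra! h
    have h1 := hv.sum_smul (w j)
    simp only [h, zero_smul, Finset.sum_const_zero] at h1
    have h2 := hw.star_dotProduct_self j
    rw [← h1] at h2
    simp at h2
  choose σ hσ using hex
  have hval : ∀ j, w j = (star (v (σ j)) ⬝ᵥ w j) • v (σ j) := by
    intro j
    conv_lhs => rw [← hv.sum_smul (w j)]
    rw [Finset.sum_eq_single (σ j)]
    · intro k _ hk
      have : star (v k) ⬝ᵥ w j = 0 := by
        by_contra hne
        exact hk (hinj ((horth j k hne).trans (horth j _ (hσ j)).symm))
      rw [this, zero_smul]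
    · simp
  have hσinj : Function.Injective σ := by
    intro i j hij
    by_contra hne
    have h1 := hw.1 i j
    rw [if_neg hne, hval i, hval j, hij] at h1
    simp only [star_smul, smul_dotProduct, dotProduct_smul, hv.star_dotProduct_self, smul_eq_mul,
      mul_one] at h1
    rcases mul_eq_zero.1 h1 with h2 | h2
    · exact hσ j h2
    · exact hσ i (by rw [hij]; simpa using h2)
  refine ⟨Equiv.ofBijective σ (Finite.injective_iff_bijective.1 hσinj), fun j => ?_⟩
  have hn : ‖star (v (σ j)) ⬝ᵥ w j‖ = 1 := by
    have h1 := hw.star_dotProduct_self j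
    set c := star (v (σ j)) ⬝ᵥ w j with hc
    rw [hval j, star_smul, smul_dotProduct, dotProduct_smul, hv.star_dotProduct_self, ← hc] at h1
    simp only [smul_eq_mul, mul_one] at h1
    rw [Complex.star_def, Complex.conj_mul'] at h1
    have h2 : ‖c‖ ^ 2 = 1 := by exact_mod_cast h1
    exact (pow_eq_one_iff_of_nonneg (norm_nonneg c) two_ne_zero).1 h2
  conv_lhs => rw [hval j]
  exact rankOne_smul hn _

/-- The eigenvalue of a basis vector is its expectation, hence converges with the matrix and the
vector; the condition is therefore closed. -/
theorem IsEigenbasis.of_tendsto {X : Type*} {l : Filter X} [l.NeBot]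
    {N : X → Matrix (DirBond B) (DirBond B) ℂ} {ψ : X → DirBond B → DirBond B → ℂ}
    (hN : Tendsto N l (𝓝 M)) (hψ : ∀ k, Tendsto (fun x => ψ x k) l (𝓝 (v k)))
    (h : ∀ᶠ x in l, IsEigenbasis (N x) (ψ x)) : IsEigenbasis M v := by
  have hdot : ∀ {f g : X → DirBond B → ℂ} {a b : DirBond B → ℂ}, Tendsto f l (𝓝 a) →
      Tendsto g l (𝓝 b) → Tendsto (fun x => star (f x) ⬝ᵥ g x) l (𝓝 (star a ⬝ᵥ b)) := by
    intro f g a b hf hg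
    exact tendsto_finsetSum _ fun i _ =>
      ((continuous_star.tendsto _).comp (tendsto_pi_nhds.1 hf i)).mul (tendsto_pi_nhds.1 hg i)
  have hmul : ∀ k, Tendsto (fun x => N x *ᵥ ψ x k) l (𝓝 (M *ᵥ v k)) := fun k =>
    tendsto_pi_nhds.2 fun i => tendsto_finsetSum Finset.univ fun j _ =>
      (tendsto_pi_nhds.1 (tendsto_pi_nhds.1 hN i) j).mul (tendsto_pi_nhds.1 (hψ k) j)
  refine ⟨fun i j => ?_, fun k => ⟨expectation M (v k), ?_⟩⟩
  · refine tendsto_nhds_unique (hdot (hψ i) (hψ j)) (tendsto_const_nhds.congr' ?_)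
    filter_upwards [h] with x hx
    rw [hx.1]
  · have h2 : Tendsto (fun x => expectation (N x) (ψ x k) • ψ x k) l
        (𝓝 (expectation M (v k) • v k)) := (hdot (hψ k) (hmul k)).smul (hψ k)
    refine tendsto_nhds_unique (hmul k) (h2.congr' ?_)
    filter_upwards [h] with x hx
    exact (hx.mulVec k).symm

/-- Near a point of simple spectrum, eigenbases are continuous up to order and phases. -/
theorem exists_perm_continuousAt {X : Type*} [TopologicalSpace X]
    {N : X → Matrix (DirBond B) (DirBond B) ℂ} {ψ : X → DirBond B → DirBond B → ℂ} {x₀ : X}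
    (hN : ContinuousAt N x₀) (hψ : ∀ᶠ x in 𝓝 x₀, IsEigenbasis (N x) (ψ x))
    (hs : HasSimpleSpectrum (N x₀)) :
    ∃ σ : X → Equiv.Perm (DirBond B), ∀ j,
      ContinuousAt (fun x => rankOne (ψ x (σ x j))) x₀ := by
  have h₀ : IsEigenbasis (N x₀) (ψ x₀) := hψ.self_of_nhds
  let P : (DirBond B → ℂ) → DirBond B → DirBond B → ℂ := fun u => rankOne u
  have hP : Continuous P := by
    refine continuous_pi fun i => continuous_pi fun j => ?_
    change Continuous fun u : DirBond B → ℂ => u i * star (u j)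
    fun_prop
  let d : X → Equiv.Perm (DirBond B) → ℝ := fun x σ =>
    ∑ j, dist (P (ψ x (σ j))) (P (ψ x₀ j))
  -- At each point the basis is ordered to lie as close as possible to the basis at `x₀`.
  choose σ hσ using fun x => Finite.exists_min (d x)
  have hlim : Tendsto (fun x => d x (σ x)) (𝓝 x₀) (𝓝 0) := by
    -- Along an ultrafilter the bases converge, by compactness, to an eigenbasis at `x₀`, which by
    -- simplicity is a reordering of the chosen one. That reordering competes in the minimum and its
    -- distance tends to zero.
    rw [tendsto_iff_ultrafilter]
    intro l hl
    have hK : IsCompact (Set.univ.pi fun _ : DirBond B =>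
        Metric.closedBall (0 : DirBond B → ℂ) 1) :=
      isCompact_univ_pi fun _ => isCompact_closedBall _ _
    have hψl : ∀ᶠ x in (l : Filter X), IsEigenbasis (N x) (ψ x) := hl hψ
    obtain ⟨u, -, hu⟩ := hK.ultrafilter_le_nhds (l.map ψ) (by
      rw [le_principal_iff]
      change ∀ᶠ x in (l : Filter X), _
      filter_upwards [hψl] with x hx k _
      rw [mem_closedBall_zero_iff, pi_norm_le_iff_of_nonneg zero_le_one]
      exact hx.norm_apply_le k)
    have hu' : Tendsto ψ l (𝓝 u) := hu
    have huk : ∀ k, Tendsto (fun x => ψ x k) l (𝓝 (u k)) := fun k =>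
      (continuous_apply k).tendsto u |>.comp hu'
    have hNl : Tendsto N l (𝓝 (N x₀)) := hN.mono_left hl
    have hue : IsEigenbasis (N x₀) u := IsEigenbasis.of_tendsto hNl huk hψl
    obtain ⟨τ, hτ⟩ := h₀.exists_perm hue hs
    have h3 : Tendsto (fun x => d x τ⁻¹) l (𝓝 0) := by
      have : Tendsto (fun x => ∑ j, dist (P (ψ x (τ⁻¹ j))) (P (ψ x₀ j))) l
          (𝓝 (∑ j, dist (P (u (τ⁻¹ j))) (P (ψ x₀ j)))) :=
        tendsto_finsetSum _ fun j _ =>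
          ((hP.tendsto _).comp (huk (τ⁻¹ j))).dist tendsto_const_nhds
      have h0 : ∑ j, dist (P (u (τ⁻¹ j))) (P (ψ x₀ j)) = 0 := by
        refine Finset.sum_eq_zero fun j _ => ?_
        have : P (u (τ⁻¹ j)) = P (ψ x₀ j) := by
          have h := hτ (τ⁻¹ j)
          rw [show τ (τ⁻¹ j) = j from τ.apply_symm_apply j] at h
          exact h
        rw [this, dist_self]
      rw [h0] at this
      exact this
    exact squeeze_zero (fun x => Finset.sum_nonneg fun _ _ => dist_nonneg)
      (fun x => hσ x τ⁻¹) h3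
  have hlim' : ∀ j, Tendsto (fun x => P (ψ x (σ x j))) (𝓝 x₀) (𝓝 (P (ψ x₀ j))) := fun j => by
    rw [tendsto_iff_dist_tendsto_zero]
    exact squeeze_zero (fun _ => dist_nonneg) (fun x => Finset.single_le_sum
      (f := fun j => dist (P (ψ x (σ x j))) (P (ψ x₀ j))) (fun _ _ => dist_nonneg)
      (Finset.mem_univ j)) hlim
  refine ⟨σ, fun j => ?_⟩
  -- The minimizing order at `x₀` itself need not be the identity, but it gives the same
  -- projections, as the limit along the pure filter shows.
  have h4 : P (ψ x₀ (σ x₀ j)) = P (ψ x₀ j) :=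
    (tendsto_pure_nhds (fun x => P (ψ x (σ x j))) x₀ |> fun h =>
      tendsto_nhds_unique h ((hlim' j).mono_left (pure_le_nhds x₀)))
  have h5 := hlim' j
  rw [← h4] at h5
  exact h5

end Eigenbasis

/-! ### Orthonormal eigenbases of Hermitian and unitary matrices -/

section Existence

variable {B : ℕ}

theorem exists_isEigenbasis_of_isHermitian {H : Matrix (DirBond B) (DirBond B) ℂ}
    (hH : H.IsHermitian) : ∃ v, IsEigenbasis H v := by
  refine ⟨fun k => ⇑(hH.eigenvectorBasis k), fun i j => ?_, fun k =>
    ⟨(hH.eigenvalues k : ℂ), ?_⟩⟩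
  · have h1 : (hH.eigenvectorUnitary : Matrix (DirBond B) (DirBond B) ℂ)ᴴ *
        hH.eigenvectorUnitary = 1 := (Matrix.mem_unitaryGroup_iff'.1 hH.eigenvectorUnitary.2)
    have h2 := congrFun (congrFun h1 i) j
    rw [Matrix.one_apply] at h2
    rw [← h2]
    rfl
  · have := hH.mulVec_eigenvectorBasis k
    rw [this]
    ext i
    simp

/-- Cayley transform: for a unit `c` outside the spectrum, `i(c + M)(c - M)⁻¹` is Hermitian, and its
eigenvectors are eigenvectors of `M`. -/
theorem exists_isEigenbasis_of_unitary {M : Matrix (DirBond B) (DirBond B) ℂ}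
    (hM : M ∈ Matrix.unitaryGroup (DirBond B) ℂ) : ∃ v, IsEigenbasis M v := by
  obtain ⟨c, hc1, hc⟩ : ∃ c : ℂ, ‖c‖ = 1 ∧ M.charpoly.eval c ≠ 0 := by
    by_contra! h
    have hfin : (M.charpoly.rootSet ℂ).Finite := Polynomial.rootSet_finite _ _
    have hinf : ((fun t : ℝ => (Circle.exp t : ℂ)) '' Set.Icc 0 1).Infinite := by
      refine (Set.Icc_infinite zero_lt_one).image ?_
      exact Circle.coe_injective.comp_injOn
        (Circle.exp_injOn_Icc (by linarith [Real.pi_gt_three]))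
    refine hinf (hfin.subset ?_)
    rintro _ ⟨t, -, rfl⟩
    rw [Polynomial.mem_rootSet]
    exact ⟨M.charpoly_monic.ne_zero, by
      simpa [Polynomial.aeval_def] using h _ (Circle.norm_coe (Circle.exp t))⟩
  rw [Matrix.eval_charpoly] at hc
  have hcc : c * star c = 1 := by
    rw [Complex.star_def, Complex.mul_conj', hc1]; simp
  have hc00 : c ≠ 0 := fun h => by simp [h] at hc1
  set Y := Matrix.scalar (DirBond B) c - M with hY
  have hYu : IsUnit Y.det := isUnit_iff_ne_zero.2 hc
  have hMM : M * Mᴴ = 1 := Matrix.mem_unitaryGroup_iff.1 hM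
  have hscal : Matrix.scalar (DirBond B) c = c • 1 := by
    ext i j; simp [Matrix.one_apply, Matrix.diagonal_apply]
  have hYH : Yᴴ = star c • 1 - Mᴴ := by
    rw [hY, hscal]; simp
  have hYHu : IsUnit Yᴴ.det := by
    rw [det_conjTranspose]; exact hYu.star
  -- The matrix form of the fact that `1 / (1 - u)` has real part `1/2` for `|u| = 1`, `u ≠ 1`, with
  -- `c⁻¹M` in place of `u`.
  have key : c • Y⁻¹ + star c • (Y⁻¹)ᴴ = 1 := by
    have h1 : Y * (c • Y⁻¹ + star c • (Y⁻¹)ᴴ) * Yᴴ = Y * 1 * Yᴴ := by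
      rw [Matrix.mul_add, Matrix.add_mul, Matrix.mul_smul, Matrix.mul_smul,
        Matrix.mul_nonsing_inv _ hYu, Matrix.smul_mul, Matrix.smul_mul, Matrix.one_mul,
        Matrix.mul_assoc Y, conjTranspose_nonsing_inv, Matrix.nonsing_inv_mul _ hYHu,
        Matrix.mul_one, hYH, hY, hscal]
      simp only [Matrix.sub_mul, Matrix.mul_sub, Matrix.smul_mul, Matrix.mul_smul, Matrix.one_mul,
        Matrix.mul_one, hMM, smul_sub, smul_smul]
      rw [mul_comm (star c), hcc, one_smul]
      abel
    have h2 := congrArg (fun Z => Y⁻¹ * Z * Yᴴ⁻¹) h1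
    simpa only [Matrix.mul_assoc, Matrix.mul_nonsing_inv _ hYHu, Matrix.mul_one, ← Matrix.mul_assoc,
      Matrix.nonsing_inv_mul _ hYu, Matrix.one_mul, Matrix.mul_nonsing_inv_cancel_right _ _ hYHu]
      using h2
  -- This is the Cayley transform, because `2c = (c + M) + (c - M)`.
  let H : Matrix (DirBond B) (DirBond B) ℂ := Complex.I • ((2 * c) • Y⁻¹ - 1)
  have hH : H.IsHermitian := by
    have h3 : star c • (Y⁻¹)ᴴ = 1 - c • Y⁻¹ := by rw [← key]; abel
    change Hᴴ = H
    simp only [H, conjTranspose_smul, conjTranspose_sub, conjTranspose_one, mul_smul,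
      Complex.star_def, Complex.conj_I, map_ofNat]
    simp only [Complex.star_def] at h3
    rw [h3]
    simp only [smul_sub, neg_smul]
    module
  obtain ⟨v, hv⟩ := exists_isEigenbasis_of_isHermitian hH
  refine ⟨v, hv.1, fun k => ?_⟩
  obtain ⟨μ, hμ⟩ := hv.2 k
  have hQ : ∃ q : ℂ, Y⁻¹ *ᵥ v k = q • v k := by
    refine ⟨(2 * c)⁻¹ * (1 - Complex.I * μ), ?_⟩
    have hc0 : (2 * c) ≠ 0 := by simp [hc00]
    have h4 : Y⁻¹ = (2 * c)⁻¹ • (1 - Complex.I • H) := by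
      simp only [H, smul_smul, Complex.I_mul_I]
      rw [neg_one_smul, sub_neg_eq_add, add_sub_cancel, smul_smul, inv_mul_cancel₀ hc0, one_smul]
    rw [h4, Matrix.smul_mulVec, Matrix.sub_mulVec, Matrix.one_mulVec, Matrix.smul_mulVec, hμ]
    module
  obtain ⟨q, hq⟩ := hQ
  have h5 : v k = q • (Y *ᵥ v k) := by
    rw [← Matrix.mulVec_smul, ← hq, Matrix.mulVec_mulVec, Matrix.mul_nonsing_inv _ hYu,
      Matrix.one_mulVec]
  have hq0 : q ≠ 0 := by
    rintro rfl
    have := hv.star_dotProduct_self k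
    rw [h5] at this
    simp at this
  refine ⟨c - q⁻¹, ?_⟩
  have h6 : Y *ᵥ v k = q⁻¹ • v k := by
    conv_rhs => rw [h5]
    rw [smul_smul, inv_mul_cancel₀ hq0, one_smul]
  rw [hY, hscal, Matrix.sub_mulVec, Matrix.smul_mulVec, Matrix.one_mulVec] at h6
  rw [sub_smul, ← h6]
  abel

end Existence

/-! ### Regular choices of eigenvectors -/

section Evolution

variable {B : ℕ} {S₀ : Matrix (DirBond B) (DirBond B) ℂ}

/-- The bond underlying a directed bond. -/
def bond (i : DirBond B) : Fin B := Sum.elim id id i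

theorem sumElim_eq_bond {α : Type*} (f : Fin B → α) (i : DirBond B) :
    Sum.elim f f i = f (bond i) := by
  cases i <;> rfl

theorem evolution_apply (S₀ : Matrix (DirBond B) (DirBond B) ℂ) (z : Torus B) (i j : DirBond B) :
    evolution S₀ z i j = (z (bond i) : ℂ) * S₀ i j := by
  rw [evolution, phaseMatrix, Matrix.diagonal_mul, sumElim_eq_bond (fun b => (z b : ℂ))]

theorem evolution_rotate (S₀ : Matrix (DirBond B) (DirBond B) ℂ) (c : Circle) (z : Torus B) :
    evolution S₀ (rotate c z) = (c : ℂ) • evolution S₀ z := by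
  ext i j
  simp [evolution_apply, rotate, mul_assoc]

theorem evolution_mem_unitaryGroup (hS₀ : S₀ ∈ Matrix.unitaryGroup (DirBond B) ℂ) (z : Torus B) :
    evolution S₀ z ∈ Matrix.unitaryGroup (DirBond B) ℂ := by
  refine mul_mem ?_ hS₀
  rw [Matrix.mem_unitaryGroup_iff, phaseMatrix, Matrix.star_eq_conjTranspose,
    diagonal_conjTranspose, diagonal_mul_diagonal, ← diagonal_one]
  congr 1
  funext i
  rw [Pi.star_apply, sumElim_eq_bond (fun b => (z b : ℂ)), Complex.star_def, Complex.mul_conj',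
    Circle.norm_coe]
  simp

theorem continuous_evolution (S₀ : Matrix (DirBond B) (DirBond B) ℂ) :
    Continuous (evolution S₀) := by
  refine continuous_pi fun i => continuous_pi fun j => ?_
  simp only [evolution_apply]
  exact (continuous_subtype_val.comp (continuous_apply (bond i))).mul continuous_const

/-- `evolution S₀` as a matrix of functions. -/
def evolutionFun (L : Fin B → ℝ) (S₀ : Matrix (DirBond B) (DirBond B) ℂ) :
    Matrix (DirBond B) (DirBond B) (orbitAnalytic L) := fun i j =>
  ⟨_, coord_mem_orbitAnalytic L (bond i)⟩ * algebraMap ℂ _ (S₀ i j)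

theorem mapMatrix_evolutionFun (L : Fin B → ℝ) (S₀ : Matrix (DirBond B) (DirBond B) ℂ)
    (z : Torus B) : (evalAt L z).mapMatrix (evolutionFun L S₀) = evolution S₀ z := by
  ext i j
  rw [evolution_apply]
  rfl

/-- Entrywise complex conjugation of a matrix of functions. -/
def conjFun {L : Fin B → ℝ} {m n : Type*} (N : Matrix m n (orbitAnalytic L)) :
    Matrix m n (orbitAnalytic L) := fun i j => ⟨_, star_mem_orbitAnalytic (N i j).2⟩

theorem IsEigenbasis.smul {M : Matrix (DirBond B) (DirBond B) ℂ}
    {v : DirBond B → DirBond B → ℂ} (h : IsEigenbasis M v) (a : ℂ) : IsEigenbasis (a • M) v :=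
  ⟨h.1, fun k => ⟨a * expectation M (v k), by
    rw [Matrix.smul_mulVec, h.mulVec, smul_smul]⟩⟩

theorem expectation_smul (a : ℂ) (M : Matrix (DirBond B) (DirBond B) ℂ) (x : DirBond B → ℂ) :
    expectation (a • M) x = a * expectation M x := by
  rw [expectation, Matrix.smul_mulVec, dotProduct_smul, smul_eq_mul, expectation]

theorem IsEigenbasis.hasSimpleSpectrum_smul {M : Matrix (DirBond B) (DirBond B) ℂ}
    {v : DirBond B → DirBond B → ℂ} (h : IsEigenbasis M v) {a : ℂ} (ha : a ≠ 0) :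
    HasSimpleSpectrum (a • M) ↔ HasSimpleSpectrum M := by
  rw [(h.smul a).hasSimpleSpectrum_iff, h.hasSimpleSpectrum_iff]
  simp only [expectation_smul]
  exact (mul_right_injective₀ ha).of_comp_iff _

/-- A choice of eigenvectors is regular if almost everywhere it diagonalizes a family with simple
spectrum that is analytic along the flow. -/
theorem isRegularChoice_of_hasSimpleSpectrum {L : Fin B → ℝ} (hL : LinearIndependent ℚ L)
    {N : Torus B → Matrix (DirBond B) (DirBond B) ℂ}
    {N' : Matrix (DirBond B) (DirBond B) (orbitAnalytic L)}
    (hN : ∀ z, (evalAt L z).mapMatrix N' = N z)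
    (hrot : ∀ c z, ∃ a : ℂ, a ≠ 0 ∧ N (rotate c z) = a • N z)
    (hdiag : ∀ z, ∃ v, IsEigenbasis (N z) v) {z₀ : Torus B} (hz₀ : HasSimpleSpectrum (N z₀))
    {ψ : Torus B → DirBond B → DirBond B → ℂ}
    (hψ : ∀ z, HasSimpleSpectrum (N z) → IsEigenbasis (N z) (ψ z)) : IsRegularChoice L ψ := by
  have hNcont : Continuous N := by
    refine continuous_pi fun i => continuous_pi fun j => ?_
    have : (fun z => N z i j) = (N' i j : Torus B → ℂ) := by
      funext z
      rw [← hN z]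
      rfl
    rw [this]
    exact (N' i j).2.1
  let f : Torus B → ℂ := (traceDiscriminant N').1
  have hf : f ∈ orbitAnalytic L := (traceDiscriminant N').2
  have hfN : ∀ z, f z ≠ 0 ↔ HasSimpleSpectrum (N z) := fun z => by
    obtain ⟨v, hv⟩ := hdiag z
    rw [← hv.traceDiscriminant_ne_zero_iff, ← hN z, ← map_traceDiscriminant]
    rfl
  have hclosed : IsClosed {z | f z = 0} := isClosed_eq hf.1 continuous_const
  have hf₀ : f z₀ ≠ 0 := (hfN z₀).2 hz₀
  have hsimple : ∀ c z, HasSimpleSpectrum (N (rotate c z)) ↔ HasSimpleSpectrum (N z) := by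
    intro c z
    obtain ⟨v, hv⟩ := hdiag z
    obtain ⟨a, ha, hNa⟩ := hrot c z
    rw [hNa, hv.hasSimpleSpectrum_smul ha]
  refine ⟨{z | f z = 0}, hclosed, fun c z hz => ?_, ?_, volume_flow_zero hL hf hf₀,
    fun z hz c => ?_, fun z hz => ?_⟩
  · change f (rotate c z) = 0
    by_contra h
    exact (hfN z).2 ((hsimple c z).1 ((hfN _).1 h)) hz
  · rw [← torusMeasure_eq_zero_iff hclosed.measurableSet]
    exact torusMeasure_zero hL hf hf₀
  · have hz' := (hfN z).1 hz
    have h1 := hψ z hz'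
    have h2 := hψ (rotate c z) ((hsimple c z).2 hz')
    obtain ⟨a, ha, hNa⟩ := hrot c z
    have h3 := h1.smul a
    rw [← hNa] at h3
    exact h3.exists_perm h2 ((hsimple c z).2 hz')
  · refine exists_perm_continuousAt hNcont.continuousAt ?_ ((hfN z).1 hz)
    filter_upwards [hclosed.isOpen_compl.mem_nhds hz] with w hw
    exact hψ w ((hfN w).1 hw)

theorem isRegularChoice_of_evolution {L : Fin B → ℝ} (hL : LinearIndependent ℚ L)
    (hS₀ : S₀ ∈ Matrix.unitaryGroup (DirBond B) ℂ)
    {z₀ : Torus B} (hz₀ : HasSimpleSpectrum (evolution S₀ z₀))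
    {ψ : Torus B → DirBond B → DirBond B → ℂ} (hψ : IsEigenvectorChoice S₀ ψ) :
    IsRegularChoice L ψ :=
  isRegularChoice_of_hasSimpleSpectrum hL (mapMatrix_evolutionFun L S₀)
    (fun c z => ⟨c, Circle.coe_ne_zero c, evolution_rotate S₀ c z⟩)
    (fun z => exists_isEigenbasis_of_unitary (evolution_mem_unitaryGroup hS₀ z)) hz₀
    fun z _ => hψ z

end Evolution

/-! ### A generically nondegenerate Hermitian family in the commutant of the evolution -/

section Commutant

open scoped Kronecker

variable {B : ℕ}

/-- The operator `X ↦ M X M⁻¹ - X` for a unitary matrix `M`, acting on vectorized matrices. -/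
def adSubOne (M : Matrix (DirBond B) (DirBond B) ℂ) :
    Matrix (DirBond B × DirBond B) (DirBond B × DirBond B) ℂ :=
  M.map star ⊗ₖ M - 1

theorem adSubOne_mulVec_vec (M X : Matrix (DirBond B) (DirBond B) ℂ) :
    adSubOne M *ᵥ vec X = vec (M * X * Mᴴ - X) := by
  rw [adSubOne, Matrix.sub_mulVec, kronecker_mulVec_vec, Matrix.one_mulVec, vec_sub]
  rfl

/-- The vector `y = Wx - x` is fixed by the isometry `W`, so `⟨Wx, y⟩ = ⟨Wx, Wy⟩ = ⟨x, y⟩` and hence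
`⟨y, y⟩ = 0`. The eigenvalue `1` thus has no Jordan blocks. -/
theorem mulVec_sub_one_eq_zero_of_sq {n : Type*} [Fintype n] [DecidableEq n]
    {W : Matrix n n ℂ} (hW : Wᴴ * W = 1)
    {x : n → ℂ} (hx : (W - 1) *ᵥ ((W - 1) *ᵥ x) = 0) : (W - 1) *ᵥ x = 0 := by
  set y := (W - 1) *ᵥ x with hy
  have h1 : W *ᵥ y = y := by
    rwa [Matrix.sub_mulVec, Matrix.one_mulVec, sub_eq_zero] at hx
  have h2 : star y ⬝ᵥ y = 0 := by
    have h3 : star (W *ᵥ x) ⬝ᵥ y = star x ⬝ᵥ y := by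
      conv_lhs => rw [← h1]
      rw [Matrix.star_mulVec, ← Matrix.dotProduct_mulVec, Matrix.mulVec_mulVec, hW,
        Matrix.one_mulVec]
    have h4 : star y = star (W *ᵥ x) - star x := by
      rw [hy, Matrix.sub_mulVec, Matrix.one_mulVec, star_sub]
    rw [h4, sub_dotProduct, h3, sub_self]
  rw [star_dotProduct_self_eq] at h2
  have h5 : ∑ i, ‖y i‖ ^ 2 = 0 := by exact_mod_cast h2
  rw [Finset.sum_eq_zero_iff_of_nonneg fun _ _ => by positivity] at h5
  funext i
  simpa using h5 i (Finset.mem_univ i)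

theorem mulVec_sub_one_eq_zero_of_pow {n : Type*} [Fintype n] [DecidableEq n]
    {W : Matrix n n ℂ} (hW : Wᴴ * W = 1)
    {x : n → ℂ} (r : ℕ) (hx : (W - 1) ^ r *ᵥ x = 0) : (W - 1) *ᵥ x = 0 := by
  induction r with
  | zero =>
    rw [pow_zero, Matrix.one_mulVec] at hx
    rw [hx, Matrix.mulVec_zero]
  | succ r ih =>
    cases r with
    | zero => simpa using hx
    | succ r =>
      refine ih ?_
      rw [_root_.pow_succ', ← Matrix.mulVec_mulVec]
      refine mulVec_sub_one_eq_zero_of_sq hW ?_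
      rw [_root_.pow_succ', _root_.pow_succ', ← Matrix.mulVec_mulVec, ← Matrix.mulVec_mulVec] at hx
      exact hx

theorem star_map_kronecker_unitary {M : Matrix (DirBond B) (DirBond B) ℂ}
    (hM : M ∈ Matrix.unitaryGroup (DirBond B) ℂ) :
    (M.map star ⊗ₖ M)ᴴ * (M.map star ⊗ₖ M) = 1 := by
  have h1 : Mᴴ * M = 1 := Matrix.mem_unitaryGroup_iff'.1 hM
  have h2 : (M.map star)ᴴ * M.map star = 1 := by
    have : (M.map star)ᴴ * M.map star = (Mᴴ * M).map star := by
      ext i j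
      simp [Matrix.mul_apply]
    rw [this, h1]
    ext i j
    by_cases h : i = j <;> simp [Matrix.one_apply, h]
  rw [conjTranspose_kronecker, ← mul_kronecker_mul, h1, h2, one_kronecker_one]

/-- `adSubOne (evolution S₀ ·)` as a matrix of functions. -/
def adSubOneFun (L : Fin B → ℝ) (S₀ : Matrix (DirBond B) (DirBond B) ℂ) :
    Matrix (DirBond B × DirBond B) (DirBond B × DirBond B) (orbitAnalytic L) :=
  conjFun (evolutionFun L S₀) ⊗ₖ evolutionFun L S₀ - 1

theorem mapMatrix_adSubOneFun (L : Fin B → ℝ) (S₀ : Matrix (DirBond B) (DirBond B) ℂ)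
    (z : Torus B) :
    (evalAt L z).mapMatrix (adSubOneFun L S₀) = adSubOne (evolution S₀ z) := by
  rw [adSubOneFun, map_sub, map_one, adSubOne]
  congr 1
  ext i j
  rw [kroneckerMap_apply, ← mapMatrix_evolutionFun L S₀ z]
  rfl

/-- Conjugation does not see scalar phases. This makes the commuting family invariant under them. -/
theorem adSubOne_rotate (S₀ : Matrix (DirBond B) (DirBond B) ℂ) (c : Circle) (z : Torus B) :
    adSubOne (evolution S₀ (rotate c z)) = adSubOne (evolution S₀ z) := by
  have hcc : star (c : ℂ) * (c : ℂ) = 1 := by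
    rw [Complex.star_def, Complex.conj_mul', Circle.norm_coe]; simp
  rw [adSubOne, adSubOne, evolution_rotate]
  congr 1
  ext i j
  simp only [kroneckerMap_apply, Matrix.map_apply, Matrix.smul_apply, smul_eq_mul, star_mul']
  linear_combination (star (evolution S₀ z i.1 j.1) * evolution S₀ z i.2 j.2) * hcc

/-- There is a Hermitian family that commutes with the evolution, is analytic along the flow,
invariant under phases, and somewhere has simple spectrum. -/
theorem exists_commuting_family {L : Fin B → ℝ} {S₀ : Matrix (DirBond B) (DirBond B) ℂ}
    (hS₀ : S₀ ∈ Matrix.unitaryGroup (DirBond B) ℂ) :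
    ∃ (N : Torus B → Matrix (DirBond B) (DirBond B) ℂ)
      (N' : Matrix (DirBond B) (DirBond B) (orbitAnalytic L)),
      (∀ z, (evalAt L z).mapMatrix N' = N z) ∧ (∀ z, (N z).IsHermitian) ∧
      (∀ z, Commute (evolution S₀ z) (N z)) ∧ (∀ c z, N (rotate c z) = N z) ∧
      ∃ z₀, HasSimpleSpectrum (N z₀) := by
  set T' := adSubOneFun L S₀
  set T : Torus B → _ := fun z => adSubOne (evolution S₀ z) with hT
  have hT' : ∀ z, (evalAt L z).mapMatrix T' = T z := mapMatrix_adSubOneFun L S₀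
  -- The largest power of `X` is split off over the ring of functions, so that the constant term of
  -- the cofactor `p` is nonzero at some point `z₀`. Pointwise the factor `X ^ r` is the same for
  -- all `z`, which keeps `q z` analytic along the flow.
  set r := T'.charpoly.natTrailingDegree with hr
  obtain ⟨p, hp⟩ : Polynomial.X ^ r ∣ T'.charpoly :=
    Polynomial.X_pow_dvd_iff.2 fun d hd => Polynomial.coeff_eq_zero_of_lt_natTrailingDegree hd
  have hne : T'.charpoly ≠ 0 := by
    intro h
    have := congrArg (Polynomial.map (evalAt L 1)) h
    rw [← Matrix.charpoly_map, Polynomial.map_zero] at this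
    exact (Matrix.charpoly_monic _).ne_zero this
  have hp0 : p.coeff 0 ≠ 0 := by
    have h1 : T'.charpoly.coeff r ≠ 0 := by
      have := Polynomial.trailingCoeff_nonzero_iff_nonzero.2 hne
      exact this
    have h2 := Polynomial.coeff_X_pow_mul p r 0
    rw [zero_add, ← hp] at h2
    rwa [h2] at h1
  obtain ⟨z₀, hz₀⟩ : ∃ z₀, (p.coeff 0 : Torus B → ℂ) z₀ ≠ 0 := by
    by_contra! h
    exact hp0 (Subtype.ext (funext h))
  let q : Torus B → Polynomial ℂ := fun z => p.map (evalAt L z)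
  have hq : ∀ z, (T z).charpoly = Polynomial.X ^ r * q z := fun z => by
    rw [← hT' z, RingHom.mapMatrix_apply, Matrix.charpoly_map, hp]
    simp [q]
  have hTrot : ∀ c z, T (rotate c z) = T z := fun c z => adSubOne_rotate S₀ c z
  have hqrot : ∀ c z, q (rotate c z) = q z := fun c z => by
    have h1 := hq (rotate c z)
    rw [hTrot, hq z] at h1
    exact (mul_left_cancel₀ (pow_ne_zero _ Polynomial.X_ne_zero) h1).symm
  have hCH : ∀ z, T z ^ r * Polynomial.aeval (T z) (q z) = 0 := fun z => by
    have h1 := Matrix.aeval_self_charpoly (T z)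
    rwa [hq z, map_mul, map_pow, Polynomial.aeval_X] at h1
  obtain ⟨v, hv⟩ := exists_isEigenbasis_of_unitary (evolution_mem_unitaryGroup hS₀ z₀)
  let e := Fintype.equivFin (DirBond B)
  -- Any distinct real numbers serve as eigenvalues: `H₀` becomes Hermitian, nondegenerate and
  -- commutes with the evolution at `z₀`.
  set d : DirBond B → ℂ := fun k => ((e k : ℕ) : ℂ) with hd
  have hdinj : Function.Injective d := fun i j hij => by
    have : (e i : ℕ) = e j := by
      have h : ((e i : ℕ) : ℂ) = ((e j : ℕ) : ℂ) := hij
      exact_mod_cast h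
    exact e.injective (Fin.ext this)
  set H₀ := basisMatrix v * diagonal d * (basisMatrix v)ᴴ with hH₀
  have hH₀h : H₀ᴴ = H₀ := by
    rw [hH₀, conjTranspose_mul, conjTranspose_mul, conjTranspose_conjTranspose,
      diagonal_conjTranspose, Matrix.mul_assoc]
    congr 3
    funext k
    simp [hd]
  have hH₀v : ∀ k, H₀ *ᵥ v k = d k • v k := by
    intro k
    have h1 : H₀ * basisMatrix v = basisMatrix v * diagonal d := by
      rw [hH₀, Matrix.mul_assoc, hv.conjTranspose_mul, Matrix.mul_one]
    ext i
    have h2 := congrFun (congrFun h1 i) k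
    rw [Matrix.mul_diagonal, mul_comm] at h2
    exact h2
  have hH₀e : IsEigenbasis H₀ v := ⟨hv.1, fun k => ⟨d k, hH₀v k⟩⟩
  have hTH₀ : T z₀ *ᵥ vec H₀ = 0 := by
    have hM : evolution S₀ z₀ * (evolution S₀ z₀)ᴴ = 1 :=
      Matrix.mem_unitaryGroup_iff.1 (evolution_mem_unitaryGroup hS₀ z₀)
    have hcomm : evolution S₀ z₀ * H₀ = H₀ * evolution S₀ z₀ := by
      have h1 := hv.eq_conj
      rw [h1, hH₀]
      simp only [Matrix.mul_assoc]
      rw [← Matrix.mul_assoc (basisMatrix v)ᴴ, ← Matrix.mul_assoc (basisMatrix v)ᴴ,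
        hv.conjTranspose_mul, Matrix.one_mul, Matrix.one_mul,
        ← Matrix.mul_assoc (diagonal _) (diagonal _), ← Matrix.mul_assoc (diagonal _) (diagonal _),
        diagonal_mul_diagonal, diagonal_mul_diagonal]
      simp only [mul_comm]
    rw [hT, adSubOne_mulVec_vec, hcomm, Matrix.mul_assoc, hM, Matrix.mul_one, sub_self, vec_zero]
  set a : ℂ := (q z₀).coeff 0 with ha
  have ha0 : a ≠ 0 := by
    rw [ha, Polynomial.coeff_map]
    exact hz₀
  -- On the kernel of `T z₀` the matrix `q(T z₀)` acts as the scalar `a`. The factor `star a` makes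
  -- the result a positive multiple of `H₀`, which survives the symmetrization `K + Kᴴ`.
  set x₀ : DirBond B × DirBond B → ℂ := star a • vec H₀ with hx₀
  let x' : DirBond B × DirBond B → orbitAnalytic L :=
    Polynomial.aeval T' p *ᵥ fun i => algebraMap ℂ _ (x₀ i)
  let x : Torus B → DirBond B × DirBond B → ℂ := fun z => Polynomial.aeval (T z) (q z) *ᵥ x₀
  have hx : ∀ z i, (x' i : Torus B → ℂ) z = x z i := by
    intro z i
    have h1 : (evalAt L z).mapMatrix (Polynomial.aeval T' p) = Polynomial.aeval (T z) (q z) := by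
      rw [Polynomial.aeval_def, Polynomial.hom_eval₂, hT' z, Polynomial.aeval_def,
        Polynomial.eval₂_map]
      congr 1
      ext s i j
      by_cases h : i = j <;> simp [h, Matrix.algebraMap_matrix_apply]
    change evalAt L z (x' i) = _
    simp only [x', x, ← h1, Matrix.mulVec, dotProduct, map_sum, map_mul]
    rfl
  -- By Cayley–Hamilton `q(T z)` maps into the kernel of `T z ^ r`. As `T z + 1` is unitary this is
  -- contained in the kernel of `T z`, which is the commutant.
  have hTx : ∀ z, T z *ᵥ x z = 0 := fun z => by
    refine mulVec_sub_one_eq_zero_of_pow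
      (star_map_kronecker_unitary (evolution_mem_unitaryGroup hS₀ z)) r ?_
    change T z ^ r *ᵥ (Polynomial.aeval (T z) (q z) *ᵥ x₀) = 0
    rw [Matrix.mulVec_mulVec, hCH, Matrix.zero_mulVec]
  let K : Torus B → Matrix (DirBond B) (DirBond B) ℂ := fun z => Matrix.of fun i j => x z (j, i)
  have hKvec : ∀ z, vec (K z) = x z := fun z => rfl
  have hKcomm : ∀ z, evolution S₀ z * K z = K z * evolution S₀ z := fun z => by
    have hM : (evolution S₀ z)ᴴ * evolution S₀ z = 1 :=
      Matrix.mem_unitaryGroup_iff'.1 (evolution_mem_unitaryGroup hS₀ z)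
    have h1 := hTx z
    rw [← hKvec, hT, adSubOne_mulVec_vec] at h1
    have h2 : evolution S₀ z * K z * (evolution S₀ z)ᴴ - K z = 0 := vec_eq_zero_iff.1 h1
    rw [sub_eq_zero] at h2
    have h3 := congrArg (· * evolution S₀ z) h2
    simpa only [Matrix.mul_assoc, hM, Matrix.mul_one] using h3
  have hKHcomm : ∀ z, evolution S₀ z * (K z)ᴴ = (K z)ᴴ * evolution S₀ z := fun z => by
    have hM : (evolution S₀ z)ᴴ * evolution S₀ z = 1 :=
      Matrix.mem_unitaryGroup_iff'.1 (evolution_mem_unitaryGroup hS₀ z)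
    have hM' : evolution S₀ z * (evolution S₀ z)ᴴ = 1 :=
      Matrix.mem_unitaryGroup_iff.1 (evolution_mem_unitaryGroup hS₀ z)
    have h1 := congrArg conjTranspose (hKcomm z)
    rw [conjTranspose_mul, conjTranspose_mul] at h1
    have h2 := congrArg (fun Z => evolution S₀ z * Z * evolution S₀ z) h1
    simp only [Matrix.mul_assoc, hM, Matrix.mul_one] at h2
    rw [← Matrix.mul_assoc (evolution S₀ z) (evolution S₀ z)ᴴ, hM', Matrix.one_mul] at h2
    exact h2
  let K' : Matrix (DirBond B) (DirBond B) (orbitAnalytic L) := Matrix.of fun i j => x' (j, i)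
  have hKz₀ : K z₀ = (a * star a) • H₀ := by
    apply vec_inj.1
    rw [hKvec, vec_smul]
    have haev : ∀ f : Polynomial ℂ, Polynomial.aeval (T z₀) f *ᵥ vec H₀ = f.coeff 0 • vec H₀ := by
      intro f
      have h1 : f = Polynomial.divX f * Polynomial.X + Polynomial.C (f.coeff 0) :=
        (Polynomial.divX_mul_X_add f).symm
      conv_lhs => rw [h1]
      rw [map_add, map_mul, Polynomial.aeval_X, Polynomial.aeval_C, Matrix.add_mulVec,
        ← Matrix.mulVec_mulVec, hTH₀, Matrix.mulVec_zero, zero_add, Algebra.algebraMap_eq_smul_one,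
        Matrix.smul_mulVec, Matrix.one_mulVec]
    simp only [x, hx₀]
    rw [Matrix.mulVec_smul, haev, smul_smul, mul_comm, ← ha]
  refine ⟨fun z => K z + (K z)ᴴ, K' + (conjFun K')ᵀ, fun z => ?_, fun z => ?_, fun z => ?_,
    fun c z => ?_, z₀, ?_⟩
  · ext i j
    have h1 : (evalAt L z) ((K' + (conjFun K')ᵀ) i j) =
        (x' (j, i) : Torus B → ℂ) z + star ((x' (i, j) : Torus B → ℂ) z) := rfl
    rw [RingHom.mapMatrix_apply, Matrix.map_apply, h1, hx, hx]
    rfl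
  · change (K z + (K z)ᴴ)ᴴ = K z + (K z)ᴴ
    rw [conjTranspose_add, conjTranspose_conjTranspose, add_comm]
  · change evolution S₀ z * (K z + (K z)ᴴ) = (K z + (K z)ᴴ) * evolution S₀ z
    rw [Matrix.mul_add, Matrix.add_mul, hKcomm, hKHcomm]
  · have : K (rotate c z) = K z := by
      simp only [K, x, hTrot, hqrot]
    simp only [this]
  · have h1 : K z₀ + (K z₀)ᴴ = (2 * (a * star a)) • H₀ := by
      rw [hKz₀, conjTranspose_smul, hH₀h, star_mul', star_star, mul_comm (star a), ← add_smul,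
        two_mul]
    simp only [h1]
    rw [hH₀e.hasSimpleSpectrum_smul (by simp [ha0]), hH₀e.hasSimpleSpectrum_iff]
    have h2 : (fun k => expectation H₀ (v k)) = d := by
      funext k
      exact hH₀e.eq_expectation (hH₀v k)
    rw [h2]
    exact hdinj

theorem exists_isRegularChoice {L : Fin B → ℝ} (hL : LinearIndependent ℚ L)
    {S₀ : Matrix (DirBond B) (DirBond B) ℂ} (hS₀ : S₀ ∈ Matrix.unitaryGroup (DirBond B) ℂ) :
    ∃ ψ, IsEigenvectorChoice S₀ ψ ∧ IsRegularChoice L ψ := by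
  classical
  obtain ⟨N, N', hN, hherm, hcomm, hrot, z₀, hz₀⟩ := exists_commuting_family (L := L) hS₀
  have hdiag : ∀ z, ∃ v, IsEigenbasis (N z) v := fun z =>
    exists_isEigenbasis_of_isHermitian (hherm z)
  have hex : ∀ z, ∃ v, IsEigenbasis (evolution S₀ z) v ∧
      (HasSimpleSpectrum (N z) → IsEigenbasis (N z) v) := by
    intro z
    -- An eigenvector for a simple eigenvalue of `N z` is an eigenvector of everything that commutes
    -- with `N z`. At the exceptional points any eigenbasis of the evolution will do.
    by_cases hs : HasSimpleSpectrum (N z)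
    · obtain ⟨v, hv⟩ := hdiag z
      refine ⟨v, ⟨hv.1, fun k => ?_⟩, fun _ => hv⟩
      have hinj := hv.hasSimpleSpectrum_iff.1 hs
      refine ⟨star (v k) ⬝ᵥ (evolution S₀ z *ᵥ v k), ?_⟩
      conv_lhs => rw [← hv.sum_smul (evolution S₀ z *ᵥ v k)]
      refine Finset.sum_eq_single k (fun l _ hl => ?_) (by simp)
      have h1 := hv.star_dotProduct_mulVec l (evolution S₀ z *ᵥ v k)
      rw [Matrix.mulVec_mulVec, ← (hcomm z).eq, ← Matrix.mulVec_mulVec, hv.mulVec,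
        Matrix.mulVec_smul, dotProduct_smul, smul_eq_mul] at h1
      have h2 : star (v l) ⬝ᵥ (evolution S₀ z *ᵥ v k) = 0 := by
        by_contra hne
        exact hl (hinj (mul_right_cancel₀ hne h1).symm)
      rw [h2, zero_smul]
    · obtain ⟨v, hv⟩ := exists_isEigenbasis_of_unitary (evolution_mem_unitaryGroup hS₀ z)
      exact ⟨v, hv, fun h => absurd h hs⟩
  choose ψ hψ₁ hψ₂ using hex
  exact ⟨ψ, hψ₁, isRegularChoice_of_hasSimpleSpectrum hL hN
    (fun c z => ⟨1, one_ne_zero, by rw [hrot, one_smul]⟩) hdiag hz₀ hψ₂⟩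

end Commutant

/-! ### The phase distance on the unit circle -/

section PhaseDist

/-- The distance of a unit complex number from `1` along the circle. -/
def phaseDist (μ : ℂ) : ℝ := Real.arccos μ.re

theorem continuous_phaseDist : Continuous phaseDist :=
  Real.continuous_arccos.comp Complex.continuous_re

theorem phaseDist_nonneg (μ : ℂ) : 0 ≤ phaseDist μ := Real.arccos_nonneg _

theorem phaseDist_eq_angle {μ : ℂ} (h : ‖μ‖ = 1) :
    phaseDist μ = InnerProductGeometry.angle μ 1 := by
  rw [phaseDist, InnerProductGeometry.angle, h]
  simp

theorem phaseDist_exp {α : ℝ} (h : |α| ≤ Real.pi) : phaseDist (Complex.exp (α * Complex.I)) = |α| := by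
  rw [phaseDist, Complex.exp_ofReal_mul_I_re, ← Real.cos_abs, Real.arccos_cos (abs_nonneg _) h]

theorem abs_phaseDist_sub_le {μ ν : ℂ} (hμ : ‖μ‖ = 1) (hν : ‖ν‖ = 1) :
    |phaseDist μ - phaseDist ν| ≤ 2 * ‖μ - ν‖ := by
  have h1 := InnerProductGeometry.angle_le_angle_add_angle μ ν (1 : ℂ)
  have h2 := InnerProductGeometry.angle_le_angle_add_angle ν μ (1 : ℂ)
  have h3 := Complex.angle_le_mul_norm_sub hμ hν
  rw [InnerProductGeometry.angle_comm ν μ] at h2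
  -- An arc is at most `π / 2` times its chord; the constant is rounded up to `2`.
  have h4 : Real.pi / 2 * ‖μ - ν‖ ≤ 2 * ‖μ - ν‖ := by
    gcongr
    linarith [Real.pi_le_four]
  rw [phaseDist_eq_angle hμ, phaseDist_eq_angle hν, abs_le]
  constructor <;> linarith

theorem phaseDist_le {μ : ℂ} (hμ : ‖μ‖ = 1) : phaseDist μ ≤ 2 * ‖μ - 1‖ := by
  have h1 := abs_phaseDist_sub_le hμ (norm_one (α := ℂ))
  have h2 : phaseDist 1 = 0 := by simp [phaseDist]
  rw [h2, sub_zero] at h1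
  exact (le_abs_self _).trans h1

theorem exists_eq_exp_of_norm_eq_one {μ : ℂ} (hμ : ‖μ‖ = 1) :
    ∃ α : ℝ, μ = Complex.exp (α * Complex.I) ∧ |α| = phaseDist μ := by
  have h1 : μ = Complex.exp (μ.arg * Complex.I) := by
    conv_lhs => rw [← Complex.norm_mul_exp_arg_mul_I μ, hμ]
    simp
  refine ⟨μ.arg, h1, ?_⟩
  conv_rhs => rw [h1]
  rw [phaseDist_exp (Complex.abs_arg_le_pi μ)]

/-- The tent of half-width `a` on the circle. -/
def phaseTent (a : ℝ) (μ : ℂ) : ℝ := max 0 (1 - phaseDist μ / a)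

theorem phaseTent_nonneg (a : ℝ) (μ : ℂ) : 0 ≤ phaseTent a μ := le_max_left _ _

theorem phaseTent_le_one {a : ℝ} (ha : 0 ≤ a) (μ : ℂ) : phaseTent a μ ≤ 1 :=
  max_le zero_le_one (by linarith [div_nonneg (phaseDist_nonneg μ) ha])

theorem half_le_phaseTent {a : ℝ} (ha : 0 < a) {μ : ℂ} (h : phaseDist μ ≤ a / 2) :
    1 / 2 ≤ phaseTent a μ := by
  refine le_max_of_le_right ?_
  have : phaseDist μ / a ≤ 1 / 2 := by
    rw [div_le_iff₀ ha]; linarith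
  linarith

/-- An intermediate value argument: a curve on the circle close to `μ e^{i ℓ s}` passes
through `1`. -/
theorem exists_eq_one_of_curve {γ : ℝ → ℂ} {h ℓ κ : ℝ} {μ : ℂ} (hh : 0 < h) (hκ : 0 < κ)
    (hγ : ContinuousOn γ (Set.Icc (-h) h)) (hγ1 : ∀ s ∈ Set.Icc (-h) h, ‖γ s‖ = 1) (hμ : ‖μ‖ = 1)
    (hclose : ∀ s ∈ Set.Icc (-h) h, ‖γ s - μ * Complex.exp ((s * ℓ : ℝ) * Complex.I)‖ ≤ κ * |s|)
    (hℓ : 0 ≤ ℓ) (hhℓ : h * ℓ ≤ 1 / 2) (hθ : phaseDist μ ≤ h * (ℓ - 2 * κ)) :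
    ∃ s ∈ Set.Icc (-h) h, γ s = 1 := by
  obtain ⟨α, hα, hαd⟩ := exists_eq_exp_of_norm_eq_one hμ
  have hform : ∀ s : ℝ, μ * Complex.exp ((s * ℓ : ℝ) * Complex.I) =
      Complex.exp ((α + s * ℓ : ℝ) * Complex.I) := by
    intro s
    rw [hα, ← Complex.exp_add]
    push_cast
    ring_nf
  simp only [hform] at hclose
  have hα1 : |α| ≤ h * (ℓ - 2 * κ) := hαd ▸ hθ
  have hα2 := abs_le.1 hα1
  have him : ∀ s ∈ Set.Icc (-h) h, |(γ s).im - Real.sin (α + s * ℓ)| ≤ κ * h := by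
    intro s hs
    have h1 := (Complex.abs_im_le_norm _).trans (hclose s hs)
    rw [Complex.sub_im, Complex.exp_ofReal_mul_I_im] at h1
    exact h1.trans (by gcongr; exact abs_le.2 hs)
  have hre : ∀ s ∈ Set.Icc (-h) h, |(γ s).re - Real.cos (α + s * ℓ)| ≤ κ * h := by
    intro s hs
    have h1 := (Complex.abs_re_le_norm _).trans (hclose s hs)
    rw [Complex.sub_re, Complex.exp_ofReal_mul_I_re] at h1
    exact h1.trans (by gcongr; exact abs_le.2 hs)
  have hκh0 : 0 < κ * h := by positivity
  -- On this range `sin y ≥ 2y/π > y/2`. The bound on the initial phase leaves an angle of at least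
  -- `2κh` at either end of the interval, so the sign of the imaginary part there survives the
  -- perturbation `κh`.
  have hsin : ∀ y : ℝ, 2 * (κ * h) ≤ y → y ≤ 1 → κ * h < Real.sin y := by
    intro y hy1 hy2
    have h1 := Real.mul_le_sin (x := y) (by linarith) (by linarith [Real.pi_gt_three])
    have h2 : 1 / 2 < 2 / Real.pi := by
      rw [div_lt_div_iff₀ (by norm_num) Real.pi_pos]
      linarith [Real.pi_lt_four]
    have h3 : 1 / 2 * y < 2 / Real.pi * y := by
      apply mul_lt_mul_of_pos_right h2
      linarith
    linarith
  have hend1 : 0 < (γ h).im := by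
    have h1 := abs_le.1 (him h ⟨by linarith, le_rfl⟩)
    have h2 := hsin (α + h * ℓ) (by nlinarith) (by nlinarith)
    linarith
  have hend2 : (γ (-h)).im < 0 := by
    have h1 := abs_le.1 (him (-h) ⟨le_rfl, by linarith⟩)
    have h2 := hsin (-(α + -h * ℓ)) (by nlinarith) (by nlinarith)
    rw [Real.sin_neg] at h2
    linarith
  have hcont : ContinuousOn (fun s => (γ s).im) (Set.Icc (-h) h) :=
    Complex.continuous_im.comp_continuousOn hγ
  obtain ⟨s, hs, hs0⟩ := intermediate_value_Icc (by linarith : -h ≤ h) hcont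
    (show (0 : ℝ) ∈ Set.Icc ((γ (-h)).im) ((γ h).im) from ⟨hend2.le, hend1.le⟩)
  refine ⟨s, hs, ?_⟩
  have hs0' : (γ s).im = 0 := hs0
  -- A real number on the unit circle is `1` or `-1`; the whole arc stays away from `-1`.
  have hpos : 0 < (γ s).re := by
    have h1 := abs_le.1 (hre s hs)
    have h2 := Real.one_sub_sq_div_two_le_cos (x := α + s * ℓ)
    have h3 : |α + s * ℓ| ≤ 1 := by
      have h4 : |s * ℓ| ≤ 1 / 2 := by
        rw [abs_mul, abs_of_nonneg hℓ]
        exact (mul_le_mul_of_nonneg_right (abs_le.2 hs) hℓ).trans hhℓ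
      have h5 : |α| ≤ 1 / 2 := by nlinarith
      linarith [abs_add_le α (s * ℓ)]
    have h4 : (α + s * ℓ) ^ 2 ≤ 1 := by
      rw [← sq_abs]; exact pow_le_one₀ (abs_nonneg _) h3
    nlinarith
  have hn := hγ1 s hs
  rw [← Complex.re_add_im (γ s), hs0'] at hn ⊢
  simp only [Complex.ofReal_zero, zero_mul, add_zero, Complex.norm_real, Real.norm_eq_abs,
    abs_of_pos hpos] at hn ⊢
  rw [hn]; simp

end PhaseDist

/-! ### Motion of one eigenvalue along the flow -/

section LocalEstimates

variable {B : ℕ} {S₀ : Matrix (DirBond B) (DirBond B) ℂ} {L : Fin B → ℝ}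
  {ψ : Torus B → DirBond B → DirBond B → ℂ}

/-- The projection on a vector of the chosen basis, as an array with the supremum norm. -/
def proj (ψ : Torus B → DirBond B → DirBond B → ℂ) (z : Torus B) (k : DirBond B) :
    DirBond B → DirBond B → ℂ := rankOne (ψ z k)

theorem proj_apply (z : Torus B) (k i j : DirBond B) :
    proj ψ z k i j = ψ z k i * star (ψ z k j) := rfl

/-- The eigenvalue that belongs to a vector of the chosen basis. -/
def eigval (S₀ : Matrix (DirBond B) (DirBond B) ℂ) (ψ : Torus B → DirBond B → DirBond B → ℂ)
    (z : Torus B) (k : DirBond B) : ℂ := expectation (evolution S₀ z) (ψ z k)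

/-- `tr (A P)`. -/
def traceMul (A : Matrix (DirBond B) (DirBond B) ℂ) (P : DirBond B → DirBond B → ℂ) : ℂ :=
  ∑ i, ∑ j, A i j * P j i

theorem continuous_traceMul :
    Continuous fun p : Matrix (DirBond B) (DirBond B) ℂ × (DirBond B → DirBond B → ℂ) =>
      traceMul p.1 p.2 := by
  refine continuous_finsetSum _ fun i _ => continuous_finsetSum _ fun j _ => ?_
  have h1 : Continuous fun p : Matrix (DirBond B) (DirBond B) ℂ × (DirBond B → DirBond B → ℂ) =>
    p.1 i j := (continuous_apply_apply i j).comp continuous_fst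
  have h2 : Continuous fun p : Matrix (DirBond B) (DirBond B) ℂ × (DirBond B → DirBond B → ℂ) =>
    p.2 j i := (continuous_apply_apply j i).comp continuous_snd
  exact h1.mul h2

theorem traceMul_proj (A : Matrix (DirBond B) (DirBond B) ℂ) (z : Torus B) (k : DirBond B) :
    traceMul A (proj ψ z k) = expectation A (ψ z k) := by
  rw [expectation_eq_trace]
  rfl

/-- The mean length `⟨L⟩` in the state of a projection. -/
def lengthOf (L : Fin B → ℝ) (P : DirBond B → DirBond B → ℂ) : ℝ :=
  ∑ i, L (bond i) * (P i i).re

theorem continuous_lengthOf (L : Fin B → ℝ) : Continuous (lengthOf L) := by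
  refine continuous_finsetSum _ fun i _ => continuous_const.mul ?_
  exact Complex.continuous_re.comp (continuous_apply_apply i i)

theorem proj_diag (z : Torus B) (k i : DirBond B) :
    proj ψ z k i i = ((‖ψ z k i‖ ^ 2 : ℝ) : ℂ) := by
  rw [proj_apply, Complex.star_def, Complex.mul_conj']
  simp

theorem sum_norm_sq (hψ : IsEigenvectorChoice S₀ ψ) (z : Torus B) (k : DirBond B) :
    ∑ i, ‖ψ z k i‖ ^ 2 = 1 := by
  have h := (hψ z).star_dotProduct_self k
  rw [star_dotProduct_self_eq] at h
  exact_mod_cast h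

theorem expectation_bondLength (z : Torus B) (k : DirBond B) :
    expectation (bondLength L) (ψ z k) = (lengthOf L (proj ψ z k) : ℂ) := by
  rw [← traceMul_proj, traceMul, lengthOf, Complex.ofReal_sum]
  refine Finset.sum_congr rfl fun i _ => ?_
  rw [Finset.sum_eq_single i, proj_diag, bondLength, Matrix.diagonal_apply_eq,
    sumElim_eq_bond (fun b => (L b : ℂ)), Complex.ofReal_re, Complex.ofReal_mul]
  · intro j _ hj
    rw [bondLength, Matrix.diagonal_apply_ne' _ hj, zero_mul]
  · simp

theorem lengthOf_proj (z : Torus B) (k : DirBond B) :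
    lengthOf L (proj ψ z k) = ∑ i, L (bond i) * ‖ψ z k i‖ ^ 2 := by
  simp only [lengthOf, proj_diag, Complex.ofReal_re]

theorem le_lengthOf (hψ : IsEigenvectorChoice S₀ ψ) {ℓ₀ : ℝ} (h₀ : ∀ b, ℓ₀ ≤ L b) (z : Torus B)
    (k : DirBond B) : ℓ₀ ≤ lengthOf L (proj ψ z k) := by
  rw [lengthOf_proj, ← mul_one ℓ₀, ← sum_norm_sq hψ z k, Finset.mul_sum]
  exact Finset.sum_le_sum fun i _ => mul_le_mul_of_nonneg_right (h₀ _) (by positivity)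

theorem lengthOf_le (hψ : IsEigenvectorChoice S₀ ψ) {Lm : ℝ} (hm : ∀ b, L b ≤ Lm) (z : Torus B)
    (k : DirBond B) : lengthOf L (proj ψ z k) ≤ Lm := by
  rw [lengthOf_proj, ← mul_one Lm, ← sum_norm_sq hψ z k, Finset.mul_sum]
  exact Finset.sum_le_sum fun i _ => mul_le_mul_of_nonneg_right (hm _) (by positivity)

theorem norm_proj_apply_le (hψ : IsEigenvectorChoice S₀ ψ) (z : Torus B) (k i j : DirBond B) :
    ‖proj ψ z k i j‖ ≤ 1 := by
  rw [proj_apply, norm_mul, norm_star]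
  exact mul_le_one₀ ((hψ z).norm_apply_le k i) (norm_nonneg _) ((hψ z).norm_apply_le k j)

theorem norm_proj_le (hψ : IsEigenvectorChoice S₀ ψ) (z : Torus B) (k : DirBond B) :
    ‖proj ψ z k‖ ≤ 1 := by
  rw [pi_norm_le_iff_of_nonneg zero_le_one]
  intro i
  rw [pi_norm_le_iff_of_nonneg zero_le_one]
  exact norm_proj_apply_le hψ z k i

theorem norm_apply_apply_le (P : DirBond B → DirBond B → ℂ) (i j : DirBond B) : ‖P i j‖ ≤ ‖P‖ :=
  (norm_le_pi_norm (P i) j).trans (norm_le_pi_norm P i)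

theorem norm_eigval (hS₀ : S₀ ∈ Matrix.unitaryGroup (DirBond B) ℂ)
    (hψ : IsEigenvectorChoice S₀ ψ) (z : Torus B) (k : DirBond B) : ‖eigval S₀ ψ z k‖ = 1 := by
  have h1 := (hψ z).mulVec k
  have hM : (evolution S₀ z)ᴴ * evolution S₀ z = 1 :=
    Matrix.mem_unitaryGroup_iff'.1 (evolution_mem_unitaryGroup hS₀ z)
  have h2 : star (evolution S₀ z *ᵥ ψ z k) ⬝ᵥ (evolution S₀ z *ᵥ ψ z k) = 1 := by
    rw [Matrix.star_mulVec, ← Matrix.dotProduct_mulVec, Matrix.mulVec_mulVec, hM,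
      Matrix.one_mulVec, (hψ z).star_dotProduct_self]
  rw [h1, star_smul, smul_dotProduct, dotProduct_smul, (hψ z).star_dotProduct_self] at h2
  simp only [smul_eq_mul, mul_one, Complex.star_def, Complex.conj_mul'] at h2
  have h3 : ‖eigval S₀ ψ z k‖ ^ 2 = 1 := by exact_mod_cast h2
  exact (pow_eq_one_iff_of_nonneg (norm_nonneg _) two_ne_zero).1 h3

theorem eigval_eq_traceMul (z : Torus B) (k : DirBond B) :
    eigval S₀ ψ z k = traceMul (evolution S₀ z) (proj ψ z k) := (traceMul_proj _ z k).symm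

/-- `∑ E_i P_{ij} Q_{ji}`. -/
def overlap (E : DirBond B → ℂ) (P Q : DirBond B → DirBond B → ℂ) : ℂ :=
  ∑ i, ∑ j, E i * (P i j * Q j i)

/-- The product `⟨w|E|v⟩⟨v|w⟩` does not depend on the phases of the two vectors, so perturbation
theory can be done with projections alone. -/
theorem overlap_proj (E : DirBond B → ℂ) (z w : Torus B) (k l : DirBond B) :
    overlap E (proj ψ z k) (proj ψ w l) =
      (star (ψ w l) ⬝ᵥ fun i => E i * ψ z k i) * (star (ψ z k) ⬝ᵥ ψ w l) := by
  simp only [overlap, dotProduct, proj_apply, Finset.sum_mul_sum, Pi.star_apply]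
  refine Finset.sum_congr rfl fun i _ => Finset.sum_congr rfl fun j _ => ?_
  ring

theorem norm_overlap_le {E : DirBond B → ℂ} {P Q : DirBond B → DirBond B → ℂ} {a b c : ℝ}
    (hE : ∀ i, ‖E i‖ ≤ a) (hP : ‖P‖ ≤ b) (hQ : ‖Q‖ ≤ c) :
    ‖overlap E P Q‖ ≤ (2 * B) ^ 2 * (a * (b * c)) := by
  have hcard : (Finset.univ : Finset (DirBond B)).card = 2 * B := by
    simp [two_mul]
  have h1 : ∀ i j, ‖E i * (P i j * Q j i)‖ ≤ a * (b * c) := fun i j => by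
    have hi := hE i
    have ha : 0 ≤ a := (norm_nonneg _).trans hi
    have hb := (norm_apply_apply_le P i j).trans hP
    have hb0 : 0 ≤ b := (norm_nonneg _).trans hP
    have hc := (norm_apply_apply_le Q j i).trans hQ
    rw [norm_mul, norm_mul]
    gcongr
  refine (norm_sum_le_of_le _ fun i _ => norm_sum_le_of_le _ fun j _ => h1 i j).trans ?_
  rw [Finset.sum_const, Finset.sum_const, hcard, nsmul_eq_mul, nsmul_eq_mul]
  push_cast
  apply le_of_eq
  ring

theorem overlap_self (hψ : IsEigenvectorChoice S₀ ψ) (z : Torus B) (k : DirBond B) :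
    overlap (fun _ => 1) (proj ψ z k) (proj ψ z k) = 1 := by
  rw [overlap_proj]
  simp only [one_mul]
  change (star (ψ z k) ⬝ᵥ ψ z k) * (star (ψ z k) ⬝ᵥ ψ z k) = 1
  rw [(hψ z).star_dotProduct_self, one_mul]

theorem overlap_length_self (hψ : IsEigenvectorChoice S₀ ψ) (z : Torus B) (k : DirBond B) :
    overlap (fun i => (L (bond i) : ℂ)) (proj ψ z k) (proj ψ z k) =
      lengthOf L (proj ψ z k) := by
  rw [overlap_proj, (hψ z).star_dotProduct_self, mul_one, lengthOf_proj, dotProduct]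
  push_cast
  refine Finset.sum_congr rfl fun i _ => ?_
  have := Complex.conj_mul' (ψ z k i)
  rw [Pi.star_apply, Complex.star_def]
  linear_combination (L (bond i) : ℂ) * this

theorem overlap_sub_right (E : DirBond B → ℂ) (P Q R : DirBond B → DirBond B → ℂ) :
    overlap E P (Q - R) = overlap E P Q - overlap E P R := by
  simp only [overlap, Pi.sub_apply, mul_sub, Finset.sum_sub_distrib]

theorem overlap_sub_left (E F : DirBond B → ℂ) (P Q : DirBond B → DirBond B → ℂ) :
    overlap (E - F) P Q = overlap E P Q - overlap F P Q := by
  simp only [overlap, Pi.sub_apply, sub_mul, Finset.sum_sub_distrib]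

theorem overlap_smul_left (c : ℂ) (E : DirBond B → ℂ) (P Q : DirBond B → DirBond B → ℂ) :
    overlap (c • E) P Q = c * overlap E P Q := by
  simp only [overlap, Pi.smul_apply, smul_eq_mul, Finset.mul_sum, mul_assoc]

/-- Different vectors of one basis have well separated projections. -/
theorem eq_of_norm_proj_sub_lt (hψ : IsEigenvectorChoice S₀ ψ) {z : Torus B} {k l : DirBond B}
    (h : (2 * B : ℝ) ^ 2 * ‖proj ψ z l - proj ψ z k‖ < 1) : k = l := by
  by_contra hne
  have h1 : overlap (fun _ => 1) (proj ψ z k) (proj ψ z l) = 0 := by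
    rw [overlap_proj, (hψ z).1 k l, if_neg hne, mul_zero]
  have h2 := norm_overlap_le (E := fun _ : DirBond B => (1 : ℂ)) (a := 1) (fun _ => by simp)
    (norm_proj_le hψ z k) (le_refl ‖proj ψ z l - proj ψ z k‖)
  rw [overlap_sub_right, h1, overlap_self hψ, zero_sub, norm_neg, norm_one, one_mul, one_mul] at h2
  linarith

/-- The phases `e^{i s L}` on directed bonds. -/
def bondPhase (L : Fin B → ℝ) (s : ℝ) (i : DirBond B) : ℂ :=
  Complex.exp ((s * L (bond i) : ℝ) * Complex.I)

theorem evolution_flow_add_mulVec (t s : ℝ) (x : DirBond B → ℂ) (i : DirBond B) :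
    (evolution S₀ (flow L (t + s)) *ᵥ x) i =
      bondPhase L s i * (evolution S₀ (flow L t) *ᵥ x) i := by
  simp only [Matrix.mulVec, dotProduct, Finset.mul_sum, evolution_apply, flow_add, Pi.mul_apply,
    Circle.coe_mul]
  refine Finset.sum_congr rfl fun j _ => ?_
  have : ((flow L s (bond i) : Circle) : ℂ) = bondPhase L s i := by
    simp [flow, expTorus, bondPhase]
  rw [this]
  ring

/-- Exact perturbation identity: the matrix element of the evolution at time `t + s` between an old
and a new eigenvector is evaluated on either side. To first order in `s` it gives the angular
velocity `⟨L⟩`. -/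
theorem eigval_mul_overlap (hψ : IsEigenvectorChoice S₀ ψ) (t s : ℝ) (k l : DirBond B) :
    eigval S₀ ψ (flow L (t + s)) l *
        overlap (fun _ => 1) (proj ψ (flow L t) k) (proj ψ (flow L (t + s)) l) =
      eigval S₀ ψ (flow L t) k *
        overlap (bondPhase L s) (proj ψ (flow L t) k) (proj ψ (flow L (t + s)) l) := by
  have h1 := (hψ (flow L (t + s))).star_dotProduct_mulVec l (ψ (flow L t) k)
  have h2 : evolution S₀ (flow L (t + s)) *ᵥ ψ (flow L t) k =
      eigval S₀ ψ (flow L t) k • fun i => bondPhase L s i * ψ (flow L t) k i := by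
    funext i
    rw [evolution_flow_add_mulVec, (hψ (flow L t)).mulVec, Pi.smul_apply, Pi.smul_apply,
      smul_eq_mul, smul_eq_mul, eigval]
    ring
  rw [h2, dotProduct_smul, smul_eq_mul] at h1
  rw [overlap_proj, overlap_proj, ← mul_assoc, ← mul_assoc, h1]
  simp only [one_mul]
  rfl

theorem norm_exp_sub_le {x : ℝ} (hx : |x| ≤ 1) :
    ‖Complex.exp (x * Complex.I) - 1 - x * Complex.I‖ ≤ x ^ 2 := by
  have h : ‖(x : ℂ) * Complex.I‖ = |x| := by simp
  have := Complex.norm_exp_sub_one_sub_id_le (x := x * Complex.I) (by rwa [h])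
  rwa [h, sq_abs] at this

/-- Along the flow, an eigenvalue whose eigenprojection moves little turns with angular velocity
close to `⟨L⟩`. -/
theorem norm_eigval_sub_le (hS₀ : S₀ ∈ Matrix.unitaryGroup (DirBond B) ℂ)
    (hψ : IsEigenvectorChoice S₀ ψ) {Lm : ℝ} (hLpos : ∀ b, 0 < L b) (hm : ∀ b, L b ≤ Lm)
    (hLm : 0 < Lm) {t s ε : ℝ} {k l : DirBond B} (hs : |s| * Lm ≤ 1)
    (hε : (2 * B : ℝ) ^ 2 * ε ≤ 1 / 2)
    (hP : ‖proj ψ (flow L (t + s)) l - proj ψ (flow L t) k‖ ≤ ε) :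
    ‖eigval S₀ ψ (flow L (t + s)) l - eigval S₀ ψ (flow L t) k *
        Complex.exp ((s * lengthOf L (proj ψ (flow L t) k) : ℝ) * Complex.I)‖ ≤
      (3 * (2 * B) ^ 2 * Lm * (Lm * |s| + ε)) * |s| := by
  have hB1 : (1 : ℝ) ≤ (2 * B) ^ 2 := by
    have : 0 < B := (bond k).pos
    have : (1 : ℝ) ≤ B := by exact_mod_cast this
    nlinarith
  set P := proj ψ (flow L t) k with hPdef
  set Q := proj ψ (flow L (t + s)) l with hQdef
  set ℓ := lengthOf L P with hℓ
  set μ := eigval S₀ ψ (flow L t) k with hμ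
  set μ' := eigval S₀ ψ (flow L (t + s)) l with hμ'
  set n2 : ℝ := (2 * B) ^ 2 with hn2
  have hP1 : ‖P‖ ≤ 1 := norm_proj_le hψ _ _
  have hQ1 : ‖Q‖ ≤ 1 := norm_proj_le hψ _ _
  have hℓ0 : 0 ≤ ℓ := le_lengthOf hψ (fun b => (hLpos b).le) _ _
  have hℓm : ℓ ≤ Lm := lengthOf_le hψ hm _ _
  have hε0 : 0 ≤ ε := (norm_nonneg _).trans hP
  have key := eigval_mul_overlap (L := L) hψ t s k l
  set o := overlap (fun _ => 1) P Q with ho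
  set os := overlap (bondPhase L s) P Q with hos
  let EL : DirBond B → ℂ := fun i => (L (bond i) : ℂ)
  -- Here `e^{isL}` is expanded as `1 + isL` with remainder `R1 = O(s²)`, and `L` is replaced by its
  -- mean `ℓ`. The defect `R2` vanishes when `Q = P`, hence is of the order of the change of the
  -- projection.
  let R1 := overlap (bondPhase L s - (fun _ => 1) - (s * Complex.I) • EL) P Q
  let R2 := overlap (EL - (ℓ : ℂ) • fun _ => 1) P Q
  have hsum : os = o + s * Complex.I * ℓ * o + s * Complex.I * R2 + R1 := by
    simp only [R1, R2, overlap_sub_left, overlap_smul_left]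
    ring
  have hR1 : ‖R1‖ ≤ n2 * ((|s| * Lm) ^ 2 * (1 * 1)) := by
    refine norm_overlap_le (fun i => ?_) hP1 hQ1
    have hLi : |s * L (bond i)| ≤ |s| * Lm := by
      rw [abs_mul, abs_of_pos (hLpos _)]
      exact mul_le_mul_of_nonneg_left (hm _) (abs_nonneg s)
    have h1 := norm_exp_sub_le (hLi.trans hs)
    have h2 : (bondPhase L s - (fun _ => 1) - (s * Complex.I) • EL : DirBond B → ℂ) i =
        Complex.exp ((s * L (bond i) : ℝ) * Complex.I) - 1 - ((s * L (bond i) : ℝ) : ℂ) * Complex.I := by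
      simp only [Pi.sub_apply, Pi.smul_apply, smul_eq_mul, bondPhase, EL]
      push_cast
      ring
    rw [h2]
    refine h1.trans ?_
    rw [← sq_abs]
    exact pow_le_pow_left₀ (abs_nonneg _) hLi 2
  have hR2 : ‖R2‖ ≤ n2 * (Lm * (1 * ε)) := by
    have h1 : R2 = overlap (EL - (ℓ : ℂ) • fun _ => 1) P (Q - P) := by
      have h2 : overlap (EL - (ℓ : ℂ) • fun _ => 1) P P = 0 := by
        rw [overlap_sub_left, overlap_smul_left, overlap_self hψ, overlap_length_self hψ, mul_one,
          sub_self]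
      rw [overlap_sub_right, h2, sub_zero]
    rw [h1]
    refine norm_overlap_le (fun i => ?_) hP1 hP
    have h2 : (EL - (ℓ : ℂ) • (fun _ => 1) : DirBond B → ℂ) i = ((L (bond i) - ℓ : ℝ) : ℂ) := by
      simp [EL]
    rw [h2, Complex.norm_real, Real.norm_eq_abs, abs_le]
    constructor <;> linarith [hLpos (bond i), hm (bond i)]
  have ho1 : 1 / 2 ≤ ‖o‖ := by
    have h1 : ‖o - 1‖ ≤ n2 * (1 * (1 * ε)) := by
      have h2 : o - 1 = overlap (fun _ => 1) P (Q - P) := by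
        rw [overlap_sub_right, overlap_self hψ]
      rw [h2]
      exact norm_overlap_le (fun i => by simp) hP1 hP
    have h3 : ‖(1 : ℂ)‖ ≤ ‖o‖ + ‖o - 1‖ := by
      calc ‖(1 : ℂ)‖ = ‖o - (o - 1)‖ := by congr 1; ring
        _ ≤ _ := norm_sub_le _ _
    rw [norm_one] at h3
    linarith
  have hμ1 : ‖μ‖ = 1 := norm_eigval hS₀ hψ _ _
  have h4 : (μ' - μ * (1 + s * ℓ * Complex.I)) * o = μ * (s * Complex.I * R2 + R1) := by
    rw [hsum] at key
    linear_combination key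
  have h5 : ‖μ' - μ * (1 + s * ℓ * Complex.I)‖ * (1 / 2) ≤
      |s| * (n2 * (Lm * (1 * ε))) + n2 * ((|s| * Lm) ^ 2 * (1 * 1)) := by
    calc _ ≤ ‖μ' - μ * (1 + s * ℓ * Complex.I)‖ * ‖o‖ := by gcongr
      _ = ‖s * Complex.I * R2 + R1‖ := by rw [← norm_mul, h4, norm_mul, hμ1, one_mul]
      _ ≤ ‖s * Complex.I * R2‖ + ‖R1‖ := norm_add_le _ _
      _ = |s| * ‖R2‖ + ‖R1‖ := by simp
      _ ≤ _ := by gcongr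
  have hsl : |s * ℓ| ≤ |s| * Lm := by
    rw [abs_mul, abs_of_nonneg hℓ0]; gcongr
  have h6 : ‖Complex.exp ((s * ℓ : ℝ) * Complex.I) - 1 - ((s * ℓ : ℝ) : ℂ) * Complex.I‖ ≤
      (|s| * Lm) ^ 2 := by
    refine (norm_exp_sub_le (hsl.trans hs)).trans ?_
    rw [← sq_abs]
    exact pow_le_pow_left₀ (abs_nonneg _) hsl 2
  have h7 : (|s| * Lm) ^ 2 ≤ n2 * (|s| * Lm) ^ 2 := le_mul_of_one_le_left (by positivity) hB1
  -- The constant `3` is a `2` from dividing by an overlap of norm at least `1/2`, and a `1` from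
  -- replacing `1 + isℓ` by `e^{isℓ}`.
  calc _ = ‖(μ' - μ * (1 + s * ℓ * Complex.I)) - μ * (Complex.exp ((s * ℓ : ℝ) * Complex.I) - 1 -
        ((s * ℓ : ℝ) : ℂ) * Complex.I)‖ := by
        congr 1
        push_cast
        ring
    _ ≤ ‖μ' - μ * (1 + s * ℓ * Complex.I)‖ + (|s| * Lm) ^ 2 := by
        refine (norm_sub_le _ _).trans ?_
        rw [norm_mul μ, hμ1, one_mul]
        gcongr
    _ ≤ 2 * (|s| * (n2 * (Lm * (1 * ε))) + n2 * ((|s| * Lm) ^ 2 * (1 * 1))) +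
          n2 * (|s| * Lm) ^ 2 := by linarith
    _ ≤ _ := by
        have : 0 ≤ |s| * (n2 * (Lm * ε)) := by positivity
        linarith

/-- If `1` is an eigenvalue at time `t + s`, then at time `t` there is an eigenvalue close to
`1`. -/
theorem exists_phaseDist_eigval_le (hS₀ : S₀ ∈ Matrix.unitaryGroup (DirBond B) ℂ)
    (hψ : IsEigenvectorChoice S₀ ψ) {Lm : ℝ} (hLpos : ∀ b, 0 < L b) (hm : ∀ b, L b ≤ Lm)
    {t s : ℝ} {l : DirBond B} (hl : eigval S₀ ψ (flow L (t + s)) l = 1) :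
    ∃ k, phaseDist (eigval S₀ ψ (flow L t) k) ≤ 2 * (|s| * Lm) := by
  suffices h : ∃ k, ‖eigval S₀ ψ (flow L t) k - 1‖ ≤ |s| * Lm by
    obtain ⟨k, hk⟩ := h
    exact ⟨k, (phaseDist_le (norm_eigval hS₀ hψ _ _)).trans (by linarith)⟩
  -- The fixed vector `x` at time `t + s` is moved at time `t` by at most `|s| Lm`. By Parseval it
  -- would be moved further if all eigenvalues were further than that from `1`.
  by_contra! hcon
  set x := ψ (flow L (t + s)) l with hx
  have hfix : evolution S₀ (flow L (t + s)) *ᵥ x = x := by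
    have := (hψ (flow L (t + s))).mulVec l
    rw [← hx] at this
    rw [this]
    change eigval S₀ ψ (flow L (t + s)) l • x = x
    rw [hl, one_smul]
  have hback : evolution S₀ (flow L t) *ᵥ x = fun i => bondPhase L (-s) i * x i := by
    funext i
    have := evolution_flow_add_mulVec (S₀ := S₀) (L := L) (t + s) (-s) x i
    rw [add_neg_cancel_right, hfix] at this
    exact this
  have hpar1 := (hψ (flow L t)).parseval x
  have hpar2 := (hψ (flow L t)).parseval (evolution S₀ (flow L t) *ᵥ x - x)
  have hLm0 : ∀ i, ‖(evolution S₀ (flow L t) *ᵥ x - x) i‖ ^ 2 ≤ (|s| * Lm) ^ 2 * ‖x i‖ ^ 2 := by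
    intro i
    rw [Pi.sub_apply, hback]
    have h1 : bondPhase L (-s) i * x i - x i = (bondPhase L (-s) i - 1) * x i := by ring
    rw [h1, norm_mul, mul_pow]
    gcongr
    have h2 := Real.norm_exp_I_mul_ofReal_sub_one_le (x := -s * L (bond i))
    rw [mul_comm] at h2
    refine h2.trans ?_
    rw [norm_mul, Real.norm_eq_abs, Real.norm_eq_abs, abs_neg, abs_of_pos (hLpos _)]
    exact mul_le_mul_of_nonneg_left (hm _) (abs_nonneg _)
  have hcoef : ∀ k, star (ψ (flow L t) k) ⬝ᵥ (evolution S₀ (flow L t) *ᵥ x - x) =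
      (eigval S₀ ψ (flow L t) k - 1) * (star (ψ (flow L t) k) ⬝ᵥ x) := by
    intro k
    rw [dotProduct_sub, (hψ (flow L t)).star_dotProduct_mulVec, sub_mul, one_mul, eigval]
  have hone : ∑ i, ‖x i‖ ^ 2 = 1 := sum_norm_sq hψ _ _
  rw [hone] at hpar1
  obtain ⟨k₀, hk₀⟩ : ∃ k, ‖star (ψ (flow L t) k) ⬝ᵥ x‖ ^ 2 ≠ 0 := by
    by_contra! h
    simp [h] at hpar1
  have hsLm : 0 ≤ |s| * Lm := mul_nonneg (abs_nonneg _) ((hLpos (bond l)).le.trans (hm _))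
  have hlt : ∑ k, (|s| * Lm) ^ 2 * ‖star (ψ (flow L t) k) ⬝ᵥ x‖ ^ 2 <
      ∑ k, ‖star (ψ (flow L t) k) ⬝ᵥ (evolution S₀ (flow L t) *ᵥ x - x)‖ ^ 2 := by
    refine Finset.sum_lt_sum (fun k _ => ?_) ⟨k₀, Finset.mem_univ _, ?_⟩
    · rw [hcoef, norm_mul, mul_pow ‖eigval S₀ ψ (flow L t) k - 1‖]
      gcongr
      exact (hcon k).le
    · rw [hcoef, norm_mul, mul_pow ‖eigval S₀ ψ (flow L t) k₀ - 1‖]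
      have : 0 < ‖star (ψ (flow L t) k₀) ⬝ᵥ x‖ ^ 2 := lt_of_le_of_ne (by positivity) (Ne.symm hk₀)
      exact mul_lt_mul_of_pos_right (pow_lt_pow_left₀ (hcon k₀) hsLm two_ne_zero) this
  rw [← Finset.mul_sum, hpar1, hpar2, mul_one] at hlt
  have hle := Finset.sum_le_sum fun i (_ : i ∈ Finset.univ) => hLm0 i
  rw [← Finset.mul_sum, hone, mul_one] at hle
  linarith

end LocalEstimates

/-! ### Spacing of the spectrum -/

section Spacing

variable {B : ℕ} {S₀ : Matrix (DirBond B) (DirBond B) ℂ} {L : Fin B → ℝ}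
  {ψ : Torus B → DirBond B → DirBond B → ℂ} {lam : ℕ → ℝ} {j : ℕ → DirBond B}

theorem IsSpectralSequence.pos (h : IsSpectralSequence S₀ L ψ lam j) (n : ℕ) : 0 < lam n :=
  (h.2.mapsTo (Set.mem_univ n)).1.1

theorem IsSpectralSequence.mulVec (h : IsSpectralSequence S₀ L ψ lam j) (n : ℕ) :
    evolution S₀ (flow L (lam n)) *ᵥ ψ (flow L (lam n)) (j n) = ψ (flow L (lam n)) (j n) :=
  (h.2.mapsTo (Set.mem_univ n)).2

theorem IsSpectralSequence.eigval (h : IsSpectralSequence S₀ L ψ lam j)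
    (hψ : IsEigenvectorChoice S₀ ψ) (n : ℕ) : eigval S₀ ψ (flow L (lam n)) (j n) = 1 :=
  (hψ (flow L (lam n))).eq_expectation (by rw [h.mulVec, one_smul])

theorem IsSpectralSequence.injective (h : IsSpectralSequence S₀ L ψ lam j) {m n : ℕ}
    (h1 : lam m = lam n) (h2 : j m = j n) : m = n :=
  h.2.injOn (Set.mem_univ m) (Set.mem_univ n) (Prod.ext h1 h2)

theorem IsSpectralSequence.exists_eq (h : IsSpectralSequence S₀ L ψ lam j)
    (hψ : IsEigenvectorChoice S₀ ψ) {t : ℝ} (ht : 0 < t) {k : DirBond B}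
    (hk : QuantumGraph.eigval S₀ ψ (flow L t) k = 1) : ∃ n, lam n = t ∧ j n = k := by
  have h1 : evolution S₀ (flow L t) *ᵥ ψ (flow L t) k = ψ (flow L t) k := by
    rw [(hψ (flow L t)).mulVec]
    change QuantumGraph.eigval S₀ ψ (flow L t) k • _ = _
    rw [hk, one_smul]
  have hne : ψ (flow L t) k ≠ 0 := by
    intro h0
    have := (hψ (flow L t)).star_dotProduct_self k
    rw [h0] at this
    simp at this
  obtain ⟨n, -, hn⟩ := h.2.surjOn (a := (t, k)) ⟨⟨ht, by
    rw [← Matrix.exists_mulVec_eq_zero_iff]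
    exact ⟨_, hne, by rw [Matrix.sub_mulVec, Matrix.one_mulVec, h1, sub_self]⟩⟩, h1⟩
  exact ⟨n, congrArg Prod.fst hn, congrArg Prod.snd hn⟩

/-- Fixed vectors of the evolution at different close times are almost orthogonal with respect to
the weight `L`. -/
theorem norm_sum_length_le (hS₀ : S₀ ∈ Matrix.unitaryGroup (DirBond B) ℂ) {Lm : ℝ}
    (hLpos : ∀ b, 0 < L b) (hm : ∀ b, L b ≤ Lm) {t s : ℝ} (hs0 : s ≠ 0) (hs : |s| * Lm ≤ 1)
    {x y : DirBond B → ℂ} (hx : evolution S₀ (flow L t) *ᵥ x = x)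
    (hy : evolution S₀ (flow L (t + s)) *ᵥ y = y) :
    ‖∑ i, (L (bond i) : ℂ) * (star (y i) * x i)‖ ≤ |s| * Lm ^ 2 * (2 * B) * ‖x‖ * ‖y‖ := by
  have hM : (evolution S₀ (flow L (t + s)))ᴴ * evolution S₀ (flow L (t + s)) = 1 :=
    Matrix.mem_unitaryGroup_iff'.1 (evolution_mem_unitaryGroup hS₀ _)
  have h1 : star y ⬝ᵥ (evolution S₀ (flow L (t + s)) *ᵥ x) = star y ⬝ᵥ x := by
    conv_lhs => rw [← hy]
    rw [Matrix.star_mulVec, ← Matrix.dotProduct_mulVec, Matrix.mulVec_mulVec, hM,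
      Matrix.one_mulVec]
  -- Both vectors are fixed by unitaries that differ by the factor `e^{isL}`, so `⟨y|e^{isL} - 1|x⟩
  -- = 0` exactly. Linearizing and dividing by `s` leaves `⟨y|L|x⟩ = O(s)`.
  have h2 : ∑ i, (bondPhase L s i - 1) * (star (y i) * x i) = 0 := by
    have h3 : star y ⬝ᵥ (evolution S₀ (flow L (t + s)) *ᵥ x) =
        ∑ i, bondPhase L s i * (star (y i) * x i) := by
      refine Finset.sum_congr rfl fun i _ => ?_
      rw [evolution_flow_add_mulVec, hx, Pi.star_apply]
      ring
    rw [h3] at h1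
    simp only [sub_mul, one_mul, Finset.sum_sub_distrib]
    rw [h1, sub_eq_zero]
    rfl
  have h4 : ∀ i, ‖(bondPhase L s i - 1 - (s * L (bond i) : ℝ) * Complex.I) *
      (star (y i) * x i)‖ ≤ (|s| * Lm) ^ 2 * (‖x‖ * ‖y‖) := by
    intro i
    have hLi : |s * L (bond i)| ≤ |s| * Lm := by
      rw [abs_mul, abs_of_pos (hLpos _)]
      exact mul_le_mul_of_nonneg_left (hm _) (abs_nonneg s)
    have h5 := norm_exp_sub_le (hLi.trans hs)
    have h6 : (s * L (bond i)) ^ 2 ≤ (|s| * Lm) ^ 2 := by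
      rw [← sq_abs]
      exact pow_le_pow_left₀ (abs_nonneg _) hLi 2
    rw [norm_mul, norm_mul, norm_star, mul_comm ‖x‖]
    gcongr
    · exact h5.trans h6
    · exact norm_le_pi_norm y i
    · exact norm_le_pi_norm x i
  have h7 : (s * Complex.I) * ∑ i, (L (bond i) : ℂ) * (star (y i) * x i) =
      -∑ i, (bondPhase L s i - 1 - (s * L (bond i) : ℝ) * Complex.I) * (star (y i) * x i) := by
    rw [Finset.mul_sum, ← sub_eq_zero, sub_neg_eq_add, ← Finset.sum_add_distrib, ← h2]
    refine Finset.sum_congr rfl fun i _ => ?_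
    push_cast
    ring
  have h8 : |s| * ‖∑ i, (L (bond i) : ℂ) * (star (y i) * x i)‖ ≤
      2 * B * ((|s| * Lm) ^ 2 * (‖x‖ * ‖y‖)) := by
    have h9 := congrArg norm h7
    rw [norm_mul, norm_mul, Complex.norm_I, mul_one, Complex.norm_real, Real.norm_eq_abs,
      norm_neg] at h9
    rw [h9]
    refine (norm_sum_le_of_le _ fun i _ => h4 i).trans ?_
    simp [two_mul]
  have hspos : 0 < |s| := abs_pos.2 hs0
  refine le_of_mul_le_mul_left (h8.trans (le_of_eq ?_)) hspos
  ring

/-- Fixed vectors of the evolution at few close times are linearly independent. -/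
theorem eq_zero_of_sum_fixed_eq_zero (hS₀ : S₀ ∈ Matrix.unitaryGroup (DirBond B) ℂ) {Lm ℓ₀ δ : ℝ}
    (hLpos : ∀ b, 0 < L b) (hm : ∀ b, L b ≤ Lm) (h₀ : ∀ b, ℓ₀ ≤ L b) (hδ : 0 ≤ δ)
    (hLm : 0 < Lm) (hδ1 : δ * Lm ≤ 1) (hδ2 : δ * Lm ^ 2 * (2 * B) * (2 * B + 1) < ℓ₀)
    {T : Finset ℝ} (hT : ∀ τ ∈ T, ∀ τ' ∈ T, |τ - τ'| ≤ δ) (hcard : T.card ≤ 2 * B + 1)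
    {w : ℝ → DirBond B → ℂ} (hw : ∀ τ ∈ T, evolution S₀ (flow L τ) *ᵥ w τ = w τ)
    (hsum : ∑ τ ∈ T, w τ = 0) : ∀ τ ∈ T, w τ = 0 := by
  set c := δ * Lm ^ 2 * (2 * B) with hc
  have hc0 : 0 ≤ c := by positivity
  have hℓ₀ : 0 < ℓ₀ := lt_of_le_of_lt (by positivity) hδ2
  set W := ∑ τ ∈ T, ‖w τ‖ with hW
  have hpair : ∀ τ ∈ T, ∀ τ' ∈ T, τ' ≠ τ →
      ‖∑ i, (L (bond i) : ℂ) * (star (w τ i) * w τ' i)‖ ≤ c * ‖w τ'‖ * ‖w τ‖ := by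
    intro τ hτ τ' hτ' hne
    have h1 := hT τ hτ τ' hτ'
    have h2 := norm_sum_length_le hS₀ hLpos hm (t := τ') (s := τ - τ')
      (sub_ne_zero.2 hne.symm) ((mul_le_mul_of_nonneg_right h1 hLm.le).trans hδ1) (hw τ' hτ')
      (by rw [add_sub_cancel]; exact hw τ hτ)
    refine h2.trans ?_
    rw [hc]
    gcongr
  -- The relation is paired with `L w τ`: the diagonal term is at least `ℓ₀‖w τ‖²`, the others are
  -- small by almost orthogonality. Summed over at most `2B + 1` times this contradicts `(2B + 1) c
  -- < ℓ₀` unless `W = 0`.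
  have hself : ∀ τ ∈ T, ℓ₀ * ‖w τ‖ ≤ c * W := by
    intro τ hτ
    by_cases h0 : ‖w τ‖ = 0
    · rw [h0, mul_zero]
      exact mul_nonneg hc0 (Finset.sum_nonneg fun _ _ => norm_nonneg _)
    have hpos : 0 < ‖w τ‖ := lt_of_le_of_ne (norm_nonneg _) (Ne.symm h0)
    have h1 : ∑ τ' ∈ T, ∑ i, (L (bond i) : ℂ) * (star (w τ i) * w τ' i) = 0 := by
      rw [Finset.sum_comm]
      refine Finset.sum_eq_zero fun i _ => ?_
      rw [← Finset.mul_sum, ← Finset.mul_sum]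
      have := congrFun hsum i
      rw [Finset.sum_apply] at this
      rw [this]
      simp
    rw [← Finset.add_sum_erase T _ hτ] at h1
    have h2 : ‖∑ i, (L (bond i) : ℂ) * (star (w τ i) * w τ i)‖ ≤
        ∑ τ' ∈ T.erase τ, c * ‖w τ'‖ * ‖w τ‖ := by
      rw [eq_neg_of_add_eq_zero_left h1, norm_neg]
      exact norm_sum_le_of_le _ fun τ' hτ' =>
        hpair τ hτ τ' (Finset.mem_of_mem_erase hτ') (Finset.ne_of_mem_erase hτ')
    have h3 : ∑ τ' ∈ T.erase τ, c * ‖w τ'‖ * ‖w τ‖ ≤ c * W * ‖w τ‖ := by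
      rw [← Finset.sum_mul, ← Finset.mul_sum]
      gcongr
      exact Finset.sum_le_sum_of_subset_of_nonneg (Finset.erase_subset _ _)
        fun _ _ _ => norm_nonneg _
    have h4 : ∑ i, (L (bond i) : ℂ) * (star (w τ i) * w τ i) =
        ((∑ i, L (bond i) * ‖w τ i‖ ^ 2 : ℝ) : ℂ) := by
      push_cast
      refine Finset.sum_congr rfl fun i _ => ?_
      rw [Complex.star_def, Complex.conj_mul']
    have h5 : ℓ₀ * ‖w τ‖ ^ 2 ≤ ‖∑ i, (L (bond i) : ℂ) * (star (w τ i) * w τ i)‖ := by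
      rw [h4, Complex.norm_real, Real.norm_eq_abs]
      refine le_trans ?_ (le_abs_self _)
      obtain ⟨i, hi⟩ : ∃ i, ‖w τ‖ = ‖w τ i‖ := by
        have : Nonempty (DirBond B) := by
          by_contra hemp
          rw [not_nonempty_iff] at hemp
          exact h0 (by simp [Subsingleton.elim (w τ) 0])
        obtain ⟨i, hi⟩ := Finite.exists_max fun i => ‖w τ i‖
        exact ⟨i, le_antisymm ((pi_norm_le_iff_of_nonneg (norm_nonneg _)).2 hi)
          (norm_le_pi_norm _ i)⟩
      rw [hi]
      calc ℓ₀ * ‖w τ i‖ ^ 2 ≤ L (bond i) * ‖w τ i‖ ^ 2 := by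
            gcongr; exact h₀ _
        _ ≤ _ := Finset.single_le_sum (f := fun i => L (bond i) * ‖w τ i‖ ^ 2)
            (fun i _ => mul_nonneg (hLpos _).le (by positivity)) (Finset.mem_univ i)
    have h6 : ℓ₀ * ‖w τ‖ * ‖w τ‖ ≤ c * W * ‖w τ‖ := by
      calc _ = ℓ₀ * ‖w τ‖ ^ 2 := by ring
        _ ≤ _ := h5.trans (h2.trans h3)
    exact le_of_mul_le_mul_right h6 hpos
  have hW0 : 0 ≤ W := Finset.sum_nonneg fun _ _ => norm_nonneg _
  have hWsum : ℓ₀ * W ≤ (2 * B + 1) * (c * W) := by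
    rw [hW, Finset.mul_sum, ← hW]
    refine (Finset.sum_le_sum hself).trans ?_
    rw [Finset.sum_const, nsmul_eq_mul]
    have : (T.card : ℝ) ≤ 2 * B + 1 := by exact_mod_cast hcard
    gcongr
  have hWz : W = 0 := by
    by_contra hne
    have hpos : 0 < W := lt_of_le_of_ne hW0 (Ne.symm hne)
    nlinarith
  intro τ hτ
  have := (Finset.sum_eq_zero_iff_of_nonneg (fun τ _ => norm_nonneg (w τ))).1 hWz τ hτ
  exact norm_eq_zero.1 this

/-- If `2B + 1` consecutive points lay in a window of length `δ`, their eigenvectors would be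
dependent in `ℂ^{2B}`. Grouping a relation by time, each group vanishes by
`eq_zero_of_sum_fixed_eq_zero`, and within a group the vectors are orthonormal, so the relation is
trivial. -/
theorem IsSpectralSequence.exists_spacing (h : IsSpectralSequence S₀ L ψ lam j)
    (hS₀ : S₀ ∈ Matrix.unitaryGroup (DirBond B) ℂ) (hψ : IsEigenvectorChoice S₀ ψ) {Lm ℓ₀ : ℝ}
    (hLpos : ∀ b, 0 < L b) (hm : ∀ b, L b ≤ Lm) (h₀ : ∀ b, ℓ₀ ≤ L b) (hLm : 0 < Lm)
    (hℓ₀ : 0 < ℓ₀) : ∃ δ > 0, ∀ n, lam n + δ < lam (n + 2 * B) := by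
  obtain ⟨δ, hδ, hδ1, hδ2⟩ : ∃ δ > 0, δ * Lm ≤ 1 ∧ δ * Lm ^ 2 * (2 * B) * (2 * B + 1) < ℓ₀ := by
    have e1 : ∀ᶠ δ : ℝ in 𝓝 0, δ * Lm < 1 := by
      have : Continuous fun δ : ℝ => δ * Lm := by fun_prop
      exact this.continuousAt.eventually_lt_const (by simp)
    have e2 : ∀ᶠ δ : ℝ in 𝓝 0, δ * Lm ^ 2 * (2 * B) * (2 * B + 1) < ℓ₀ := by
      have : Continuous fun δ : ℝ => δ * Lm ^ 2 * (2 * B) * (2 * B + 1) := by fun_prop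
      exact this.continuousAt.eventually_lt_const (by simpa using hℓ₀)
    have e3 : ∀ᶠ δ : ℝ in 𝓝[>] 0, 0 < δ ∧ δ * Lm < 1 ∧
        δ * Lm ^ 2 * (2 * B) * (2 * B + 1) < ℓ₀ := by
      filter_upwards [self_mem_nhdsWithin, e1.filter_mono nhdsWithin_le_nhds,
        e2.filter_mono nhdsWithin_le_nhds] with δ h1 h2 h3 using ⟨h1, h2, h3⟩
    obtain ⟨δ, h1, h2, h3⟩ := e3.exists
    exact ⟨δ, h1, h2.le, h3⟩
  refine ⟨δ, hδ, fun n => ?_⟩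
  by_contra! hcon
  let ι := Fin (2 * B + 1)
  let φ : ι → DirBond B → ℂ := fun i => ψ (flow L (lam (n + i))) (j (n + i))
  have hdep : ¬ LinearIndependent ℂ φ := by
    intro hli
    have := hli.fintype_card_le_finrank
    simp [ι] at this
    omega
  obtain ⟨g, hg, i₀, hi₀⟩ := Fintype.not_linearIndependent_iff.1 hdep
  let τ : ι → ℝ := fun i => lam (n + i)
  let T : Finset ℝ := Finset.univ.image τ
  let w : ℝ → DirBond B → ℂ := fun x => ∑ i with τ i = x, g i • φ i
  have hT : ∀ x ∈ T, ∀ y ∈ T, |x - y| ≤ δ := by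
    have hbound : ∀ i : ι, lam n ≤ τ i ∧ τ i ≤ lam n + δ := fun i =>
      ⟨h.1 (Nat.le_add_right _ _), (h.1 (by have := i.2; omega)).trans hcon⟩
    intro x hx y hy
    obtain ⟨i, -, rfl⟩ := Finset.mem_image.1 hx
    obtain ⟨i', -, rfl⟩ := Finset.mem_image.1 hy
    rw [abs_le]
    constructor <;> linarith [(hbound i).1, (hbound i).2, (hbound i').1, (hbound i').2]
  have hcard : T.card ≤ 2 * B + 1 := by
    refine Finset.card_image_le.trans ?_
    simp [ι]
  have hw : ∀ x ∈ T, evolution S₀ (flow L x) *ᵥ w x = w x := by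
    intro x _
    simp only [w, Matrix.mulVec_sum]
    refine Finset.sum_congr rfl fun i hi => ?_
    rw [Matrix.mulVec_smul, ← (Finset.mem_filter.1 hi).2]
    congr 1
    exact h.mulVec (n + i)
  have hsum : ∑ x ∈ T, w x = 0 := by
    rw [← hg]
    exact Finset.sum_fiberwise_of_maps_to (fun i _ => Finset.mem_image_of_mem τ (Finset.mem_univ i))
      fun i => g i • φ i
  have hz := eq_zero_of_sum_fixed_eq_zero hS₀ hLpos hm h₀ hδ.le hLm hδ1 hδ2 hT hcard hw hsum
    (τ i₀) (Finset.mem_image_of_mem τ (Finset.mem_univ i₀))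
  apply hi₀
  have h1 : star (φ i₀) ⬝ᵥ w (τ i₀) = 0 := by rw [hz, dotProduct_zero]
  simp only [w, dotProduct_sum, dotProduct_smul, smul_eq_mul] at h1
  rw [Finset.sum_eq_single i₀] at h1
  · have h2 : star (φ i₀) ⬝ᵥ φ i₀ = 1 := (hψ _).star_dotProduct_self _
    rwa [h2, mul_one] at h1
  · intro i hi hne
    have hτ : lam (n + i) = lam (n + i₀) := (Finset.mem_filter.1 hi).2
    have h3 : star (φ i₀) ⬝ᵥ φ i = 0 := by
      simp only [φ, hτ]
      rw [(hψ _).1, if_neg]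
      intro hj
      exact hne (Fin.ext (by have := h.injective hτ hj.symm; omega))
    rw [h3, mul_zero]
  · simp

theorem IsSpectralSequence.tendsto_atTop (h : IsSpectralSequence S₀ L ψ lam j) {δ : ℝ}
    (hδ : 0 < δ) (hsp : ∀ n, lam n + δ < lam (n + 2 * B)) : Tendsto lam atTop atTop := by
  have hq : ∀ q : ℕ, q * δ ≤ lam (q * (2 * B)) := by
    intro q
    induction q with
    | zero => simpa using (h.pos 0).le
    | succ q ih =>
      have := hsp (q * (2 * B))
      rw [show (q + 1) * (2 * B) = q * (2 * B) + 2 * B by ring]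
      push_cast
      linarith
  refine tendsto_atTop_atTop_of_monotone h.1 fun x => ?_
  obtain ⟨q, hq'⟩ := exists_nat_ge (x / δ)
  exact ⟨q * (2 * B), ((div_le_iff₀ hδ).1 hq').trans (hq q)⟩

theorem card_le_of_spacing (hmono : Monotone lam) {δ : ℝ}
    (hsp : ∀ n, lam n + δ < lam (n + 2 * B)) {J : Finset ℕ}
    (hJ : ∀ m ∈ J, ∀ n ∈ J, lam n ≤ lam m + δ) : J.card ≤ 2 * B := by
  rcases J.eq_empty_or_nonempty with rfl | hne
  · simp
  set m := J.min' hne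
  have hsub : J ⊆ Finset.Ico m (m + 2 * B) := by
    intro n hn
    rw [Finset.mem_Ico]
    refine ⟨J.min'_le n hn, ?_⟩
    by_contra! hcon
    have h1 := hJ m (J.min'_mem hne) n hn
    have h2 := hmono hcon
    linarith [hsp m]
  simpa using Finset.card_le_card hsub

end Spacing

/-! ### Matching eigenbases at nearby points -/

section Matching

variable {B : ℕ} {S₀ : Matrix (DirBond B) (DirBond B) ℂ} {L : Fin B → ℝ}
  {ψ : Torus B → DirBond B → DirBond B → ℂ} {lam : ℕ → ℝ} {j : ℕ → DirBond B}

/-- The bases chosen at `z` and `w` agree up to order, phases and an error `ε`. -/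
def Matched (ψ : Torus B → DirBond B → DirBond B → ℂ) (ε : ℝ) (z w : Torus B) : Prop :=
  ∃ σ : Equiv.Perm (DirBond B), ∀ k, ‖proj ψ w (σ k) - proj ψ z k‖ < ε

theorem Matched.symm {ε : ℝ} {z w : Torus B} (h : Matched ψ ε z w) : Matched ψ ε w z := by
  obtain ⟨σ, hσ⟩ := h
  refine ⟨σ.symm, fun k => ?_⟩
  have := hσ (σ.symm k)
  rwa [Equiv.apply_symm_apply, norm_sub_rev] at this

theorem Matched.trans {ε ε' : ℝ} {x y z : Torus B} (h : Matched ψ ε x y) (h' : Matched ψ ε' y z) :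
    Matched ψ (ε + ε') x z := by
  obtain ⟨σ, hσ⟩ := h
  obtain ⟨τ, hτ⟩ := h'
  refine ⟨τ * σ, fun k => ?_⟩
  have h1 := norm_sub_le_norm_sub_add_norm_sub (proj ψ z (τ (σ k))) (proj ψ y (σ k)) (proj ψ x k)
  rw [Equiv.Perm.mul_apply]
  linarith [hσ k, hτ (σ k)]

theorem eventually_matched {z : Torus B}
    (h : ∃ σ : Torus B → Equiv.Perm (DirBond B), ∀ k,
      ContinuousAt (fun w => rankOne (ψ w (σ w k))) z) {ε : ℝ} (hε : 0 < ε) :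
    ∀ᶠ w in 𝓝 z, Matched ψ ε z w := by
  obtain ⟨σ, hσ⟩ := h
  have h1 : ∀ k, ∀ᶠ w in 𝓝 z, ‖proj ψ w (σ w k) - proj ψ z (σ z k)‖ < ε := fun k => by
    have h2 : ContinuousAt (fun w => proj ψ w (σ w k)) z := hσ k
    simpa only [dist_eq_norm] using Metric.tendsto_nhds.1 h2 ε hε
  filter_upwards [eventually_all.2 h1] with w hw
  refine ⟨σ w * (σ z).symm, fun k => ?_⟩
  have := hw ((σ z).symm k)
  rwa [Equiv.apply_symm_apply] at this

/-- Local continuity becomes uniform on `K` by a Lebesgue number; points in one member of the cover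
are compared through its centre, hence `ε / 2` there. -/
theorem exists_matched_of_isCompact {U K : Set (Torus B)} (hU : IsClosed U) (hK : IsCompact K)
    (hKU : Disjoint K U) (hloc : ∀ z ∉ U, ∀ ε > 0, ∀ᶠ w in 𝓝 z, Matched ψ ε z w) {ε : ℝ}
    (hε : 0 < ε) :
    ∃ δ > 0, ∀ z ∈ K, ∀ w, dist w z < δ → w ∉ U ∧ Matched ψ ε z w := by
  let O : K → Set (Torus B) := fun x => interior {w | w ∉ U ∧ Matched ψ (ε / 2) x w}
  obtain ⟨δ, hδ, hball⟩ := lebesgue_number_lemma_of_metric hK (c := O)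
    (fun x => isOpen_interior) fun x hx => Set.mem_iUnion.2 ⟨⟨x, hx⟩, by
      have hxU := Set.disjoint_left.1 hKU hx
      exact mem_interior_iff_mem_nhds.2
        (inter_mem (hU.isOpen_compl.mem_nhds hxU) (hloc x hxU _ (half_pos hε)))⟩
  refine ⟨δ, hδ, fun z hz w hw => ?_⟩
  obtain ⟨x, hx⟩ := hball z hz
  have h1 := interior_subset (hx (Metric.mem_ball_self hδ))
  have h2 := interior_subset (hx (Metric.mem_ball.2 hw))
  refine ⟨h2.1, ?_⟩
  have := h1.2.symm.trans h2.2
  rwa [add_halves] at this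

theorem dist_circle_exp_le (x y : ℝ) : dist (Circle.exp x) (Circle.exp y) ≤ |x - y| := by
  change dist (Circle.exp x : ℂ) (Circle.exp y : ℂ) ≤ _
  rw [Complex.dist_eq, Circle.coe_exp, Circle.coe_exp]
  have h1 : Complex.exp (x * Complex.I) - Complex.exp (y * Complex.I) =
      Complex.exp (y * Complex.I) * (Complex.exp (Complex.I * (x - y : ℝ)) - 1) := by
    rw [mul_sub, mul_one, ← Complex.exp_add]
    congr 2
    push_cast
    ring
  rw [h1, norm_mul, Complex.norm_exp_ofReal_mul_I, one_mul]
  exact Real.norm_exp_I_mul_ofReal_sub_one_le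

theorem dist_flow_le {Lm : ℝ} (hLpos : ∀ b, 0 < L b) (hm : ∀ b, L b ≤ Lm) (hLm : 0 < Lm)
    (t s : ℝ) : dist (flow L (t + s)) (flow L t) ≤ |s| * Lm := by
  refine (dist_pi_le_iff (by positivity)).2 fun b => (dist_circle_exp_le _ _).trans ?_
  rw [← sub_mul, add_sub_cancel_left, abs_mul, abs_of_pos (hLpos b)]
  exact mul_le_mul_of_nonneg_left (hm b) (abs_nonneg s)

/-- The branches of a matched family of eigenbases are continuous. -/
theorem continuousOn_proj_of_matched (hψ : IsEigenvectorChoice S₀ ψ) {U : Set (Torus B)}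
    (hloc : ∀ z ∉ U, ∀ ε > 0, ∀ᶠ w in 𝓝 z, Matched ψ ε z w) {p : ℝ → Torus B}
    (hp : Continuous p) {I : Set ℝ} (hpU : ∀ s ∈ I, p s ∉ U) {z : Torus B} {ε : ℝ}
    (hε : 0 < ε) (hε1 : (2 * B : ℝ) ^ 2 * (3 * ε) ≤ 1 / 2) {σ : ℝ → Equiv.Perm (DirBond B)}
    (hσ : ∀ s ∈ I, ∀ k, ‖proj ψ (p s) (σ s k) - proj ψ z k‖ < ε) (k : DirBond B) :
    ContinuousOn (fun s => proj ψ (p s) (σ s k)) I := by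
  intro s₀ hs₀
  refine Metric.tendsto_nhds.2 fun r hr => ?_
  have e1 := (hp.continuousAt (x := s₀)).eventually
    (hloc (p s₀) (hpU s₀ hs₀) (min ε r) (lt_min hε hr))
  filter_upwards [e1.filter_mono nhdsWithin_le_nhds, self_mem_nhdsWithin] with s hs hsI
  obtain ⟨τ, hτ⟩ := hs
  have h1 := hτ (σ s₀ k)
  have h2 := hσ s hsI k
  have h3 := hσ s₀ hs₀ k
  -- Both labels give projections at `p s` within `3ε` of each other, and distinct vectors of one
  -- basis are further apart than that. Hence the labelling by closeness to `z` follows the local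
  -- continuous labelling.
  have heq : σ s k = τ (σ s₀ k) := by
    refine (eq_of_norm_proj_sub_lt hψ (z := p s) ?_).symm
    have h4 := norm_sub_le_norm_sub_add_norm_sub (proj ψ (p s) (σ s k)) (proj ψ z k)
      (proj ψ (p s) (τ (σ s₀ k)))
    have h5 := norm_sub_le_norm_sub_add_norm_sub (proj ψ z k) (proj ψ (p s₀) (σ s₀ k))
      (proj ψ (p s) (τ (σ s₀ k)))
    rw [norm_sub_rev] at h1 h3
    have h6 : ‖proj ψ (p s) (σ s k) - proj ψ (p s) (τ (σ s₀ k))‖ ≤ 3 * ε := by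
      linarith [min_le_left ε r]
    have h7 := mul_le_mul_of_nonneg_left h6 (by positivity : (0 : ℝ) ≤ (2 * B : ℝ) ^ 2)
    linarith
  rw [dist_eq_norm, heq]
  exact h1.trans_le (min_le_right _ _)

/-- The tent of half-width `h`. -/
def tent (h x : ℝ) : ℝ := max 0 (1 - |x| / h)

theorem tent_nonneg (h x : ℝ) : 0 ≤ tent h x := le_max_left _ _

theorem tent_le_one {h : ℝ} (hh : 0 ≤ h) (x : ℝ) : tent h x ≤ 1 :=
  max_le zero_le_one (by linarith [div_nonneg (abs_nonneg x) hh])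

theorem tent_eq_zero {h x : ℝ} (hh : 0 < h) (hx : h ≤ |x|) : tent h x = 0 := by
  refine max_eq_left ?_
  have := (one_le_div hh).2 hx
  linarith

theorem half_le_sum_phaseTent {a : ℝ} (ha : 0 < a) {μ : DirBond B → ℂ} {k : DirBond B}
    (h : phaseDist (μ k) ≤ a / 2) : 1 / 2 ≤ ∑ k, phaseTent a (μ k) :=
  (half_le_phaseTent ha h).trans
    (Finset.single_le_sum (f := fun k => phaseTent a (μ k)) (fun k _ => phaseTent_nonneg a (μ k))
      (Finset.mem_univ k))

theorem card_dirBond : (Finset.univ : Finset (DirBond B)).card = 2 * B := by simp [two_mul]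

/-- The width `4hLm` is such that a spectral point within time `h` forces an eigenvalue within phase
`2hLm`, half the width. Whatever contributes near time `t` is thus seen by the wide tent with weight
at least `1/2`. -/
theorem phaseTent_eq_zero_or {h ℓ Lm : ℝ} (hh : 0 < h) (hℓ : 0 < ℓ) (hℓm : ℓ ≤ Lm) (μ : ℂ) :
    phaseTent (h * ℓ) μ = 0 ∨ phaseDist μ ≤ 4 * h * Lm / 2 := by
  by_cases hc : phaseDist μ ≤ h * ℓ
  · right
    have := mul_le_mul_of_nonneg_left hℓm hh.le
    nlinarith
  · left
    refine max_eq_left ?_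
    have := (one_le_div (by positivity : 0 < h * ℓ)).2 (not_le.1 hc).le
    linarith

/-- A bound that holds at every time. -/
theorem norm_sum_tent_sub_le (hs : IsSpectralSequence S₀ L ψ lam j)
    (hS₀ : S₀ ∈ Matrix.unitaryGroup (DirBond B) ℂ) (hψ : IsEigenvectorChoice S₀ ψ) {Lm ℓ₀ δ : ℝ}
    (hLpos : ∀ b, 0 < L b) (hm : ∀ b, L b ≤ Lm) (h₀ : ∀ b, ℓ₀ ≤ L b) (hLm : 0 < Lm)
    (hℓ₀ : 0 < ℓ₀) (hsp : ∀ n, lam n + δ < lam (n + 2 * B)) {h : ℝ} (hh : 0 < h)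
    (hhδ : 2 * h ≤ δ) {g : (DirBond B → DirBond B → ℂ) → ℂ} {C : ℝ}
    (hC : ∀ z k, ‖g (proj ψ z k)‖ ≤ C) (t : ℝ) (S : Finset ℕ) :
    ‖∑ n ∈ S, (tent h (lam n - t) : ℂ) * g (proj ψ (flow L (lam n)) (j n)) -
        ∑ k, g (proj ψ (flow L t) k) *
          phaseTent (h * lengthOf L (proj ψ (flow L t) k)) (eigval S₀ ψ (flow L t) k)‖ ≤
      8 * B * C * ∑ k, phaseTent (4 * h * Lm) (eigval S₀ ψ (flow L t) k) := by
  classical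
  set T := ∑ k, phaseTent (4 * h * Lm) (eigval S₀ ψ (flow L t) k) with hT
  have hT0 : 0 ≤ T := Finset.sum_nonneg fun k _ => phaseTent_nonneg _ _
  have ha : 0 < 4 * h * Lm := by positivity
  have hℓ : ∀ k, 0 < lengthOf L (proj ψ (flow L t) k) := fun k =>
    hℓ₀.trans_le (le_lengthOf hψ h₀ _ k)
  by_cases hB : Nonempty (DirBond B)
  swap
  · exact absurd ⟨j 0⟩ hB
  have hC0 : 0 ≤ C := (norm_nonneg _).trans (hC (flow L t) hB.some)
  -- At most `2B` terms occur, by the spacing, and if any occurs then `2T ≥ 1`. The sum over the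
  -- basis obeys the same bound.
  have h1 : ‖∑ n ∈ S, (tent h (lam n - t) : ℂ) * g (proj ψ (flow L (lam n)) (j n))‖ ≤
      2 * B * C * (2 * T) := by
    set J := S.filter fun n => |lam n - t| ≤ h with hJ
    rw [← Finset.sum_filter_of_ne (p := fun n => |lam n - t| ≤ h)]
    swap
    · intro n _ hn
      by_contra hcon
      exact hn (by rw [tent_eq_zero hh (not_le.1 hcon).le, Complex.ofReal_zero, zero_mul])
    rcases J.eq_empty_or_nonempty with he | ⟨n, hn⟩
    · rw [← hJ, he, Finset.sum_empty, norm_zero]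
      positivity
    have hT1 : 1 ≤ 2 * T := by
      have hn' := (Finset.mem_filter.1 hn).2
      obtain ⟨k, hk⟩ := exists_phaseDist_eigval_le hS₀ hψ hLpos hm (t := t) (s := lam n - t)
        (l := j n) (by rw [add_sub_cancel]; exact hs.eigval hψ n)
      have h2 : |lam n - t| * Lm ≤ h * Lm := mul_le_mul_of_nonneg_right hn' hLm.le
      have := half_le_sum_phaseTent ha (μ := eigval S₀ ψ (flow L t)) (k := k) (by linarith)
      linarith
    have hcard : (J.card : ℝ) ≤ 2 * B := by
      have := card_le_of_spacing hs.1 hsp (J := J) fun m hm n hn => by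
        have h3 := abs_le.1 (Finset.mem_filter.1 hm).2
        have h4 := abs_le.1 (Finset.mem_filter.1 hn).2
        linarith
      exact_mod_cast this
    calc _ ≤ ∑ n ∈ J, C := norm_sum_le_of_le _ fun n _ => by
          rw [norm_mul, Complex.norm_real, Real.norm_eq_abs, abs_of_nonneg (tent_nonneg _ _)]
          calc _ ≤ 1 * C := mul_le_mul (tent_le_one hh.le _) (hC _ _) (norm_nonneg _) zero_le_one
            _ = C := one_mul C
      _ = J.card * C := by rw [Finset.sum_const, nsmul_eq_mul]
      _ ≤ 2 * B * C := by gcongr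
      _ ≤ 2 * B * C * (2 * T) := le_mul_of_one_le_right (by positivity) hT1
  have hq : ∀ k, phaseTent (h * lengthOf L (proj ψ (flow L t) k)) (eigval S₀ ψ (flow L t) k) ≤
      2 * T := fun k => by
    rcases phaseTent_eq_zero_or hh (hℓ k) (lengthOf_le hψ hm _ k) (eigval S₀ ψ (flow L t) k)
      with h0 | h0
    · rw [h0]
      exact mul_nonneg zero_le_two hT0
    · have h3 := half_le_sum_phaseTent ha (μ := eigval S₀ ψ (flow L t)) h0
      have h4 := phaseTent_le_one (mul_nonneg hh.le (hℓ k).le) (eigval S₀ ψ (flow L t) k)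
      linarith
  have h2 : ‖∑ k, g (proj ψ (flow L t) k) *
      phaseTent (h * lengthOf L (proj ψ (flow L t) k)) (eigval S₀ ψ (flow L t) k)‖ ≤
      2 * B * C * (2 * T) := by
    have h3 : ∀ k, ‖g (proj ψ (flow L t) k) *
        phaseTent (h * lengthOf L (proj ψ (flow L t) k)) (eigval S₀ ψ (flow L t) k)‖ ≤
        C * (2 * T) := fun k => by
      rw [norm_mul, Complex.norm_real, Real.norm_eq_abs, abs_of_nonneg (phaseTent_nonneg _ _)]
      exact mul_le_mul (hC _ _) (hq k) (phaseTent_nonneg _ _) hC0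
    refine (norm_sum_le_of_le _ fun k _ => h3 k).trans (le_of_eq ?_)
    rw [Finset.sum_const, card_dirBond, nsmul_eq_mul]
    push_cast
    ring
  refine (norm_sub_le _ _).trans ((add_le_add h1 h2).trans (le_of_eq ?_))
  ring

end Matching

/-! ### Spectral points and eigenphases near a good time -/

section GoodTimes

variable {B : ℕ} {S₀ : Matrix (DirBond B) (DirBond B) ℂ} {L : Fin B → ℝ}
  {ψ : Torus B → DirBond B → DirBond B → ℂ} {lam : ℕ → ℝ} {j : ℕ → DirBond B}
  {Lm ℓ₀ h ε κ t : ℝ} {σ : ℝ → Equiv.Perm (DirBond B)}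

theorem norm_branch_sub_le (hS₀ : S₀ ∈ Matrix.unitaryGroup (DirBond B) ℂ)
    (hψ : IsEigenvectorChoice S₀ ψ) (hLpos : ∀ b, 0 < L b) (hm : ∀ b, L b ≤ Lm) (hLm : 0 < Lm)
    (hhL : h * Lm ≤ 1 / 2) (hε1 : (2 * B : ℝ) ^ 2 * (3 * ε) ≤ 1 / 2)
    (hκ : 3 * (2 * B) ^ 2 * Lm * (Lm * h + ε) ≤ κ)
    (hσ : ∀ s ∈ Set.Icc (-h) h, ∀ k,
      ‖proj ψ (flow L (t + s)) (σ s k) - proj ψ (flow L t) k‖ < ε)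
    {s : ℝ} (hs : s ∈ Set.Icc (-h) h) (k : DirBond B) :
    ‖eigval S₀ ψ (flow L (t + s)) (σ s k) - eigval S₀ ψ (flow L t) k *
        Complex.exp ((s * lengthOf L (proj ψ (flow L t) k) : ℝ) * Complex.I)‖ ≤ κ * |s| := by
  have hsh : |s| ≤ h := abs_le.2 hs
  have h1 : |s| * Lm ≤ h * Lm := mul_le_mul_of_nonneg_right hsh hLm.le
  have hε0 : 0 < ε := (norm_nonneg _).trans_lt (hσ s hs k)
  have hBε : 0 ≤ (2 * B : ℝ) ^ 2 * ε := by positivity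
  refine (norm_eigval_sub_le hS₀ hψ hLpos hm hLm (by linarith) (by linarith)
    (hσ s hs k).le).trans ?_
  refine mul_le_mul_of_nonneg_right (le_trans ?_ hκ) (abs_nonneg s)
  gcongr

/-- A branch that equals `1` at time `t + s` satisfies `1 ≈ μ e^{isℓ}` up to `κ|s|`, so `μ` has
phase close to `-sℓ`. The factor `2` compares arc and chord. -/
theorem abs_phaseDist_sub_mul_le (hS₀ : S₀ ∈ Matrix.unitaryGroup (DirBond B) ℂ)
    (hψ : IsEigenvectorChoice S₀ ψ) (hLpos : ∀ b, 0 < L b) (hm : ∀ b, L b ≤ Lm) (hLm : 0 < Lm)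
    (hhL : h * Lm ≤ 1 / 2) (hε1 : (2 * B : ℝ) ^ 2 * (3 * ε) ≤ 1 / 2)
    (hκ : 3 * (2 * B) ^ 2 * Lm * (Lm * h + ε) ≤ κ)
    (hσ : ∀ s ∈ Set.Icc (-h) h, ∀ k,
      ‖proj ψ (flow L (t + s)) (σ s k) - proj ψ (flow L t) k‖ < ε)
    {s : ℝ} (hs : s ∈ Set.Icc (-h) h) {k : DirBond B}
    (hk : eigval S₀ ψ (flow L (t + s)) (σ s k) = 1) :
    |phaseDist (eigval S₀ ψ (flow L t) k) - |s| * lengthOf L (proj ψ (flow L t) k)| ≤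
      2 * (κ * |s|) := by
  set ℓ := lengthOf L (proj ψ (flow L t) k) with hℓ
  have hℓ0 : 0 ≤ ℓ := le_lengthOf hψ (fun b => (hLpos b).le) _ k
  have hℓm : ℓ ≤ Lm := lengthOf_le hψ hm _ k
  have h1 := norm_branch_sub_le hS₀ hψ hLpos hm hLm hhL hε1 hκ hσ hs k
  rw [hk, ← hℓ] at h1
  set μ := eigval S₀ ψ (flow L t) k with hμ
  have hμ1 : ‖μ‖ = 1 := norm_eigval hS₀ hψ _ k
  have habs : |(-(s * ℓ))| = |s| * ℓ := by rw [abs_neg, abs_mul, abs_of_nonneg hℓ0]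
  have hsπ : |(-(s * ℓ))| ≤ Real.pi := by
    have h2 : |s| * ℓ ≤ h * Lm := mul_le_mul (abs_le.2 hs) hℓm hℓ0 (by linarith [hs.1, hs.2])
    rw [habs]
    linarith [Real.pi_gt_three]
  have h2 := abs_phaseDist_sub_le hμ1 (Complex.norm_exp_ofReal_mul_I (-(s * ℓ)))
  rw [phaseDist_exp hsπ, habs] at h2
  have h3 : ‖μ - Complex.exp ((-(s * ℓ) : ℝ) * Complex.I)‖ =
      ‖1 - μ * Complex.exp ((s * ℓ : ℝ) * Complex.I)‖ := by
    have h4 : 1 - μ * Complex.exp ((s * ℓ : ℝ) * Complex.I) =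
        -(μ - Complex.exp ((-(s * ℓ) : ℝ) * Complex.I)) *
          Complex.exp ((s * ℓ : ℝ) * Complex.I) := by
      rw [neg_mul, sub_mul, ← Complex.exp_add, ← add_mul, ← Complex.ofReal_add, neg_add_cancel]
      simp
    rw [h4, norm_mul, norm_neg, Complex.norm_exp_ofReal_mul_I, mul_one]
  rw [h3] at h2
  linarith

theorem abs_tent_sub_phaseTent_le (hS₀ : S₀ ∈ Matrix.unitaryGroup (DirBond B) ℂ)
    (hψ : IsEigenvectorChoice S₀ ψ) (hLpos : ∀ b, 0 < L b) (hm : ∀ b, L b ≤ Lm) (hLm : 0 < Lm)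
    (h₀ : ∀ b, ℓ₀ ≤ L b) (hℓ₀ : 0 < ℓ₀) (hh : 0 < h) (hκ0 : 0 < κ)
    (hhL : h * Lm ≤ 1 / 2) (hε1 : (2 * B : ℝ) ^ 2 * (3 * ε) ≤ 1 / 2)
    (hκ : 3 * (2 * B) ^ 2 * Lm * (Lm * h + ε) ≤ κ)
    (hσ : ∀ s ∈ Set.Icc (-h) h, ∀ k,
      ‖proj ψ (flow L (t + s)) (σ s k) - proj ψ (flow L t) k‖ < ε)
    {s : ℝ} (hs : s ∈ Set.Icc (-h) h) {k : DirBond B}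
    (hk : eigval S₀ ψ (flow L (t + s)) (σ s k) = 1) :
    |tent h s - phaseTent (h * lengthOf L (proj ψ (flow L t) k)) (eigval S₀ ψ (flow L t) k)| ≤
      2 * κ / ℓ₀ := by
  have h1 := abs_phaseDist_sub_mul_le hS₀ hψ hLpos hm hLm hhL hε1 hκ hσ hs hk
  set ℓ := lengthOf L (proj ψ (flow L t) k) with hℓ
  have hℓ0 : ℓ₀ ≤ ℓ := le_lengthOf hψ h₀ _ k
  have hℓpos : 0 < ℓ := hℓ₀.trans_le hℓ0
  set μ := eigval S₀ ψ (flow L t) k with hμ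
  have h2 : |tent h s - phaseTent (h * ℓ) μ| ≤
      |(1 - |s| / h) - (1 - phaseDist μ / (h * ℓ))| := by
    have := abs_max_sub_max_le_max 0 (1 - |s| / h) 0 (1 - phaseDist μ / (h * ℓ))
    rw [sub_self, abs_zero] at this
    exact this.trans (max_le (abs_nonneg _) le_rfl)
  have h3 : (1 - |s| / h) - (1 - phaseDist μ / (h * ℓ)) = (phaseDist μ - |s| * ℓ) / (h * ℓ) := by
    field_simp
    ring
  rw [h3, abs_div, abs_of_pos (mul_pos hh hℓpos)] at h2
  refine h2.trans ?_
  rw [div_le_div_iff₀ (by positivity) hℓ₀]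
  have hsh : |s| ≤ h := abs_le.2 hs
  calc _ ≤ 2 * (κ * h) * ℓ := by gcongr; exact h1.trans (by gcongr)
    _ = _ := by ring

/-- Between two passages through `1` the branch would turn by at least `ℓ₀` times the elapsed time
`|r|`, with an error at most `4κ|r|`, which `8κ ≤ ℓ₀` makes too small to cancel it. -/
theorem branch_unique (hS₀ : S₀ ∈ Matrix.unitaryGroup (DirBond B) ℂ)
    (hψ : IsEigenvectorChoice S₀ ψ) (hLpos : ∀ b, 0 < L b) (hm : ∀ b, L b ≤ Lm) (hLm : 0 < Lm)
    (h₀ : ∀ b, ℓ₀ ≤ L b) (hκ0 : 0 < κ) (hκℓ : 8 * κ ≤ ℓ₀)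
    (hhL : h * Lm ≤ 1 / 2) (hε1 : (2 * B : ℝ) ^ 2 * (3 * ε) ≤ 1 / 2)
    (hκ : 3 * (2 * B) ^ 2 * Lm * (Lm * h + ε) ≤ κ)
    (hσ : ∀ s ∈ Set.Icc (-h) h, ∀ k,
      ‖proj ψ (flow L (t + s)) (σ s k) - proj ψ (flow L t) k‖ < ε)
    {s s' : ℝ} (hs : s ∈ Set.Icc (-h) h) (hs' : s' ∈ Set.Icc (-h) h) {k : DirBond B}
    (hk : eigval S₀ ψ (flow L (t + s)) (σ s k) = 1)
    (hk' : eigval S₀ ψ (flow L (t + s')) (σ s' k) = 1) : s = s' := by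
  set r := s' - s with hr
  have hts : t + s' = t + s + r := by rw [hr]; ring
  have hr2 : |r| ≤ 2 * h := by
    rw [abs_le]
    constructor <;> linarith [hs.1, hs.2, hs'.1, hs'.2]
  have hε0 : 0 < ε := (norm_nonneg _).trans_lt (hσ s hs k)
  have hBε : 0 ≤ (2 * B : ℝ) ^ 2 * ε := by positivity
  have hP : ‖proj ψ (flow L (t + s + r)) (σ s' k) - proj ψ (flow L (t + s)) (σ s k)‖ ≤ 2 * ε := by
    rw [← hts]
    have h1 := norm_sub_le_norm_sub_add_norm_sub (proj ψ (flow L (t + s')) (σ s' k))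
      (proj ψ (flow L t) k) (proj ψ (flow L (t + s)) (σ s k))
    have h2 := hσ s hs k
    rw [norm_sub_rev] at h2
    linarith [hσ s' hs' k]
  have hrL : |r| * Lm ≤ 1 := by
    have := mul_le_mul_of_nonneg_right hr2 hLm.le
    linarith
  have h1 := norm_eigval_sub_le hS₀ hψ hLpos hm hLm hrL (by linarith) hP
  rw [← hts, hk, hk', one_mul] at h1
  set ℓ := lengthOf L (proj ψ (flow L (t + s)) (σ s k)) with hℓ
  have hℓ0 : ℓ₀ ≤ ℓ := le_lengthOf hψ h₀ _ _
  have hℓm : ℓ ≤ Lm := lengthOf_le hψ hm _ _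
  have hℓpos : 0 < ℓ := by linarith
  have h2 := phaseDist_le (Complex.norm_exp_ofReal_mul_I (r * ℓ))
  rw [phaseDist_exp, abs_mul, abs_of_pos hℓpos, norm_sub_rev] at h2
  swap
  · rw [abs_mul, abs_of_pos hℓpos]
    have := mul_le_mul_of_nonneg_left hℓm (abs_nonneg r)
    linarith [Real.pi_gt_three]
  -- The two times differ by up to `2h` and the projections, both compared with time `t`, by up to
  -- `2ε`; this doubles `κ`.
  have h3 : 3 * (2 * B) ^ 2 * Lm * (Lm * |r| + 2 * ε) ≤ 2 * κ := by
    calc _ ≤ 3 * (2 * B) ^ 2 * Lm * (Lm * (2 * h) + 2 * ε) := by gcongr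
      _ = 2 * (3 * (2 * B) ^ 2 * Lm * (Lm * h + ε)) := by ring
      _ ≤ _ := by linarith
  have h4 : |r| * ℓ ≤ 2 * (2 * κ * |r|) :=
    h2.trans (mul_le_mul_of_nonneg_left
      (h1.trans (mul_le_mul_of_nonneg_right h3 (abs_nonneg r))) zero_le_two)
  have h5 : |r| = 0 := by
    by_contra hne
    have hpos : 0 < |r| := lt_of_le_of_ne (abs_nonneg r) (Ne.symm hne)
    nlinarith
  have h6 : r = 0 := abs_eq_zero.1 h5
  linarith

/-- Converse to the preceding estimates: an eigenvalue close enough to `1` is carried through `1`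
within time `h`. The branch is continuous off `U`, so `exists_eq_one_of_curve` applies; `2κ` is the
allowance for its error. -/
theorem exists_branch_eq_one (hS₀ : S₀ ∈ Matrix.unitaryGroup (DirBond B) ℂ)
    (hψ : IsEigenvectorChoice S₀ ψ) (hLpos : ∀ b, 0 < L b) (hm : ∀ b, L b ≤ Lm) (hLm : 0 < Lm)
    (h₀ : ∀ b, ℓ₀ ≤ L b) (hh : 0 < h) (hκ0 : 0 < κ) (hκℓ : 8 * κ ≤ ℓ₀)
    (hhL : h * Lm ≤ 1 / 2) (hε1 : (2 * B : ℝ) ^ 2 * (3 * ε) ≤ 1 / 2)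
    (hκ : 3 * (2 * B) ^ 2 * Lm * (Lm * h + ε) ≤ κ)
    {U : Set (Torus B)} (hloc : ∀ z ∉ U, ∀ ε > 0, ∀ᶠ w in 𝓝 z, Matched ψ ε z w)
    (hU : ∀ s ∈ Set.Icc (-h) h, flow L (t + s) ∉ U)
    (hσ : ∀ s ∈ Set.Icc (-h) h, ∀ k,
      ‖proj ψ (flow L (t + s)) (σ s k) - proj ψ (flow L t) k‖ < ε) {k : DirBond B}
    (hk : phaseDist (eigval S₀ ψ (flow L t) k) ≤
      h * (lengthOf L (proj ψ (flow L t) k) - 2 * κ)) :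
    ∃ s ∈ Set.Icc (-h) h, eigval S₀ ψ (flow L (t + s)) (σ s k) = 1 := by
  have h0 : (0 : ℝ) ∈ Set.Icc (-h) h := ⟨by linarith, hh.le⟩
  have hε0 : 0 < ε := (norm_nonneg _).trans_lt (hσ 0 h0 k)
  have hp : Continuous fun s : ℝ => flow L (t + s) :=
    (continuous_flow L).comp (continuous_const.add continuous_id)
  have hc := continuousOn_proj_of_matched hψ hloc hp hU hε0 hε1 hσ k
  have hcont : ContinuousOn (fun s => eigval S₀ ψ (flow L (t + s)) (σ s k)) (Set.Icc (-h) h) := by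
    have he : Continuous fun s : ℝ => evolution S₀ (flow L (t + s)) :=
      (continuous_evolution S₀).comp hp
    have h1 : ContinuousOn (fun s : ℝ => ((evolution S₀ (flow L (t + s)),
        proj ψ (flow L (t + s)) (σ s k)) : Matrix (DirBond B) (DirBond B) ℂ ×
          (DirBond B → DirBond B → ℂ))) (Set.Icc (-h) h) := he.continuousOn.prodMk hc
    exact (continuous_traceMul.comp_continuousOn h1).congr fun s _ => eigval_eq_traceMul _ _
  have hℓ0 : ℓ₀ ≤ lengthOf L (proj ψ (flow L t) k) := le_lengthOf hψ h₀ _ k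
  have hℓm : lengthOf L (proj ψ (flow L t) k) ≤ Lm := lengthOf_le hψ hm _ k
  refine exists_eq_one_of_curve hh hκ0 hcont (fun s _ => norm_eigval hS₀ hψ _ _)
    (norm_eigval hS₀ hψ _ _)
    (fun s hs => norm_branch_sub_le hS₀ hψ hLpos hm hLm hhL hε1 hκ hσ hs k)
    (by linarith) ?_ hk
  have := mul_le_mul_of_nonneg_left hℓm hh.le
  linarith

/-- Near a good time the spectral points match the eigenphases close to `0`. -/
theorem norm_sum_tent_sub_le_of_matched (hs : IsSpectralSequence S₀ L ψ lam j)
    (hS₀ : S₀ ∈ Matrix.unitaryGroup (DirBond B) ℂ)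
    (hψ : IsEigenvectorChoice S₀ ψ) (hLpos : ∀ b, 0 < L b) (hm : ∀ b, L b ≤ Lm) (hLm : 0 < Lm)
    (h₀ : ∀ b, ℓ₀ ≤ L b) (hℓ₀ : 0 < ℓ₀) (hh : 0 < h) (hht : h < t) (hκ0 : 0 < κ)
    (hκℓ : 8 * κ ≤ ℓ₀)
    (hhL : h * Lm ≤ 1 / 2) (hε1 : (2 * B : ℝ) ^ 2 * (3 * ε) ≤ 1 / 2)
    (hκ : 3 * (2 * B) ^ 2 * Lm * (Lm * h + ε) ≤ κ)
    {U : Set (Torus B)} (hloc : ∀ z ∉ U, ∀ ε > 0, ∀ᶠ w in 𝓝 z, Matched ψ ε z w)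
    (hU : ∀ s ∈ Set.Icc (-h) h, flow L (t + s) ∉ U)
    (hmatch : ∀ s ∈ Set.Icc (-h) h, Matched ψ ε (flow L t) (flow L (t + s)))
    {g : (DirBond B → DirBond B → ℂ) → ℂ} {C ω : ℝ} (hω : 0 ≤ ω)
    (hC : ∀ z k, ‖g (proj ψ z k)‖ ≤ C)
    (hg : ∀ z w k l, ‖proj ψ w l - proj ψ z k‖ < ε → ‖g (proj ψ w l) - g (proj ψ z k)‖ ≤ ω)
    {S : Finset ℕ} (hS : ∀ n, |lam n - t| ≤ h → n ∈ S) :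
    ‖∑ n ∈ S, (tent h (lam n - t) : ℂ) * g (proj ψ (flow L (lam n)) (j n)) -
        ∑ k, g (proj ψ (flow L t) k) *
          phaseTent (h * lengthOf L (proj ψ (flow L t) k)) (eigval S₀ ψ (flow L t) k)‖ ≤
      4 * B * (4 * C * κ / ℓ₀ + ω) *
        ∑ k, phaseTent (4 * h * Lm) (eigval S₀ ψ (flow L t) k) := by
  classical
  choose! σ hσ using hmatch
  set T := ∑ k, phaseTent (4 * h * Lm) (eigval S₀ ψ (flow L t) k) with hT
  have hT0 : 0 ≤ T := Finset.sum_nonneg fun k _ => phaseTent_nonneg _ _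
  have hC0 : 0 ≤ C := (norm_nonneg _).trans (hC (flow L t) (j 0))
  have ha : 0 < 4 * h * Lm := by positivity
  set q : DirBond B → ℝ := fun k =>
    phaseTent (h * lengthOf L (proj ψ (flow L t) k)) (eigval S₀ ψ (flow L t) k) with hq
  have hℓ : ∀ k, ℓ₀ ≤ lengthOf L (proj ψ (flow L t) k) := fun k => le_lengthOf hψ h₀ _ k
  have hq0 : ∀ k, 0 ≤ q k := fun k => phaseTent_nonneg _ _
  have hq1 : ∀ k, q k ≤ 1 := fun k => phaseTent_le_one (by nlinarith [hℓ k]) _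
  set J := S.filter fun n => |lam n - t| ≤ h with hJ
  have hJs : ∀ n ∈ J, lam n - t ∈ Set.Icc (-h) h := fun n hn =>
    abs_le.1 (Finset.mem_filter.1 hn).2
  -- The branch, labelled at time `t`, that passes `1` at the spectral point. Since each branch
  -- passes at most once, this pairs spectral points injectively with branches.
  let K : ℕ → DirBond B := fun n => (σ (lam n - t)).symm (j n)
  have hK : ∀ n, σ (lam n - t) (K n) = j n := fun n => Equiv.apply_symm_apply _ _
  have hKev : ∀ n, eigval S₀ ψ (flow L (t + (lam n - t))) (σ (lam n - t) (K n)) = 1 := fun n => by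
    rw [hK, add_sub_cancel]
    exact hs.eigval hψ n
  have hinj : Set.InjOn K J := by
    intro n hn n' hn' hnn
    have h1 : lam n - t = lam n' - t :=
      branch_unique hS₀ hψ hLpos hm hLm h₀ hκ0 hκℓ hhL hε1 hκ hσ (hJs n hn) (hJs n' hn')
        (hKev n) (by rw [hnn]; exact hKev n')
    refine hs.injective (by linarith) ?_
    rw [← hK n, ← hK n', hnn, h1]
  have hsum1 : ∑ n ∈ S, (tent h (lam n - t) : ℂ) * g (proj ψ (flow L (lam n)) (j n)) =
      ∑ n ∈ J, (tent h (lam n - t) : ℂ) * g (proj ψ (flow L (lam n)) (j n)) := by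
    rw [hJ, Finset.sum_filter_of_ne]
    intro n _ hn
    by_contra hcon
    exact hn (by rw [tent_eq_zero hh (not_le.1 hcon).le, Complex.ofReal_zero, zero_mul])
  have hsum2 : ∑ k, g (proj ψ (flow L t) k) * (q k : ℂ) =
      ∑ n ∈ J, g (proj ψ (flow L t) (K n)) * (q (K n) : ℂ) +
        ∑ k ∈ (J.image K)ᶜ, g (proj ψ (flow L t) k) * (q k : ℂ) := by
    rw [← Finset.sum_add_sum_compl (J.image K), Finset.sum_image hinj]
  change ‖_ - ∑ k, g (proj ψ (flow L t) k) * (q k : ℂ)‖ ≤ _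
  rw [hsum1, hsum2, ← sub_sub, ← Finset.sum_sub_distrib]
  have hterm1 : ∀ n ∈ J, ‖(tent h (lam n - t) : ℂ) * g (proj ψ (flow L (lam n)) (j n)) -
      g (proj ψ (flow L t) (K n)) * (q (K n) : ℂ)‖ ≤ C * (2 * κ / ℓ₀) + ω := by
    intro n hn
    have h1 := abs_tent_sub_phaseTent_le hS₀ hψ hLpos hm hLm h₀ hℓ₀ hh hκ0 hhL hε1 hκ hσ
      (hJs n hn) (hKev n)
    have h2 := hg _ _ _ _ (hσ _ (hJs n hn) (K n))
    rw [hK, add_sub_cancel] at h2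
    have h3 : (tent h (lam n - t) : ℂ) * g (proj ψ (flow L (lam n)) (j n)) -
        g (proj ψ (flow L t) (K n)) * (q (K n) : ℂ) =
        g (proj ψ (flow L (lam n)) (j n)) * ((tent h (lam n - t) - q (K n) : ℝ) : ℂ) +
          (g (proj ψ (flow L (lam n)) (j n)) - g (proj ψ (flow L t) (K n))) * (q (K n) : ℂ) := by
      push_cast
      ring
    rw [h3]
    refine (norm_add_le _ _).trans (add_le_add ?_ ?_)
    · rw [norm_mul, Complex.norm_real, Real.norm_eq_abs]
      exact mul_le_mul (hC _ _) h1 (abs_nonneg _) hC0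
    · rw [norm_mul, Complex.norm_real, Real.norm_eq_abs, abs_of_nonneg (hq0 _)]
      exact (mul_le_mul h2 (hq1 _) (hq0 _) hω).trans (le_of_eq (mul_one ω))
  -- An unpaired branch has a tent value at most `2κ/ℓ₀`: otherwise it would pass `1` within time
  -- `h`, at a positive time because `h < t`, and so produce a spectral point.
  have hterm2 : ∀ k ∈ (J.image K)ᶜ, ‖g (proj ψ (flow L t) k) * (q k : ℂ)‖ ≤
      C * (2 * κ / ℓ₀) := by
    intro k hk
    rw [norm_mul, Complex.norm_real, Real.norm_eq_abs, abs_of_nonneg (hq0 _)]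
    refine mul_le_mul (hC _ _) ?_ (hq0 k) hC0
    by_contra! hcon
    have hℓk : 0 < lengthOf L (proj ψ (flow L t) k) := hℓ₀.trans_le (hℓ k)
    have h1 : phaseDist (eigval S₀ ψ (flow L t) k) ≤
        h * (lengthOf L (proj ψ (flow L t) k) - 2 * κ) := by
      rcases lt_max_iff.1 hcon with h2 | h2
      · exact absurd h2 (not_lt.2 (by positivity))
      have h3 : 2 * κ / lengthOf L (proj ψ (flow L t) k) ≤ 2 * κ / ℓ₀ := by
        gcongr
        exact hℓ k
      have h4 : phaseDist (eigval S₀ ψ (flow L t) k) / (h * lengthOf L (proj ψ (flow L t) k)) <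
          1 - 2 * κ / lengthOf L (proj ψ (flow L t) k) := by linarith
      rw [div_lt_iff₀ (by positivity)] at h4
      refine h4.le.trans (le_of_eq ?_)
      field_simp
    obtain ⟨s, hsI, hs1⟩ := exists_branch_eq_one hS₀ hψ hLpos hm hLm h₀ hh hκ0 hκℓ hhL hε1 hκ
      hloc hU hσ h1
    obtain ⟨n, hn, hjn⟩ := hs.exists_eq hψ (t := t + s) (by linarith [hsI.1]) hs1
    have hns : lam n - t = s := by rw [hn]; ring
    refine (Finset.mem_compl.1 hk) (Finset.mem_image.2 ⟨n, ?_, ?_⟩)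
    · have : |lam n - t| ≤ h := by rw [hns]; exact abs_le.2 hsI
      exact Finset.mem_filter.2 ⟨hS n this, this⟩
    · simp only [K]
      rw [hns, hjn, Equiv.symm_apply_apply]
  have hcardJ : (J.card : ℝ) ≤ 2 * B := by
    have := Finset.card_le_univ (J.image K)
    rw [Finset.card_image_of_injOn hinj] at this
    have h2 : Fintype.card (DirBond B) = 2 * B := by simp [two_mul]
    rw [h2] at this
    exact_mod_cast this
  have hcardc : (((J.image K)ᶜ).card : ℝ) ≤ 2 * B := by
    have := Finset.card_le_univ ((J.image K)ᶜ)
    have h2 : Fintype.card (DirBond B) = 2 * B := by simp [two_mul]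
    rw [h2] at this
    exact_mod_cast this
  have hκℓ0 : 0 ≤ 2 * κ / ℓ₀ := by positivity
  have hE1 : ‖∑ n ∈ J, ((tent h (lam n - t) : ℂ) * g (proj ψ (flow L (lam n)) (j n)) -
      g (proj ψ (flow L t) (K n)) * (q (K n) : ℂ))‖ ≤ 2 * B * (C * (2 * κ / ℓ₀) + ω) := by
    refine (norm_sum_le_of_le _ hterm1).trans ?_
    rw [Finset.sum_const, nsmul_eq_mul]
    gcongr
  have hE2 : ‖∑ k ∈ (J.image K)ᶜ, g (proj ψ (flow L t) k) * (q k : ℂ)‖ ≤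
      2 * B * (C * (2 * κ / ℓ₀)) := by
    refine (norm_sum_le_of_le _ hterm2).trans ?_
    rw [Finset.sum_const, nsmul_eq_mul]
    gcongr
  have hbound : 1 ≤ 2 * T → 2 * B * (C * (2 * κ / ℓ₀) + ω) + 2 * B * (C * (2 * κ / ℓ₀)) ≤
      4 * B * (4 * C * κ / ℓ₀ + ω) * T := by
    intro h1
    have h2 : 2 * B * (C * (2 * κ / ℓ₀) + ω) + 2 * B * (C * (2 * κ / ℓ₀)) =
        2 * B * (4 * C * κ / ℓ₀ + ω) := by ring
    rw [h2]
    calc _ ≤ 2 * B * (4 * C * κ / ℓ₀ + ω) * (2 * T) :=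
          le_mul_of_one_le_right (by positivity) h1
      _ = _ := by ring
  -- The absolute error becomes proportional to `T`: when `2T < 1` neither sum has a nonzero term.
  by_cases hT1 : 1 ≤ 2 * T
  · exact (norm_sub_le _ _).trans ((add_le_add hE1 hE2).trans (hbound hT1))
  · have hJe : J = ∅ := by
      by_contra hne
      obtain ⟨n, hn⟩ := Finset.nonempty_iff_ne_empty.2 hne
      refine hT1 ?_
      obtain ⟨k, hk⟩ := exists_phaseDist_eigval_le hS₀ hψ hLpos hm (t := t) (s := lam n - t)
        (l := j n) (by rw [add_sub_cancel]; exact hs.eigval hψ n)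
      have h2 : |lam n - t| * Lm ≤ h * Lm :=
        mul_le_mul_of_nonneg_right (Finset.mem_filter.1 hn).2 hLm.le
      have := half_le_sum_phaseTent ha (μ := eigval S₀ ψ (flow L t)) (k := k) (by linarith)
      linarith
    have hqz : ∀ k, q k = 0 := by
      intro k
      rcases phaseTent_eq_zero_or hh (hℓ₀.trans_le (hℓ k)) (lengthOf_le hψ hm _ k)
        (eigval S₀ ψ (flow L t) k) with h0 | h0
      · exact h0
      · have := half_le_sum_phaseTent ha (μ := eigval S₀ ψ (flow L t)) h0
        exact absurd (by linarith) hT1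
    rw [hJe, Finset.sum_empty, zero_sub, norm_neg, Finset.sum_eq_zero, norm_zero]
    · positivity
    · intro k _
      rw [hqz k, Complex.ofReal_zero, mul_zero]

end GoodTimes

/-! ### Averaging over scalar phases -/

section TentIntegral

theorem continuous_tent (h : ℝ) : Continuous (tent h) :=
  continuous_const.max (continuous_const.sub (continuous_abs.div_const h))

theorem integral_tent {h p q : ℝ} (hh : 0 < h) (hp : p ≤ -h) (hq : h ≤ q) :
    ∫ x in p..q, tent h x = h := by
  have hi : ∀ a b, IntervalIntegrable (tent h) volume a b := fun a b =>
    (continuous_tent h).intervalIntegrable a b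
  have h1 : ∫ x in p..(-h), tent h x = 0 := by
    rw [← intervalIntegral.integral_zero (a := p) (b := -h)]
    refine intervalIntegral.integral_congr fun x hx => ?_
    rw [Set.uIcc_of_le hp] at hx
    exact tent_eq_zero hh (by rw [abs_of_neg (by linarith [hx.2])]; linarith [hx.2])
  have h2 : ∫ x in h..q, tent h x = 0 := by
    rw [← intervalIntegral.integral_zero (a := h) (b := q)]
    refine intervalIntegral.integral_congr fun x hx => ?_
    rw [Set.uIcc_of_le hq] at hx
    exact tent_eq_zero hh (by rw [abs_of_pos (by linarith [hx.1])]; exact hx.1)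
  have h3 : ∫ x in (0 : ℝ)..h, tent h x = h / 2 := by
    have : ∫ x in (0 : ℝ)..h, tent h x = ∫ x in (0 : ℝ)..h, (1 - x / h) := by
      refine intervalIntegral.integral_congr fun x hx => ?_
      rw [Set.uIcc_of_le hh.le] at hx
      rw [tent, abs_of_nonneg hx.1]
      refine max_eq_right ?_
      have := (div_le_one hh).2 hx.2
      linarith
    rw [this, intervalIntegral.integral_sub (by simp) (by
      exact (continuous_id.div_const h).intervalIntegrable _ _), intervalIntegral.integral_div]
    simp only [intervalIntegral.integral_const, integral_id, smul_eq_mul]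
    field_simp
    ring
  have h4 : ∫ x in (-h)..0, tent h x = h / 2 := by
    rw [← h3]
    have := intervalIntegral.integral_comp_neg (a := 0) (b := h) (tent h)
    rw [neg_zero] at this
    rw [← this]
    simp only [tent, abs_neg]
  rw [← intervalIntegral.integral_add_adjacent_intervals (hi p (-h)) (hi (-h) q),
    ← intervalIntegral.integral_add_adjacent_intervals (hi (-h) 0) (hi 0 q),
    ← intervalIntegral.integral_add_adjacent_intervals (hi 0 h) (hi h q), h1, h2, h3, h4]
  ring

theorem continuous_phaseTent (a : ℝ) : Continuous (phaseTent a) :=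
  continuous_const.max (continuous_const.sub (continuous_phaseDist.div_const a))

theorem integral_phaseTent {a : ℝ} (ha : 0 < a) (haπ : a ≤ Real.pi) {μ : ℂ} (hμ : ‖μ‖ = 1) :
    ∫ α in (-Real.pi)..Real.pi, phaseTent a (Complex.exp (α * Complex.I) * μ) = a := by
  obtain ⟨β, rfl, -⟩ := exists_eq_exp_of_norm_eq_one hμ
  let f : ℝ → ℝ := fun α => phaseTent a (Complex.exp (α * Complex.I))
  have hper : Function.Periodic f (2 * Real.pi) := fun α => by
    simp only [f]
    congr 1
    push_cast
    rw [add_mul]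
    exact Complex.exp_periodic _
  have h1 : ∀ α : ℝ, phaseTent a (Complex.exp (α * Complex.I) * Complex.exp (β * Complex.I)) =
      f (α + β) := fun α => by
    simp only [f]
    rw [← Complex.exp_add, ← add_mul, Complex.ofReal_add]
  simp only [h1]
  rw [intervalIntegral.integral_comp_add_right f β]
  have h2 := hper.intervalIntegral_add_eq (-Real.pi + β) (-Real.pi)
  rw [show -Real.pi + β + 2 * Real.pi = Real.pi + β by ring,
    show -Real.pi + 2 * Real.pi = Real.pi by ring] at h2
  rw [h2, ← integral_tent ha (neg_le_neg haπ) haπ]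
  refine intervalIntegral.integral_congr fun α hα => ?_
  rw [Set.uIcc_of_le (by linarith [Real.pi_pos])] at hα
  simp only [f, phaseTent, tent]
  rw [phaseDist_exp (abs_le.2 hα)]

end TentIntegral

/-! ### Invariance under scalar phases -/

section Rotation

variable {B : ℕ} {S₀ : Matrix (DirBond B) (DirBond B) ℂ}
  {ψ : Torus B → DirBond B → DirBond B → ℂ} {U : Set (Torus B)}

/-- Symmetric functions of a continuous family of bases are continuous. -/
theorem continuousAt_sum_proj {X : Type*} [TopologicalSpace X] {E : Type*} [TopologicalSpace E]
    [AddCommMonoid E] [ContinuousAdd E] {p : X → Torus B} {x : X} (hp : ContinuousAt p x)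
    (hcont : ∃ σ : Torus B → Equiv.Perm (DirBond B), ∀ k,
      ContinuousAt (fun w => rankOne (ψ w (σ w k))) (p x))
    {Γ : X × (DirBond B → DirBond B → ℂ) → E}
    (hΓ : ∀ k, ContinuousAt Γ (x, proj ψ (p x) k)) :
    ContinuousAt (fun y => ∑ k, Γ (y, proj ψ (p y) k)) x := by
  obtain ⟨σ, hσ⟩ := hcont
  have h1 : (fun y => ∑ k, Γ (y, proj ψ (p y) k)) =
      fun y => ∑ k, Γ (y, proj ψ (p y) (σ (p y) k)) := by
    funext y
    exact (Equiv.sum_comp (σ (p y)) fun k => Γ (y, proj ψ (p y) k)).symm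
  rw [h1]
  refine tendsto_finsetSum _ fun k _ => ?_
  have h2 : ContinuousAt (fun w => proj ψ w (σ w k)) (p x) := hσ k
  have h3 : ContinuousAt (fun y => proj ψ (p y) (σ (p y) k)) x :=
    ContinuousAt.comp (f := p) (g := fun w => proj ψ w (σ w k)) h2 hp
  have h4 : ContinuousAt (fun y => (y, proj ψ (p y) (σ (p y) k))) x := continuousAt_id.prodMk h3
  exact ContinuousAt.comp (f := fun y => (y, proj ψ (p y) (σ (p y) k))) (g := Γ)
    (hΓ (σ (p x) k)) h4

theorem continuousAt_phaseTent {X : Type*} [TopologicalSpace X] {a : X → ℝ} {μ : X → ℂ} {x : X}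
    (ha : ContinuousAt a x) (ha0 : a x ≠ 0) (hμ : ContinuousAt μ x) :
    ContinuousAt (fun y => phaseTent (a y) (μ y)) x := by
  have h1 : ContinuousAt (fun y => phaseDist (μ y)) x :=
    (continuous_phaseDist.continuousAt).comp hμ
  exact continuousAt_const.max (continuousAt_const.sub (h1.div ha ha0))

theorem continuous_traceMul_evolution (S₀ : Matrix (DirBond B) (DirBond B) ℂ) {X : Type*}
    [TopologicalSpace X] {p : X → Torus B} {P : X → DirBond B → DirBond B → ℂ} (hp : Continuous p)
    (hP : Continuous P) : Continuous fun x => traceMul (evolution S₀ (p x)) (P x) := by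
  refine continuous_finsetSum _ fun i _ => continuous_finsetSum _ fun j _ => ?_
  have h1 : Continuous fun x => P x j i := (continuous_apply_apply j i).comp hP
  have h2 : Continuous fun x => evolution S₀ (p x) i j :=
    (((continuous_evolution S₀).matrix_elem i j)).comp hp
  exact h2.mul h1

theorem traceMul_smul (c : ℂ) (A : Matrix (DirBond B) (DirBond B) ℂ)
    (P : DirBond B → DirBond B → ℂ) : traceMul (c • A) P = c * traceMul A P := by
  simp only [traceMul, Matrix.smul_apply, smul_eq_mul, Finset.mul_sum, mul_assoc]

/-- Replacing `D` by `cD` permutes the chosen projections and multiplies the eigenvalue of each by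
`c`; a symmetric sum forgets the permutation. -/
theorem sum_rotate {E : Type*} [AddCommMonoid E] {z : Torus B} {c : Circle}
    (hrot : ∃ σ : Equiv.Perm (DirBond B), ∀ k,
      rankOne (ψ (rotate c z) k) = rankOne (ψ z (σ k)))
    (Γ : (DirBond B → DirBond B → ℂ) → ℂ → E) :
    ∑ k, Γ (proj ψ (rotate c z) k) (eigval S₀ ψ (rotate c z) k) =
      ∑ k, Γ (proj ψ z k) ((c : ℂ) * eigval S₀ ψ z k) := by
  obtain ⟨σ, hσ⟩ := hrot
  rw [← Equiv.sum_comp σ fun k => Γ (proj ψ z k) ((c : ℂ) * eigval S₀ ψ z k)]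
  refine Finset.sum_congr rfl fun k _ => ?_
  have h1 : proj ψ (rotate c z) k = proj ψ z (σ k) := hσ k
  rw [eigval_eq_traceMul, eigval_eq_traceMul, h1, evolution_rotate, traceMul_smul]

/-- Averaging over scalar phases evaluates the integral of a tent of the eigenphases. -/
theorem integral_sum_phaseTent (hS₀ : S₀ ∈ Matrix.unitaryGroup (DirBond B) ℂ)
    (hψ : IsEigenvectorChoice S₀ ψ) (hU : IsClosed U) (h0 : torusMeasure B U = 0)
    (hcont : ∀ z ∉ U, ∃ σ : Torus B → Equiv.Perm (DirBond B), ∀ k,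
      ContinuousAt (fun w => rankOne (ψ w (σ w k))) z)
    (hrot : ∀ z ∉ U, ∀ c : Circle, ∃ σ : Equiv.Perm (DirBond B), ∀ k,
      rankOne (ψ (rotate c z) k) = rankOne (ψ z (σ k)))
    {Γ : Torus B × (DirBond B → DirBond B → ℂ) → ℂ}
    (hΓ : ∀ z ∉ U, ∀ k, ContinuousAt Γ (z, proj ψ z k))
    (hΓr : ∀ c z P, Γ (rotate c z, P) = Γ (z, P)) {C : ℝ}
    (hC : ∀ z k, ‖Γ (z, proj ψ z k)‖ ≤ C) {a : (DirBond B → DirBond B → ℂ) → ℝ}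
    (ha : Continuous a) (ha0 : ∀ z k, 0 < a (proj ψ z k)) (haπ : ∀ z k, a (proj ψ z k) ≤ Real.pi) :
    ∫ z, ∑ k, Γ (z, proj ψ z k) * (phaseTent (a (proj ψ z k)) (eigval S₀ ψ z k) : ℂ)
        ∂torusMeasure B =
      (2 * Real.pi : ℂ)⁻¹ * ∫ z, ∑ k, Γ (z, proj ψ z k) * (a (proj ψ z k) : ℂ) ∂torusMeasure B := by
  let H : ℝ × Torus B → ℂ := fun y => ∑ k, Γ (y.2, proj ψ y.2 k) *
    (phaseTent (a (proj ψ y.2 k))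
      (Complex.exp (y.1 * Complex.I) * traceMul (evolution S₀ y.2) (proj ψ y.2 k)) : ℂ)
  set ν : Measure ℝ := volume.restrict (Set.Ioc (-Real.pi) Real.pi) with hν
  have hHc : ∀ y ∉ (Set.univ : Set ℝ) ×ˢ U, ContinuousAt H y := by
    intro y hy
    have hyU : y.2 ∉ U := fun h => hy ⟨Set.mem_univ _, h⟩
    refine continuousAt_sum_proj (p := Prod.snd) continuousAt_snd (hcont y.2 hyU)
      (Γ := fun q : (ℝ × Torus B) × (DirBond B → DirBond B → ℂ) => Γ (q.1.2, q.2) *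
        (phaseTent (a q.2)
          (Complex.exp (q.1.1 * Complex.I) * traceMul (evolution S₀ q.1.2) q.2) : ℂ)) fun k => ?_
    have c1 : Continuous fun q : (ℝ × Torus B) × (DirBond B → DirBond B → ℂ) => (q.1.2, q.2) := by
      fun_prop
    have c2 : Continuous fun q : (ℝ × Torus B) × (DirBond B → DirBond B → ℂ) =>
        traceMul (evolution S₀ q.1.2) q.2 := 
      continuous_traceMul_evolution S₀ (continuous_snd.comp continuous_fst) continuous_snd
    have c3 : Continuous fun q : (ℝ × Torus B) × (DirBond B → DirBond B → ℂ) =>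
        Complex.exp (q.1.1 * Complex.I) := by fun_prop
    have h1 : ContinuousAt (fun q : (ℝ × Torus B) × (DirBond B → DirBond B → ℂ) =>
        Γ (q.1.2, q.2)) (y, proj ψ y.2 k) :=
      ContinuousAt.comp (f := fun q : (ℝ × Torus B) × (DirBond B → DirBond B → ℂ) => (q.1.2, q.2))
        (g := Γ) (hΓ y.2 hyU k) c1.continuousAt
    exact h1.mul (Complex.continuous_ofReal.continuousAt.comp
      (continuousAt_phaseTent (ha.comp continuous_snd).continuousAt (ha0 _ _).ne'
        (c3.mul c2).continuousAt))
  have hC0 : ∀ z : Torus B, ∀ k : DirBond B, 0 ≤ C := fun z k => (norm_nonneg _).trans (hC z k)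
  have hHb : ∀ y, ‖H y‖ ≤ ∑ _k : DirBond B, C := by
    intro y
    refine norm_sum_le_of_le _ fun k _ => ?_
    rw [norm_mul, Complex.norm_real, Real.norm_eq_abs, abs_of_nonneg (phaseTent_nonneg _ _)]
    exact (mul_le_mul (hC _ _) (phaseTent_le_one (ha0 _ _).le _) (phaseTent_nonneg _ _)
      (hC0 y.2 k)).trans (le_of_eq (mul_one C))
  have hUnull : (ν.prod (torusMeasure B)) ((Set.univ : Set ℝ) ×ˢ U) = 0 := by
    rw [Measure.prod_prod, h0, mul_zero]
  have hHi : Integrable H (ν.prod (torusMeasure B)) :=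
    integrable_of_bounded_of_continuousAt_compl (isClosed_univ.prod hU) hUnull hHc hHb
  have hae : ∀ᵐ z ∂torusMeasure B, z ∉ U := measure_eq_zero_iff_ae_notMem.1 h0
  -- The phase `e^{iα}` is absorbed by translating the invariant measure. The other order of
  -- integration spreads each eigenvalue uniformly over the circle, where its tent has integral `a`.
  have hconst : ∀ α : ℝ, ∫ z, H (α, z) ∂torusMeasure B =
      ∫ z, ∑ k, Γ (z, proj ψ z k) * (phaseTent (a (proj ψ z k)) (eigval S₀ ψ z k) : ℂ)
        ∂torusMeasure B := by
    intro α
    rw [← integral_mul_left_eq_self (μ := torusMeasure B) (fun z => ∑ k, Γ (z, proj ψ z k) *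
      (phaseTent (a (proj ψ z k)) (eigval S₀ ψ z k) : ℂ)) (fun _ => Circle.exp α)]
    refine integral_congr_ae (hae.mono fun z hz => ?_)
    simp only [← rotate_eq_mul, hΓr]
    rw [sum_rotate (hrot z hz _) fun P μ => Γ (z, P) * (phaseTent (a P) μ : ℂ)]
    simp only [H, eigval_eq_traceMul, Circle.coe_exp]
  have hinner : ∀ z, ∫ α, H (α, z) ∂ν = ∑ k, Γ (z, proj ψ z k) * (a (proj ψ z k) : ℂ) := by
    intro z
    have hInt : ∀ k, Continuous fun α : ℝ => Γ (z, proj ψ z k) * (phaseTent (a (proj ψ z k))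
        (Complex.exp (α * Complex.I) * traceMul (evolution S₀ z) (proj ψ z k)) : ℂ) := fun k => by
      have := continuous_phaseTent (a (proj ψ z k))
      fun_prop
    rw [hν, ← intervalIntegral.integral_of_le (by linarith [Real.pi_pos])]
    simp only [H]
    rw [intervalIntegral.integral_finsetSum fun k _ => (hInt k).intervalIntegrable _ _]
    refine Finset.sum_congr rfl fun k _ => ?_
    rw [intervalIntegral.integral_const_mul, intervalIntegral.integral_ofReal,
      ← eigval_eq_traceMul, integral_phaseTent (ha0 z k) (haπ z k) (norm_eigval hS₀ hψ z k)]
  have hswap := integral_integral_swap (f := fun α z => H (α, z)) hHi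
  simp only [hconst, hinner] at hswap
  rw [← hswap, integral_const]
  have hreal : ν.real Set.univ = 2 * Real.pi := by
    rw [hν, measureReal_restrict_apply_univ, Real.volume_real_Ioc_of_le (by linarith [Real.pi_pos])]
    ring
  rw [hreal, Complex.real_smul, ← mul_assoc]
  push_cast
  rw [inv_mul_cancel₀ (by simp [Real.pi_ne_zero]), one_mul]

end Rotation

/-! ### Spectral averages -/

section SpectralAverage

variable {B : ℕ} {S₀ : Matrix (DirBond B) (DirBond B) ℂ} {L : Fin B → ℝ}
  {ψ : Torus B → DirBond B → DirBond B → ℂ} {lam : ℕ → ℝ} {j : ℕ → DirBond B}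

theorem integral_tent_mem_Icc {h p q : ℝ} (hh : 0 < h) (hpq : p ≤ q) :
    ∫ x in p..q, tent h x ∈ Set.Icc 0 h := by
  refine ⟨intervalIntegral.integral_nonneg hpq fun x _ => tent_nonneg h x, ?_⟩
  refine le_trans ?_ (integral_tent hh (min_le_right p (-h)) (le_max_right q h)).le
  exact intervalIntegral.integral_mono_interval (μ := volume) (min_le_left _ _) hpq (le_max_left _ _)
    (Eventually.of_forall fun x => tent_nonneg h x) ((continuous_tent h).intervalIntegrable _ _)

/-- A sum over the spectral points differs little from the integral of its smoothing. -/
theorem norm_mul_sum_sub_integral_le (hmono : Monotone lam) {δ h C : ℝ}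
    (hsp : ∀ n, lam n + δ < lam (n + 2 * B)) (hh : 0 < h) (hhδ : h ≤ δ) {m : ℕ}
    (hm : ∀ n ≥ m, 1 + h ≤ lam n) {g : ℕ → ℂ} (hg : ∀ n, ‖g n‖ ≤ C) {N : ℕ} (hN : 1 ≤ lam N) :
    ‖h * ∑ n ∈ Finset.range N, g n -
        ∫ t in (1 : ℝ)..lam N, ∑ n ∈ Finset.range (N + 2 * B), (tent h (lam n - t) : ℂ) * g n‖ ≤
      (m + 4 * B) * (h * C) := by
  classical
  have hC : 0 ≤ C := (norm_nonneg _).trans (hg 0)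
  have hct : ∀ n, Continuous fun t : ℝ => (tent h (lam n - t) : ℂ) * g n := fun n => by
    have := continuous_tent h
    fun_prop
  let I : ℕ → ℝ := fun n => ∫ x in (lam n - lam N)..(lam n - 1), tent h x
  have hI : ∀ n, ∫ t in (1 : ℝ)..lam N, (tent h (lam n - t) : ℂ) * g n = (I n : ℂ) * g n := by
    intro n
    rw [intervalIntegral.integral_mul_const, intervalIntegral.integral_ofReal,
      intervalIntegral.integral_comp_sub_left (tent h)]
  have hI01 : ∀ n, I n ∈ Set.Icc 0 h := fun n => integral_tent_mem_Icc hh (by linarith)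
  rw [intervalIntegral.integral_finsetSum fun n _ => (hct n).intervalIntegrable _ _]
  simp only [hI]
  let d : ℕ → ℝ := fun n => (if n < N then h else 0) - I n
  have hd : ∀ n, |d n| ≤ h := by
    intro n
    have := hI01 n
    simp only [d]
    rw [abs_le]
    split_ifs <;> constructor <;> linarith [this.1, this.2]
  have hsum : (h : ℂ) * ∑ n ∈ Finset.range N, g n -
      ∑ n ∈ Finset.range (N + 2 * B), (I n : ℂ) * g n =
      ∑ n ∈ Finset.range (N + 2 * B), (d n : ℂ) * g n := by
    have h1 : (h : ℂ) * ∑ n ∈ Finset.range N, g n =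
        ∑ n ∈ Finset.range (N + 2 * B), ((if n < N then h else 0 : ℝ) : ℂ) * g n := by
      rw [Finset.mul_sum, ← Finset.sum_subset (Finset.range_mono (Nat.le_add_right N (2 * B)))]
      · refine Finset.sum_congr rfl fun n hn => ?_
        rw [if_pos (Finset.mem_range.1 hn)]
      · intro n _ hn
        rw [if_neg (by simpa using hn), Complex.ofReal_zero, zero_mul]
    rw [h1, ← Finset.sum_sub_distrib]
    refine Finset.sum_congr rfl fun n _ => ?_
    simp only [d]
    push_cast
    ring
  rw [hsum]
  let b₁ := (Finset.range N).filter fun n => lam N - h < lam n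
  -- Only tents cut by an end of the integration interval count wrongly: initial points, those
  -- within `h` below `lam N`, and the `2B` indices from `N` on. Spacing bounds the second kind by
  -- `2B`.
  let bad := Finset.range m ∪ (b₁ ∪ Finset.Ico N (N + 2 * B))
  have hz : ∀ n ∈ Finset.range (N + 2 * B), n ∉ bad → (d n : ℂ) * g n = 0 := by
    intro n hn hnb
    simp only [bad, b₁, Finset.mem_union, not_or, Finset.mem_range, Finset.mem_filter,
      Finset.mem_Ico, not_lt, not_and] at hnb hn
    have hnN : n < N := by
      by_contra hcon
      exact absurd (hnb.2.2 (not_lt.1 hcon)) (by omega)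
    have h1 := hnb.2.1 hnN
    have h2 := hm n hnb.1
    have h3 : I n = h := integral_tent hh (by linarith) (by linarith)
    simp only [d]
    rw [if_pos hnN, h3, sub_self, Complex.ofReal_zero, zero_mul]
  have hcard : (bad.card : ℝ) ≤ m + 4 * B := by
    have hb1 : b₁.card ≤ 2 * B := card_le_of_spacing hmono hsp fun p hp q hq => by
      have h1 := (Finset.mem_filter.1 hp).2
      have h2 := hmono (Finset.mem_range.1 (Finset.mem_filter.1 hq).1).le
      linarith
    have h2 := Finset.card_union_le (Finset.range m) (b₁ ∪ Finset.Ico N (N + 2 * B))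
    have h3 := Finset.card_union_le b₁ (Finset.Ico N (N + 2 * B))
    rw [Finset.card_range] at h2
    rw [Nat.card_Ico] at h3
    have h4 : bad.card ≤ m + 4 * B := by
      change (Finset.range m ∪ (b₁ ∪ Finset.Ico N (N + 2 * B))).card ≤ _
      omega
    exact_mod_cast h4
  calc _ = ‖∑ n ∈ Finset.range (N + 2 * B) with n ∈ bad, (d n : ℂ) * g n‖ := by
        rw [Finset.sum_filter_of_ne]
        intro n hn hne
        by_contra hcon
        exact hne (hz n hn hcon)
    _ ≤ ∑ n ∈ Finset.range (N + 2 * B) with n ∈ bad, h * C := norm_sum_le_of_le _ fun n _ => by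
        rw [norm_mul, Complex.norm_real, Real.norm_eq_abs]
        exact mul_le_mul (hd n) (hg n) (norm_nonneg _) hh.le
    _ ≤ ∑ n ∈ bad, h * C := Finset.sum_le_sum_of_subset_of_nonneg
        (fun n hn => (Finset.mem_filter.1 hn).2) fun _ _ _ => by positivity
    _ = bad.card * (h * C) := by rw [Finset.sum_const, nsmul_eq_mul]
    _ ≤ _ := by gcongr

/-- The smoothed density of spectral points, as a function on the torus. -/
def smoothDensity (S₀ : Matrix (DirBond B) (DirBond B) ℂ) (L : Fin B → ℝ)
    (ψ : Torus B → DirBond B → DirBond B → ℂ) (g : (DirBond B → DirBond B → ℂ) → ℂ) (h : ℝ)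
    (z : Torus B) : ℂ :=
  ∑ k, g (proj ψ z k) * (phaseTent (h * lengthOf L (proj ψ z k)) (eigval S₀ ψ z k) : ℂ)

/-- The projections on unit vectors lie in this compact set. -/
def stateSet (L : Fin B → ℝ) (ℓ₀ : ℝ) : Set (DirBond B → DirBond B → ℂ) :=
  Metric.closedBall 0 1 ∩ {P | ℓ₀ ≤ lengthOf L P}

theorem isCompact_stateSet (L : Fin B → ℝ) (ℓ₀ : ℝ) : IsCompact (stateSet L ℓ₀) :=
  (isCompact_closedBall _ _).inter_right (isClosed_le continuous_const (continuous_lengthOf L))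

theorem proj_mem_stateSet (hψ : IsEigenvectorChoice S₀ ψ) {ℓ₀ : ℝ} (h₀ : ∀ b, ℓ₀ ≤ L b)
    (z : Torus B) (k : DirBond B) : proj ψ z k ∈ stateSet L ℓ₀ :=
  ⟨mem_closedBall_zero_iff.2 (norm_proj_le hψ z k), le_lengthOf hψ h₀ z k⟩

theorem exists_pos_of_eventually {p : ℝ → Prop} (h : ∀ᶠ x in 𝓝 0, p x) : ∃ x > 0, p x := by
  have h1 : ∀ᶠ x : ℝ in 𝓝[>] 0, 0 < x ∧ p x := by
    filter_upwards [self_mem_nhdsWithin, h.filter_mono nhdsWithin_le_nhds] with x h2 h3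
      using ⟨h2, h3⟩
  exact h1.exists

/-- The good and bad time estimates are joined by the cutoff. Both errors are multiples of the
number of eigenvalues near `1`, so the coefficient, a continuous phase invariant function when `ζ`
is, can be averaged on the torus. -/
theorem exists_smoothing_bound (hs : IsSpectralSequence S₀ L ψ lam j)
    (hS₀ : S₀ ∈ Matrix.unitaryGroup (DirBond B) ℂ)
    (hψ : IsEigenvectorChoice S₀ ψ) {Lm ℓ₀ δ : ℝ} (hLpos : ∀ b, 0 < L b) (hm : ∀ b, L b ≤ Lm)
    (hLm : 0 < Lm) (h₀ : ∀ b, ℓ₀ ≤ L b) (hℓ₀ : 0 < ℓ₀) (hδ : 0 < δ)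
    (hsp : ∀ n, lam n + δ < lam (n + 2 * B)) {U : Set (Torus B)} (hU : IsClosed U)
    (hcont : ∀ z ∉ U, ∃ σ : Torus B → Equiv.Perm (DirBond B), ∀ k,
      ContinuousAt (fun w => rankOne (ψ w (σ w k))) z)
    {g : (DirBond B → DirBond B → ℂ) → ℂ} (hg : ContinuousOn g (stateSet L ℓ₀)) {C : ℝ}
    (hC0 : 0 ≤ C) (hC : ∀ z k, ‖g (proj ψ z k)‖ ≤ C) {ζ : C(Torus B, ℝ)} (hζ0 : ∀ z, 0 ≤ ζ z)
    (hζU : ∀ z ∈ U, ζ z = 1) {ε : ℝ} (hε : 0 < ε) :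
    ∃ h > 0, h ≤ δ ∧ h * Lm ≤ 1 / 2 ∧ ∀ t ≥ 1, ∀ S : Finset ℕ,
      (∀ n, |lam n - t| ≤ h → n ∈ S) →
      ‖∑ n ∈ S, (tent h (lam n - t) : ℂ) * g (proj ψ (flow L (lam n)) (j n)) -
          smoothDensity S₀ L ψ g h (flow L t)‖ ≤
        (ε + 16 * B * C * ζ (flow L t)) *
          ∑ k, phaseTent (4 * h * Lm) (eigval S₀ ψ (flow L t) k) := by
  have hloc : ∀ z ∉ U, ∀ ε > 0, ∀ᶠ w in 𝓝 z, Matched ψ ε z w := fun z hz ε hε =>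
    eventually_matched (hcont z hz) hε
  -- The allowances `ω`, for the change of `g`, and `κ`, for the angular velocity, each contribute
  -- at most `ε / 2` to the coefficient at good times.
  set ω := ε / (8 * B + 8) with hω
  have hω0 : 0 < ω := by positivity
  set κ := min (ℓ₀ / 8) (ε * ℓ₀ / (32 * (B * C + 1))) with hκ
  have hκ0 : 0 < κ := lt_min (by positivity) (by positivity)
  have hκ8 : 8 * κ ≤ ℓ₀ := by linarith [min_le_left (ℓ₀ / 8) (ε * ℓ₀ / (32 * (B * C + 1)))]
  have herr : 4 * B * (4 * C * κ / ℓ₀ + ω) ≤ ε := by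
    have h1 : κ ≤ ε * ℓ₀ / (32 * (B * C + 1)) := min_le_right _ _
    have hBC : 0 ≤ B * C := by positivity
    have h2 : 16 * (B * C) * (κ / ℓ₀) ≤ ε / 2 := by
      have h3 : κ / ℓ₀ ≤ ε / (32 * (B * C + 1)) := by
        rw [div_le_iff₀ hℓ₀]
        refine h1.trans (le_of_eq ?_)
        ring
      calc _ ≤ 16 * (B * C) * (ε / (32 * (B * C + 1))) := by gcongr
        _ = ε / 2 * ((B * C) / (B * C + 1)) := by field_simp; ring
        _ ≤ ε / 2 * 1 := by
          gcongr
          rw [div_le_one (by positivity)]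
          linarith
        _ = _ := by ring
    have h4 : 4 * B * ω ≤ ε / 2 := by
      rw [hω, mul_div_assoc', div_le_div_iff₀ (by positivity) two_pos]
      nlinarith
    calc _ = 16 * (B * C) * (κ / ℓ₀) + 4 * B * ω := by ring
      _ ≤ ε := by linarith
  obtain ⟨ε₁, hε₁, hguc⟩ := Metric.uniformContinuousOn_iff.1
    ((isCompact_stateSet L ℓ₀).uniformContinuousOn_of_continuous hg) ω hω0
  obtain ⟨ε₂, hε₂, hε₂1, hε₂2, hε₂3⟩ : ∃ ε₂ > 0, ε₂ < ε₁ ∧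
      (2 * B : ℝ) ^ 2 * (3 * ε₂) < 1 / 2 ∧ 3 * (2 * B) ^ 2 * Lm * ε₂ < κ / 2 := by
    have e2 : ∀ᶠ x : ℝ in 𝓝 0, (2 * B : ℝ) ^ 2 * (3 * x) < 1 / 2 := by
      have : Continuous fun x : ℝ => (2 * B : ℝ) ^ 2 * (3 * x) := by fun_prop
      exact this.continuousAt.eventually_lt_const (by norm_num)
    have e3 : ∀ᶠ x : ℝ in 𝓝 0, 3 * (2 * B) ^ 2 * Lm * x < κ / 2 := by
      have : Continuous fun x : ℝ => 3 * (2 * B) ^ 2 * Lm * x := by fun_prop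
      exact this.continuousAt.eventually_lt_const (by simpa using hκ0)
    exact exists_pos_of_eventually ((eventually_lt_nhds hε₁).and (e2.and e3))
  set K : Set (Torus B) := {z | ζ z ≤ 1 / 2} with hK
  have hKc : IsCompact K := (isClosed_le ζ.continuous continuous_const).isCompact
  have hKU : Disjoint K U := Set.disjoint_left.2 fun z hz hzU => by
    have h1 : ζ z ≤ 1 / 2 := hz
    rw [hζU z hzU] at h1
    norm_num at h1
  obtain ⟨r, hr, hmatch⟩ := exists_matched_of_isCompact hU hKc hKU hloc hε₂
  -- The window is chosen last: short enough for the flow to stay in the matching radius `r`, and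
  -- below `1` so that times `t ≥ 1` have only positive times nearby.
  obtain ⟨h, hh, hh1, hhδ, hhr, hhL, hhκ⟩ : ∃ h > 0, h < 1 ∧ 2 * h < δ ∧ h * Lm < r ∧
      h * Lm < 1 / 2 ∧ 3 * (2 * B) ^ 2 * Lm * (Lm * h) < κ / 2 := by
    have e1 : ∀ᶠ x : ℝ in 𝓝 0, 2 * x < δ := by
      have : Continuous fun x : ℝ => 2 * x := by fun_prop
      exact this.continuousAt.eventually_lt_const (by simpa using hδ)
    have e2 : ∀ c > 0, ∀ᶠ x : ℝ in 𝓝 0, x * Lm < c := fun c hc => by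
      have : Continuous fun x : ℝ => x * Lm := by fun_prop
      exact this.continuousAt.eventually_lt_const (by simpa using hc)
    have e3 : ∀ᶠ x : ℝ in 𝓝 0, 3 * (2 * B) ^ 2 * Lm * (Lm * x) < κ / 2 := by
      have : Continuous fun x : ℝ => 3 * (2 * B) ^ 2 * Lm * (Lm * x) := by fun_prop
      exact this.continuousAt.eventually_lt_const (by simpa using hκ0)
    exact exists_pos_of_eventually ((eventually_lt_nhds one_pos).and
      (e1.and ((e2 r hr).and ((e2 (1 / 2) (by norm_num)).and e3))))
  refine ⟨h, hh, by linarith, hhL.le, fun t ht S hS => ?_⟩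
  set T := ∑ k, phaseTent (4 * h * Lm) (eigval S₀ ψ (flow L t) k) with hT
  have hT0 : 0 ≤ T := Finset.sum_nonneg fun k _ => phaseTent_nonneg _ _
  have hBC : 0 ≤ B * C := by positivity
  by_cases hzK : flow L t ∈ K
  · have hgood : ∀ s ∈ Set.Icc (-h) h, flow L (t + s) ∉ U ∧
        Matched ψ ε₂ (flow L t) (flow L (t + s)) := fun s hs => by
      refine hmatch _ hzK _ ((dist_flow_le hLpos hm hLm t s).trans_lt ?_)
      exact (mul_le_mul_of_nonneg_right (abs_le.2 hs) hLm.le).trans_lt hhr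
    have h1 := norm_sum_tent_sub_le_of_matched hs hS₀ hψ hLpos hm hLm h₀ hℓ₀ hh (by linarith)
      hκ0 hκ8 hhL.le hε₂2.le (by linarith [mul_add (3 * (2 * B : ℝ) ^ 2 * Lm) (Lm * h) ε₂])
      hloc (fun s hs => (hgood s hs).1) (fun s hs => (hgood s hs).2) hω0.le hC
      (fun z w k l hzw => by
        have := hguc _ (proj_mem_stateSet hψ h₀ w l) _ (proj_mem_stateSet hψ h₀ z k)
          (by rw [dist_eq_norm]; exact hzw.trans hε₂1)
        rw [dist_eq_norm] at this
        exact this.le) hS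
    refine h1.trans (mul_le_mul_of_nonneg_right (herr.trans ?_) hT0)
    have := hζ0 (flow L t)
    nlinarith
  -- Here `ζ > 1/2`, so the crude coefficient `8BC` is below `16BCζ`.
  · have h1 := norm_sum_tent_sub_le hs hS₀ hψ hLpos hm h₀ hLm hℓ₀ hsp hh hhδ.le hC t S
    refine h1.trans (mul_le_mul_of_nonneg_right ?_ hT0)
    have h2 : 1 / 2 < ζ (flow L t) := not_le.1 hzK
    nlinarith

end SpectralAverage

/-! ### Limits of smoothed densities and of spectral sums -/

section Limits

variable {B : ℕ} {S₀ : Matrix (DirBond B) (DirBond B) ℂ} {L : Fin B → ℝ}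
  {ψ : Torus B → DirBond B → DirBond B → ℂ} {lam : ℕ → ℝ} {j : ℕ → DirBond B} {U : Set (Torus B)}

theorem continuousAt_sum_phaseTent {z : Torus B}
    (hcont : ∃ σ : Torus B → Equiv.Perm (DirBond B), ∀ k,
      ContinuousAt (fun w => rankOne (ψ w (σ w k))) z)
    {Γ : Torus B × (DirBond B → DirBond B → ℂ) → ℂ}
    (hΓ : ∀ k, ContinuousAt Γ (z, proj ψ z k))
    {a : (DirBond B → DirBond B → ℂ) → ℝ} (ha : Continuous a) (ha0 : ∀ k, 0 < a (proj ψ z k)) :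
    ContinuousAt (fun z => ∑ k, Γ (z, proj ψ z k) *
      (phaseTent (a (proj ψ z k)) (eigval S₀ ψ z k) : ℂ)) z := by
  simp only [eigval_eq_traceMul]
  refine continuousAt_sum_proj (p := id) continuousAt_id hcont
    (Γ := fun q : Torus B × (DirBond B → DirBond B → ℂ) => Γ q *
      (phaseTent (a q.2) (traceMul (evolution S₀ q.1) q.2) : ℂ)) fun k => ?_
  have c2 : Continuous fun q : Torus B × (DirBond B → DirBond B → ℂ) =>
      traceMul (evolution S₀ q.1) q.2 :=
    continuous_traceMul_evolution S₀ continuous_fst continuous_snd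
  exact (hΓ k).mul (Complex.continuous_ofReal.continuousAt.comp
    (continuousAt_phaseTent (ha.comp continuous_snd).continuousAt (ha0 k).ne' c2.continuousAt))

theorem norm_sum_phaseTent_le {z : Torus B} {Γ : Torus B × (DirBond B → DirBond B → ℂ) → ℂ} {C : ℝ}
    (hC : ∀ k, ‖Γ (z, proj ψ z k)‖ ≤ C) {a : (DirBond B → DirBond B → ℂ) → ℝ}
    (ha0 : ∀ k, 0 < a (proj ψ z k)) :
    ‖∑ k, Γ (z, proj ψ z k) * (phaseTent (a (proj ψ z k)) (eigval S₀ ψ z k) : ℂ)‖ ≤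
      ∑ _k : DirBond B, C := by
  refine norm_sum_le_of_le _ fun k _ => ?_
  rw [norm_mul, Complex.norm_real, Real.norm_eq_abs, abs_of_nonneg (phaseTent_nonneg _ _)]
  exact (mul_le_mul (hC _) (phaseTent_le_one (ha0 _).le _) (phaseTent_nonneg _ _)
    ((norm_nonneg _).trans (hC k))).trans (le_of_eq (mul_one C))

/-- The conditions on the exceptional set of a regular choice of eigenvectors. -/
structure IsExceptionalSet (L : Fin B → ℝ) (ψ : Torus B → DirBond B → DirBond B → ℂ)
    (U : Set (Torus B)) : Prop where
  isClosed : IsClosed U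
  rotate_mem : ∀ (c : Circle), ∀ z ∈ U, rotate c z ∈ U
  measure_eq_zero : torusMeasure B U = 0
  volume_flow : volume {t : ℝ | flow L t ∈ U} = 0
  exists_perm : ∀ z ∉ U, ∀ c : Circle, ∃ σ : Equiv.Perm (DirBond B), ∀ k,
    rankOne (ψ (rotate c z) k) = rankOne (ψ z (σ k))
  continuousAt : ∀ z ∉ U, ∃ σ : Torus B → Equiv.Perm (DirBond B), ∀ k,
    ContinuousAt (fun w => rankOne (ψ w (σ w k))) z

theorem IsRegularChoice.exists_isExceptionalSet (h : IsRegularChoice L ψ) :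
    ∃ U, IsExceptionalSet L ψ U := by
  obtain ⟨U, h1, h2, h3, h4, h5, h6⟩ := h
  exact ⟨U, h1, h2, (torusMeasure_eq_zero_iff h1.measurableSet).2 h3, h4, h5, h6⟩

theorem tendsto_timeAverage_phaseTent (hS₀ : S₀ ∈ Matrix.unitaryGroup (DirBond B) ℂ)
    (hψ : IsEigenvectorChoice S₀ ψ) (hL : LinearIndependent ℚ L) (hU : IsExceptionalSet L ψ U)
    {Γ : Torus B × (DirBond B → DirBond B → ℂ) → ℂ}
    (hΓ : ∀ z ∉ U, ∀ k, ContinuousAt Γ (z, proj ψ z k))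
    (hΓr : ∀ c z P, Γ (rotate c z, P) = Γ (z, P)) {C : ℝ}
    (hC : ∀ z k, ‖Γ (z, proj ψ z k)‖ ≤ C) {a : (DirBond B → DirBond B → ℂ) → ℝ}
    (ha : Continuous a) (ha0 : ∀ z k, 0 < a (proj ψ z k)) (haπ : ∀ z k, a (proj ψ z k) ≤ Real.pi) :
    Tendsto (fun Λ : ℝ => (Λ : ℂ)⁻¹ * ∫ t in (0 : ℝ)..Λ, ∑ k, Γ (flow L t, proj ψ (flow L t) k) *
        (phaseTent (a (proj ψ (flow L t) k)) (eigval S₀ ψ (flow L t) k) : ℂ)) atTop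
      (𝓝 ((2 * Real.pi : ℂ)⁻¹ *
        ∫ z, ∑ k, Γ (z, proj ψ z k) * (a (proj ψ z k) : ℂ) ∂torusMeasure B)) := by
  rw [← integral_sum_phaseTent hS₀ hψ hU.isClosed hU.measure_eq_zero hU.continuousAt hU.exists_perm
    hΓ hΓr hC ha ha0 haπ]
  exact tendsto_timeAverage hL hU.isClosed hU.rotate_mem hU.measure_eq_zero hU.volume_flow
    (f := fun z => ∑ k, Γ (z, proj ψ z k) * (phaseTent (a (proj ψ z k)) (eigval S₀ ψ z k) : ℂ))
    (fun z hz => continuousAt_sum_phaseTent (hU.continuousAt z hz) (hΓ z hz) ha (ha0 z))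
    (fun z => norm_sum_phaseTent_le (hC z) (ha0 z))

theorem continuousAt_smoothDensity (hLψ : ∀ z k, 0 < lengthOf L (proj ψ z k))
    (hU : IsExceptionalSet L ψ U) {g : (DirBond B → DirBond B → ℂ) → ℂ}
    (hg : ∀ z k, ContinuousAt g (proj ψ z k)) {h : ℝ} (hh : 0 < h) :
    ∀ z ∉ U, ContinuousAt (smoothDensity S₀ L ψ g h) z := fun z hz =>
  continuousAt_sum_phaseTent (S₀ := S₀)
    (Γ := fun q : Torus B × (DirBond B → DirBond B → ℂ) => g q.2) (hU.continuousAt z hz)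
    (fun k => ContinuousAt.comp (f := Prod.snd) (g := g) (hg z k) continuousAt_snd)
    (a := fun P => h * lengthOf L P) (continuous_const.mul (continuous_lengthOf L))
    (fun k => mul_pos hh (hLψ z k))

theorem norm_smoothDensity_le (hLψ : ∀ z k, 0 < lengthOf L (proj ψ z k))
    {g : (DirBond B → DirBond B → ℂ) → ℂ} {C : ℝ} (hC : ∀ z k, ‖g (proj ψ z k)‖ ≤ C) {h : ℝ}
    (hh : 0 < h) (z : Torus B) : ‖smoothDensity S₀ L ψ g h z‖ ≤ ∑ _k : DirBond B, C :=
  norm_sum_phaseTent_le (S₀ := S₀) (Γ := fun q : Torus B × (DirBond B → DirBond B → ℂ) => g q.2)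
    (hC z) (a := fun P => h * lengthOf L P) (fun k => mul_pos hh (hLψ z k))

/-- Averaging over phases turns the tent into its width `hℓ`, and the division by `ℓ` cancels the
angular velocity. -/
theorem tendsto_timeAverage_smoothDensity (hS₀ : S₀ ∈ Matrix.unitaryGroup (DirBond B) ℂ)
    (hψ : IsEigenvectorChoice S₀ ψ) (hL : LinearIndependent ℚ L) (hU : IsExceptionalSet L ψ U)
    (hLψ : ∀ z k, 0 < lengthOf L (proj ψ z k)) {F : (DirBond B → DirBond B → ℂ) → ℂ}
    (hg : ∀ z k, ContinuousAt (fun P => F P / (lengthOf L P : ℂ)) (proj ψ z k)) {C : ℝ}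
    (hC : ∀ z k, ‖F (proj ψ z k) / (lengthOf L (proj ψ z k) : ℂ)‖ ≤ C) {h : ℝ}
    (hh : 0 < h) (hhπ : ∀ z k, h * lengthOf L (proj ψ z k) ≤ Real.pi) :
    Tendsto (fun Λ : ℝ => (Λ : ℂ)⁻¹ * ∫ t in (0 : ℝ)..Λ,
        smoothDensity S₀ L ψ (fun P => F P / (lengthOf L P : ℂ)) h (flow L t)) atTop
      (𝓝 (h * ((2 * Real.pi : ℂ)⁻¹ * ∫ z, ∑ k, F (proj ψ z k) ∂torusMeasure B))) := by
  have h1 := tendsto_timeAverage_phaseTent hS₀ hψ hL hU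
    (Γ := fun q : Torus B × (DirBond B → DirBond B → ℂ) => F q.2 / (lengthOf L q.2 : ℂ))
    (fun z _ k => ContinuousAt.comp (f := Prod.snd) (g := fun P => F P / (lengthOf L P : ℂ))
      (hg z k) continuousAt_snd) (fun _ _ _ => rfl) hC
    (a := fun P => h * lengthOf L P) (continuous_const.mul (continuous_lengthOf L))
    (fun z k => mul_pos hh (hLψ z k)) hhπ
  have h2 : ∀ z, ∑ k, F (proj ψ z k) / (lengthOf L (proj ψ z k) : ℂ) *
      ((h * lengthOf L (proj ψ z k) : ℝ) : ℂ) = h * ∑ k, F (proj ψ z k) := fun z => by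
    rw [Finset.mul_sum]
    refine Finset.sum_congr rfl fun k _ => ?_
    have : (lengthOf L (proj ψ z k) : ℂ) ≠ 0 := by exact_mod_cast (hLψ z k).ne'
    push_cast
    field_simp
  simp only [h2] at h1
  rw [integral_const_mul, mul_left_comm] at h1
  exact h1

/-- A weighted count of the eigenphases close to `0`. -/
def weightedCount (S₀ : Matrix (DirBond B) (DirBond B) ℂ)
    (ψ : Torus B → DirBond B → DirBond B → ℂ) (w : Torus B → ℝ) (a : ℝ) (z : Torus B) : ℝ :=
  w z * ∑ k, phaseTent a (eigval S₀ ψ z k)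

theorem weightedCount_nonneg {w : Torus B → ℝ} (hw : ∀ z, 0 ≤ w z) (a : ℝ) (z : Torus B) :
    0 ≤ weightedCount S₀ ψ w a z :=
  mul_nonneg (hw z) (Finset.sum_nonneg fun _ _ => phaseTent_nonneg _ _)

theorem ofReal_weightedCount (w : Torus B → ℝ) (a : ℝ) (z : Torus B) :
    (weightedCount S₀ ψ w a z : ℂ) =
      ∑ k, (w z : ℂ) * (phaseTent a (eigval S₀ ψ z k) : ℂ) := by
  rw [weightedCount, ← Finset.mul_sum]
  push_cast
  rfl

theorem continuousAt_weightedCount (hU : IsExceptionalSet L ψ U) {w : Torus B → ℝ}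
    (hw : Continuous w) {a : ℝ} (ha : 0 < a) :
    ∀ z ∉ U, ContinuousAt (weightedCount S₀ ψ w a) z := by
  intro z hz
  have h1 : ContinuousAt (fun z => (weightedCount S₀ ψ w a z : ℂ)) z := by
    simp only [ofReal_weightedCount]
    exact continuousAt_sum_phaseTent (S₀ := S₀)
      (Γ := fun q : Torus B × (DirBond B → DirBond B → ℂ) => (w q.1 : ℂ)) (hU.continuousAt z hz)
      (fun k => (Complex.continuous_ofReal.comp (hw.comp continuous_fst)).continuousAt)
      (a := fun _ => a) continuous_const (fun _ => ha)
  exact Complex.continuous_re.continuousAt.comp h1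

theorem norm_weightedCount_le {w : Torus B → ℝ} {W : ℝ} (hw : ∀ z, |w z| ≤ W) {a : ℝ} (ha : 0 < a)
    (z : Torus B) : ‖weightedCount S₀ ψ w a z‖ ≤ ∑ _k : DirBond B, W := by
  have h1 := norm_sum_phaseTent_le (S₀ := S₀) (ψ := ψ) (z := z)
    (Γ := fun q : Torus B × (DirBond B → DirBond B → ℂ) => (w q.1 : ℂ)) (C := W)
    (fun k => by rw [Complex.norm_real]; exact hw z)
    (a := fun _ => a) (fun _ => ha)
  simp only [← ofReal_weightedCount] at h1
  rwa [Complex.norm_real] at h1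

/-- The average error is linear in the width `a`. With `a = 4hLm` it remains small, uniformly in
`h`, after the division by `h` that undoes the smoothing. -/
theorem tendsto_timeAverage_weightedCount (hS₀ : S₀ ∈ Matrix.unitaryGroup (DirBond B) ℂ)
    (hψ : IsEigenvectorChoice S₀ ψ) (hL : LinearIndependent ℚ L) (hU : IsExceptionalSet L ψ U)
    {w : Torus B → ℝ} (hwc : Continuous w) (hwr : ∀ c z, w (rotate c z) = w z) {W : ℝ}
    (hw : ∀ z, |w z| ≤ W) {a : ℝ} (ha : 0 < a) (haπ : a ≤ Real.pi) :
    Tendsto (fun Λ : ℝ => Λ⁻¹ * ∫ t in (0 : ℝ)..Λ, weightedCount S₀ ψ w a (flow L t)) atTop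
      (𝓝 ((2 * Real.pi)⁻¹ * (2 * B * ((∫ z, w z ∂torusMeasure B) * a)))) := by
  have h1 := tendsto_timeAverage_phaseTent hS₀ hψ hL hU
    (Γ := fun q : Torus B × (DirBond B → DirBond B → ℂ) => (w q.1 : ℂ))
    (fun z _ k => (Complex.continuous_ofReal.comp (hwc.comp continuous_fst)).continuousAt)
    (fun c z _ => by simp only [hwr])
    (C := W) (fun z k => by rw [Complex.norm_real]; exact hw z)
    (a := fun _ => a) continuous_const (fun _ _ => ha) (fun _ _ => haπ)
  simp only [← ofReal_weightedCount, Finset.sum_const, card_dirBond, nsmul_eq_mul,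
    intervalIntegral.integral_ofReal] at h1
  have h3 : (∫ z, ((2 * B : ℕ) : ℂ) * ((w z : ℂ) * (a : ℂ)) ∂torusMeasure B) =
      ((2 * B * ((∫ z, w z ∂torusMeasure B) * a) : ℝ) : ℂ) := by
    rw [integral_const_mul, integral_mul_const, integral_complex_ofReal]
    push_cast
    ring
  rw [h3, ← Complex.ofReal_ofNat, ← Complex.ofReal_mul, ← Complex.ofReal_inv,
    ← Complex.ofReal_mul] at h1
  have h2 := (Complex.continuous_re.tendsto _).comp h1
  rw [Complex.ofReal_re] at h2
  refine h2.congr fun Λ => ?_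
  simp only [Function.comp_apply]
  rw [← Complex.ofReal_inv, ← Complex.ofReal_mul, Complex.ofReal_re]

/-- Comparison of a spectral sum with the time integral of the smoothed density. -/
theorem norm_spectralSum_sub_le (hs : IsSpectralSequence S₀ L ψ lam j) {δ h C : ℝ}
    (hsp : ∀ n, lam n + δ < lam (n + 2 * B)) (hh : 0 < h) (hhδ : h ≤ δ) {m : ℕ}
    (hm : ∀ n ≥ m, 1 + h ≤ lam n) {g : (DirBond B → DirBond B → ℂ) → ℂ}
    (hC : ∀ z k, ‖g (proj ψ z k)‖ ≤ C) {G : ℝ → ℂ} {E : ℝ → ℝ}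
    (hGi : ∀ a b, IntervalIntegrable G volume a b)
    (hEi : ∀ a b, IntervalIntegrable E volume a b) (hE0 : ∀ t, 0 ≤ E t)
    (hbound : ∀ t ≥ 1, ∀ S : Finset ℕ, (∀ n, |lam n - t| ≤ h → n ∈ S) →
      ‖∑ n ∈ S, (tent h (lam n - t) : ℂ) * g (proj ψ (flow L (lam n)) (j n)) - G t‖ ≤ E t)
    {N : ℕ} (hN : 1 ≤ lam N) :
    ‖(lam N : ℂ)⁻¹ * ∑ n ∈ Finset.range N, g (proj ψ (flow L (lam n)) (j n)) -
        (h : ℂ)⁻¹ * ((lam N : ℂ)⁻¹ * ∫ t in (0 : ℝ)..lam N, G t)‖ ≤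
      h⁻¹ * ((lam N)⁻¹ * ((m + 4 * B) * (h * C) + ‖∫ t in (0 : ℝ)..1, G t‖) +
        (lam N)⁻¹ * ∫ t in (0 : ℝ)..lam N, E t) := by
  have hN0 : 0 < lam N := by linarith
  have h1 := norm_mul_sum_sub_integral_le hs.1 hsp hh hhδ hm
    (g := fun n => g (proj ψ (flow L (lam n)) (j n))) (fun n => hC _ _) hN
  set Y := ∫ t in (1 : ℝ)..lam N, ∑ n ∈ Finset.range (N + 2 * B),
    (tent h (lam n - t) : ℂ) * g (proj ψ (flow L (lam n)) (j n)) with hY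
  have hYi : IntervalIntegrable (fun t => ∑ n ∈ Finset.range (N + 2 * B),
      (tent h (lam n - t) : ℂ) * g (proj ψ (flow L (lam n)) (j n))) volume 1 (lam N) := by
    have := continuous_tent h
    exact Continuous.intervalIntegrable (by fun_prop) _ _
  have h2 : ‖Y - ∫ t in (1 : ℝ)..lam N, G t‖ ≤ ∫ t in (1 : ℝ)..lam N, E t := by
    rw [hY, ← intervalIntegral.integral_sub hYi (hGi _ _)]
    refine intervalIntegral.norm_integral_le_of_norm_le hN
      (Eventually.of_forall fun t ht => ?_) (hEi _ _)
    -- For `t ≤ lam N` no point of index `N + 2B` or more lies within `h ≤ δ`, so the finite sum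
    -- contains all tents that matter.
    refine hbound t ht.1.le _ fun n hn => ?_
    rw [Finset.mem_range]
    by_contra! hcon
    have h3 := hs.1 hcon
    have h4 := (abs_le.1 hn).2
    linarith [hsp N, ht.2]
  have h3 : ∫ t in (1 : ℝ)..lam N, E t ≤ ∫ t in (0 : ℝ)..lam N, E t := by
    rw [← intervalIntegral.integral_add_adjacent_intervals (hEi 0 1) (hEi 1 (lam N))]
    have := intervalIntegral.integral_nonneg (μ := volume) zero_le_one
      fun t (_ : t ∈ Set.Icc (0 : ℝ) 1) => hE0 t
    linarith
  have h4 := intervalIntegral.integral_add_adjacent_intervals (hGi 0 1) (hGi 1 (lam N))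
  set X := ∑ n ∈ Finset.range N, g (proj ψ (flow L (lam n)) (j n)) with hX
  have h5 : ‖(h : ℂ) * X - ∫ t in (0 : ℝ)..lam N, G t‖ ≤
      (m + 4 * B) * (h * C) + ‖∫ t in (0 : ℝ)..1, G t‖ + ∫ t in (0 : ℝ)..lam N, E t := by
    have h6 : (h : ℂ) * X - ∫ t in (0 : ℝ)..lam N, G t =
        (h * X - Y) + (Y - ∫ t in (1 : ℝ)..lam N, G t) - ∫ t in (0 : ℝ)..1, G t := by
      rw [← h4]
      ring
    rw [h6]
    have h7 := norm_sub_le ((h * X - Y) + (Y - ∫ t in (1 : ℝ)..lam N, G t))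
      (∫ t in (0 : ℝ)..1, G t)
    have h8 := norm_add_le (h * X - Y) (Y - ∫ t in (1 : ℝ)..lam N, G t)
    linarith
  have hh' : (h : ℂ) ≠ 0 := by exact_mod_cast hh.ne'
  have h9 : (lam N : ℂ)⁻¹ * X - (h : ℂ)⁻¹ * ((lam N : ℂ)⁻¹ * ∫ t in (0 : ℝ)..lam N, G t) =
      (h : ℂ)⁻¹ * (lam N : ℂ)⁻¹ * (h * X - ∫ t in (0 : ℝ)..lam N, G t) := by
    field_simp
  rw [h9, norm_mul, norm_mul, norm_inv, norm_inv, Complex.norm_real, Complex.norm_real,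
    Real.norm_eq_abs, Real.norm_eq_abs, abs_of_pos hh, abs_of_pos hN0, ← mul_add, ← mul_assoc]
  exact mul_le_mul_of_nonneg_left h5 (by positivity)

/-- For fixed `h` the spectral sum differs from the averaged smooth density, divided by `h`, by an
asymptotically small amount. The limit of that average does not depend on `h`, so the limit of the
sum is exact. -/
theorem tendsto_spectralSum (hs : IsSpectralSequence S₀ L ψ lam j)
    (hS₀ : S₀ ∈ Matrix.unitaryGroup (DirBond B) ℂ) (hψ : IsEigenvectorChoice S₀ ψ)
    (hLpos : ∀ b, 0 < L b) (hL : LinearIndependent ℚ L) (hU : IsExceptionalSet L ψ U)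
    {Lm ℓ₀ δ : ℝ} (hm : ∀ b, L b ≤ Lm) (hLm : 0 < Lm) (h₀ : ∀ b, ℓ₀ ≤ L b) (hℓ₀ : 0 < ℓ₀)
    (hδ : 0 < δ) (hsp : ∀ n, lam n + δ < lam (n + 2 * B))
    {F : (DirBond B → DirBond B → ℂ) → ℂ} (hF : Continuous F) :
    Tendsto (fun N : ℕ => (lam N : ℂ)⁻¹ * ∑ n ∈ Finset.range N,
        F (proj ψ (flow L (lam n)) (j n)) / (lengthOf L (proj ψ (flow L (lam n)) (j n)) : ℂ))
      atTop (𝓝 ((2 * Real.pi : ℂ)⁻¹ * ∫ z, ∑ k, F (proj ψ z k) ∂torusMeasure B)) := by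
  have hℓpos : ∀ z k, 0 < lengthOf L (proj ψ z k) := fun z k =>
    hℓ₀.trans_le (le_lengthOf hψ h₀ z k)
  have hgc : ∀ P, lengthOf L P ≠ 0 → ContinuousAt (fun P => F P / (lengthOf L P : ℂ)) P :=
    fun P hP => hF.continuousAt.div
      (Complex.continuous_ofReal.comp (continuous_lengthOf L)).continuousAt (by exact_mod_cast hP)
  have hgon : ContinuousOn (fun P => F P / (lengthOf L P : ℂ)) (stateSet L ℓ₀) := fun P hP =>
    (hgc P (hℓ₀.trans_le hP.2).ne').continuousWithinAt
  obtain ⟨C, hC⟩ := (isCompact_stateSet L ℓ₀).exists_bound_of_continuousOn hgon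
  have hC' : ∀ z k, ‖F (proj ψ z k) / (lengthOf L (proj ψ z k) : ℂ)‖ ≤ C := fun z k =>
    hC _ (proj_mem_stateSet hψ h₀ z k)
  have hC0 : 0 ≤ C := (norm_nonneg _).trans (hC' 1 (j 0))
  have hlam := hs.tendsto_atTop hδ hsp
  refine Metric.tendsto_nhds.2 fun η hη => ?_
  -- `M` times the integral of the error coefficient is the limiting error, with `h` already
  -- cancelled. That integral is at most `2ε`: one `ε` from good times, one from the cutoff.
  obtain ⟨M, hM⟩ : ∃ M : ℝ, M = (2 * Real.pi)⁻¹ * (2 * B * (4 * Lm)) := ⟨_, rfl⟩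
  have hM0 : 0 ≤ M := by rw [hM]; positivity
  obtain ⟨ε, hε⟩ : ∃ ε, ε = η / (4 * (M + 1)) := ⟨_, rfl⟩
  have hε0 : 0 < ε := by rw [hε]; positivity
  obtain ⟨ζ, hζ0, hζ1, hζU, hζr, hζi⟩ := exists_cutoff hU.isClosed hU.measure_eq_zero hU.rotate_mem
    (ε := ε / (16 * B * C + 1)) (by positivity)
  obtain ⟨h, hh, hhδ, hhL, hbound⟩ := exists_smoothing_bound hs hS₀ hψ hLpos hm hLm h₀ hℓ₀ hδ hsp
    hU.isClosed hU.continuousAt hgon hC0 hC' hζ0 hζU hε0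
  have hwc : Continuous fun z => ε + 16 * B * C * ζ z := by fun_prop
  have hw0 : ∀ z, 0 ≤ ε + 16 * B * C * ζ z := fun z => by
    have := hζ0 z
    positivity
  have hw1 : ∀ z, |ε + 16 * B * C * ζ z| ≤ ε + 16 * B * C := fun z => by
    have := mul_le_mul_of_nonneg_left (hζ1 z) (by positivity : 0 ≤ 16 * B * C)
    rw [abs_of_nonneg (hw0 z)]
    linarith
  have hhpos : 0 < 4 * h * Lm := by positivity
  have hhπ : 4 * h * Lm ≤ Real.pi := by linarith [Real.pi_gt_three]
  have hhℓπ : ∀ z k, h * lengthOf L (proj ψ z k) ≤ Real.pi := fun z k => by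
    have := mul_le_mul_of_nonneg_left (lengthOf_le hψ hm z k) hh.le
    linarith [Real.pi_gt_three]
  have hGlim := tendsto_timeAverage_smoothDensity hS₀ hψ hL hU hℓpos
    (fun z k => hgc _ (hℓpos z k).ne') hC' hh hhℓπ
  have hElim := tendsto_timeAverage_weightedCount hS₀ hψ hL hU hwc (fun c z => by rw [hζr]) hw1
    hhpos hhπ
  have hwint : M * ∫ z, (ε + 16 * B * C * ζ z) ∂torusMeasure B < η / 2 := by
    have hζint : Integrable ζ (torusMeasure B) :=
      ζ.continuous.integrable_of_hasCompactSupport (HasCompactSupport.of_compactSpace _)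
    have h1 : ∫ z, (ε + 16 * B * C * ζ z) ∂torusMeasure B =
        ε + 16 * B * C * ∫ z, ζ z ∂torusMeasure B := by
      rw [integral_add (integrable_const _) (hζint.const_mul _), integral_const,
        integral_const_mul]
      simp
    have h2 : 16 * B * C * ∫ z, ζ z ∂torusMeasure B ≤ ε := by
      calc _ ≤ 16 * B * C * (ε / (16 * B * C + 1)) := by gcongr
        _ = ε * ((16 * B * C) / (16 * B * C + 1)) := by ring
        _ ≤ ε * 1 := by
          gcongr
          rw [div_le_one (by positivity)]
          linarith
        _ = ε := mul_one ε
    calc _ ≤ M * (2 * ε) := by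
          gcongr
          linarith
      _ < (M + 1) * (2 * ε) := by nlinarith
      _ = η / 2 := by rw [hε]; field_simp; ring
  have hGi := intervalIntegrable_flow hU.isClosed hU.volume_flow
    (continuousAt_smoothDensity (S₀ := S₀) hℓpos hU (fun z k => hgc _ (hℓpos z k).ne') hh)
    (norm_smoothDensity_le (S₀ := S₀) hℓpos hC' hh)
  have hEi := intervalIntegrable_flow hU.isClosed hU.volume_flow
    (continuousAt_weightedCount (S₀ := S₀) hU hwc hhpos)
    (norm_weightedCount_le (S₀ := S₀) (ψ := ψ) hw1 hhpos)
  obtain ⟨m, hm1⟩ := eventually_atTop.1 (hlam.eventually_ge_atTop (1 + h))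
  have hmain := fun N (hN : 1 ≤ lam N) => norm_spectralSum_sub_le hs hsp hh hhδ hm1
    (g := fun P => F P / (lengthOf L P : ℂ)) hC'
    (G := fun t => smoothDensity S₀ L ψ (fun P => F P / (lengthOf L P : ℂ)) h (flow L t))
    (E := fun t => weightedCount S₀ ψ (fun z => ε + 16 * B * C * ζ z) (4 * h * Lm) (flow L t))
    hGi hEi (fun t => weightedCount_nonneg hw0 _ _) hbound hN
  have hlimU := (hGlim.comp hlam).const_mul ((h : ℂ)⁻¹)
  have hh' : (h : ℂ) ≠ 0 := by exact_mod_cast hh.ne'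
  rw [inv_mul_cancel_left₀ hh'] at hlimU
  have hlimV := (((tendsto_inv_atTop_zero.comp hlam).mul_const ((m + 4 * B) * (h * C) +
    ‖∫ t in (0 : ℝ)..1, smoothDensity S₀ L ψ (fun P => F P / (lengthOf L P : ℂ)) h (flow L t)‖)).add
    (hElim.comp hlam)).const_mul h⁻¹
  have hval : h⁻¹ * (0 * ((m + 4 * B) * (h * C) +
      ‖∫ t in (0 : ℝ)..1, smoothDensity S₀ L ψ (fun P => F P / (lengthOf L P : ℂ)) h (flow L t)‖) +
      (2 * Real.pi)⁻¹ * (2 * B * ((∫ z, (ε + 16 * B * C * ζ z) ∂torusMeasure B) *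
        (4 * h * Lm)))) = M * ∫ z, (ε + 16 * B * C * ζ z) ∂torusMeasure B := by
    rw [hM]
    field_simp
    ring
  rw [hval] at hlimV
  filter_upwards [Metric.tendsto_nhds.1 hlimU (η / 2) (by positivity),
    hlimV.eventually_lt_const hwint, hlam.eventually_ge_atTop 1] with N h1 h2 h3
  have h4 := hmain N h3
  simp only [Function.comp_apply] at h1 h2
  rw [dist_eq_norm] at h1 ⊢
  refine (norm_sub_le_norm_sub_add_norm_sub _ _ _).trans_lt ((add_lt_add_of_le_of_lt
    (h4.trans h2.le) h1).trans_eq (add_halves η))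

end Limits

/-! ### Moments of an observable and normalization by the number of spectral points -/

section Moments

variable {B : ℕ} {S₀ : Matrix (DirBond B) (DirBond B) ℂ} {L : Fin B → ℝ}
  {ψ : Torus B → DirBond B → DirBond B → ℂ} {lam : ℕ → ℝ} {j : ℕ → DirBond B} {U : Set (Torus B)}

theorem continuous_traceMul_pow (A : Matrix (DirBond B) (DirBond B) ℂ) (m : ℕ) :
    Continuous fun P => traceMul A P ^ m := by
  refine Continuous.pow ?_ m
  refine continuous_finsetSum _ fun i _ => continuous_finsetSum _ fun j _ => ?_
  exact continuous_const.mul (continuous_apply_apply j i)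

theorem meanMoment_eq (A : Matrix (DirBond B) (DirBond B) ℂ) (m : ℕ) (z : Torus B) :
    meanMoment A m (ψ z) = (2 * (B : ℂ))⁻¹ * ∑ k, traceMul A (proj ψ z k) ^ m := by
  simp only [meanMoment, traceMul_proj]

theorem continuousAt_meanMoment (hU : IsExceptionalSet L ψ U)
    (A : Matrix (DirBond B) (DirBond B) ℂ) (m : ℕ) :
    ∀ z ∉ U, ContinuousAt (fun z => meanMoment A m (ψ z)) z := by
  intro z hz
  simp only [meanMoment_eq]
  exact continuousAt_const.mul (continuousAt_sum_proj (p := id) continuousAt_id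
    (hU.continuousAt z hz)
    (Γ := fun q : Torus B × (DirBond B → DirBond B → ℂ) => traceMul A q.2 ^ m)
    fun k => ((continuous_traceMul_pow A m).comp continuous_snd).continuousAt)

theorem exists_norm_meanMoment_le (hψ : IsEigenvectorChoice S₀ ψ)
    (A : Matrix (DirBond B) (DirBond B) ℂ) (m : ℕ) :
    ∃ C, ∀ z, ‖meanMoment A m (ψ z)‖ ≤ C := by
  obtain ⟨C, hC⟩ := (isCompact_closedBall (0 : DirBond B → DirBond B → ℂ) 1)
    |>.exists_bound_of_continuousOn (continuous_traceMul_pow A m).continuousOn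
  refine ⟨‖(2 * (B : ℂ))⁻¹‖ * ∑ _k : DirBond B, C, fun z => ?_⟩
  rw [meanMoment_eq, norm_mul]
  refine mul_le_mul_of_nonneg_left (norm_sum_le_of_le _ fun k _ => ?_) (norm_nonneg _)
  exact hC _ (mem_closedBall_zero_iff.2 (norm_proj_le hψ z k))

theorem integral_comp_expTorus {f : Torus B → ℂ} (hf : Integrable f (torusMeasure B)) :
    ∫ x, f (expTorus x) ∂uniformTorus B = ∫ z, f z ∂torusMeasure B :=
  (integral_map continuous_expTorus.measurable.aemeasurable hf.aestronglyMeasurable).symm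

theorem integrable_comp_expTorus {f : Torus B → ℂ} (hf : Integrable f (torusMeasure B)) :
    Integrable (fun x => f (expTorus x)) (uniformTorus B) :=
  hf.comp_measurable continuous_expTorus.measurable

/-- The trace of the bond-length observable, computed in the chosen basis. It is the constant in
Weyl's law. -/
theorem sum_lengthOf (hψ : IsEigenvectorChoice S₀ ψ) (z : Torus B) :
    ∑ k, lengthOf L (proj ψ z k) = 2 * ∑ b, L b := by
  have h1 : ∀ i, ∑ k, (proj ψ z k i i).re = 1 := fun i => by
    have h2 := congrFun (congrFun (hψ z).sum_rankOne i) i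
    rw [Matrix.sum_apply, Matrix.one_apply_eq] at h2
    have h3 := congrArg Complex.re h2
    rw [Complex.re_sum] at h3
    exact h3
  simp only [lengthOf]
  rw [Finset.sum_comm]
  simp only [← Finset.mul_sum, h1, mul_one]
  rw [Fintype.sum_sum_type, two_mul]
  rfl

theorem tendsto_spectralAverage (hB : 0 < B) (hs : IsSpectralSequence S₀ L ψ lam j)
    (hS₀ : S₀ ∈ Matrix.unitaryGroup (DirBond B) ℂ) (hψ : IsEigenvectorChoice S₀ ψ)
    (hLpos : ∀ b, 0 < L b) (hL : LinearIndependent ℚ L) (hU : IsExceptionalSet L ψ U)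
    (A : Matrix (DirBond B) (DirBond B) ℂ) (m : ℕ) :
    Tendsto (fun N : ℕ => (N : ℂ)⁻¹ * ∑ n ∈ Finset.range N,
        expectation A (ψ (flow L (lam n)) (j n)) ^ m /
          (expectation (bondLength L) (ψ (flow L (lam n)) (j n)) / (meanLength L : ℂ)))
      atTop (𝓝 (∫ z, meanMoment A m (ψ z) ∂torusMeasure B)) := by
  have : Nonempty (Fin B) := ⟨⟨0, hB⟩⟩
  obtain ⟨b₁, hb₁⟩ := Finite.exists_max L
  obtain ⟨b₀, hb₀⟩ := Finite.exists_min L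
  obtain ⟨δ, hδ, hsp⟩ := hs.exists_spacing hS₀ hψ hLpos hb₁ hb₀ (hLpos b₁) (hLpos b₀)
  have hlam := hs.tendsto_atTop hδ hsp
  have hsum : 0 < ∑ b, L b := Finset.sum_pos (fun b _ => hLpos b) Finset.univ_nonempty
  have hBne : (B : ℂ) ≠ 0 := by exact_mod_cast hB.ne'
  have hsumne : ((∑ b, L b : ℝ) : ℂ) ≠ 0 := by exact_mod_cast hsum.ne'
  have hπ : (Real.pi : ℂ) ≠ 0 := by exact_mod_cast Real.pi_ne_zero
  have hmean : (meanLength L : ℂ) = ((∑ b, L b : ℝ) : ℂ) / B := by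
    rw [meanLength]
    push_cast
    rfl
  have h1 := tendsto_spectralSum hs hS₀ hψ hLpos hL hU hb₁ (hLpos b₁) hb₀ (hLpos b₀) hδ hsp
    (continuous_traceMul_pow A m)
  -- With `F` equal to the length every summand is `1`, so this is Weyl's law `N / lam N → (∑ L_b) /
  -- π`. Dividing by it replaces the normalization `lam N` by `N`.
  have h2 := tendsto_spectralSum hs hS₀ hψ hLpos hL hU hb₁ (hLpos b₁) hb₀ (hLpos b₀) hδ hsp
    (Complex.continuous_ofReal.comp (continuous_lengthOf L))
  have hℓ : ∀ z k, (lengthOf L (proj ψ z k) : ℂ) ≠ 0 := fun z k => by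
    exact_mod_cast ((hLpos b₀).trans_le (le_lengthOf hψ hb₀ z k)).ne'
  simp only [Function.comp_apply, div_self (hℓ _ _), ← Complex.ofReal_sum, sum_lengthOf hψ,
    Finset.sum_const, Finset.card_range, nsmul_eq_mul, mul_one, integral_const,
    probReal_univ, one_smul] at h2
  have h3 := (h1.div h2 (by
    refine mul_ne_zero (by simp [hπ]) ?_
    exact_mod_cast (by positivity : (2 * ∑ b, L b) ≠ 0))).const_mul (meanLength L : ℂ)
  have hlim : (meanLength L : ℂ) * ((2 * Real.pi : ℂ)⁻¹ *
      (∫ z, ∑ k, traceMul A (proj ψ z k) ^ m ∂torusMeasure B) /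
        ((2 * Real.pi : ℂ)⁻¹ * ((2 * ∑ b, L b : ℝ) : ℂ))) =
      ∫ z, meanMoment A m (ψ z) ∂torusMeasure B := by
    simp only [meanMoment_eq]
    rw [integral_const_mul, hmean, Complex.ofReal_mul]
    push_cast at hsumne ⊢
    field_simp
  rw [hlim] at h3
  refine h3.congr fun N => ?_
  have hN : (lam N : ℂ) ≠ 0 := by exact_mod_cast (hs.pos N).ne'
  simp only [expectation_bondLength]
  simp only [← traceMul_proj, Pi.div_apply]
  have h4 : ∀ n, traceMul A (proj ψ (flow L (lam n)) (j n)) ^ m /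
      ((lengthOf L (proj ψ (flow L (lam n)) (j n)) : ℂ) / (meanLength L : ℂ)) =
      (meanLength L : ℂ) * (traceMul A (proj ψ (flow L (lam n)) (j n)) ^ m /
        (lengthOf L (proj ψ (flow L (lam n)) (j n)) : ℂ)) := fun n => by
    rw [div_div_eq_mul_div, mul_comm, mul_div_assoc]
  simp only [h4, ← Finset.mul_sum]
  rw [mul_div_mul_left _ _ (inv_ne_zero hN), div_eq_inv_mul]
  ring

end Moments

end QuantumGraph

end

/-! ### The theorem -/

open QuantumGraph in
theorem theorem2 (B : ℕ) (hB : 0 < B)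
    (S₀ : Matrix (DirBond B) (DirBond B) ℂ) (hS₀ : S₀ ∈ Matrix.unitaryGroup (DirBond B) ℂ)
    (L : Fin B → ℝ) (hLpos : ∀ b, 0 < L b) (hL : LinearIndependent ℚ L) :
    (∃ ψ, IsEigenvectorChoice S₀ ψ ∧ IsRegularChoice L ψ) ∧
    ((∃ z, HasSimpleSpectrum (evolution S₀ z)) →
      ∀ ψ, IsEigenvectorChoice S₀ ψ → IsRegularChoice L ψ) ∧
    ∀ ψ, IsEigenvectorChoice S₀ ψ → IsRegularChoice L ψ →
      ∀ (lam : ℕ → ℝ) (j : ℕ → DirBond B), IsSpectralSequence S₀ L ψ lam j →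
      ∀ (A : Matrix (DirBond B) (DirBond B) ℂ) (m : ℕ),
        Integrable (fun x => meanMoment A m (ψ (expTorus x))) (uniformTorus B) ∧
        (∀ Λ : ℝ, IntervalIntegrable (fun t => meanMoment A m (ψ (flow L t))) volume 0 Λ) ∧
        Tendsto (fun N : ℕ => (N : ℂ)⁻¹ * ∑ n ∈ Finset.range N,
            expectation A (ψ (flow L (lam n)) (j n)) ^ m /
              (expectation (bondLength L) (ψ (flow L (lam n)) (j n)) / (meanLength L : ℂ)))
          atTop (𝓝 (∫ x, meanMoment A m (ψ (expTorus x)) ∂uniformTorus B)) ∧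
        Tendsto (fun Λ : ℝ => (Λ : ℂ)⁻¹ * ∫ t in (0 : ℝ)..Λ, meanMoment A m (ψ (flow L t)))
          atTop (𝓝 (∫ x, meanMoment A m (ψ (expTorus x)) ∂uniformTorus B)) := by
  refine ⟨exists_isRegularChoice hL hS₀, fun ⟨z, hz⟩ ψ hψ => isRegularChoice_of_evolution hL hS₀ hz hψ,
    fun ψ hψ hreg lam j hs A m => ?_⟩
  obtain ⟨U, hU⟩ := hreg.exists_isExceptionalSet
  obtain ⟨C, hC⟩ := exists_norm_meanMoment_le hψ A m
  have hc := continuousAt_meanMoment hU A m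
  have hi : Integrable (fun z => meanMoment A m (ψ z)) (torusMeasure B) :=
    integrable_of_bounded_of_continuousAt_compl hU.isClosed hU.measure_eq_zero hc hC
  rw [integral_comp_expTorus (f := fun z => meanMoment A m (ψ z)) hi]
  exact ⟨integrable_comp_expTorus hi,
    intervalIntegrable_flow hU.isClosed hU.volume_flow (f := fun z => meanMoment A m (ψ z)) hc hC 0,
    tendsto_spectralAverage hB hs hS₀ hψ hLpos hL hU A m,
    tendsto_timeAverage hL hU.isClosed hU.rotate_mem hU.measure_eq_zero hU.volume_flow
      (f := fun z => meanMoment A m (ψ z)) hc hC⟩
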